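/- **Theorem (Pure SRD Case).** Let $\{\epsilon_i\}_{i\in\mathbb Z}$ be i.i.d. real random variables with mean $0$ and variance $1$. For $j=1,\dots,J$ let $k_j\ge 1$ be an integer, let $(a_{i,j})_{i\ge 1}$ be real numbers, and consider the multilinear polynomial-form process $$X_j(n)=\sum_{1\le i_1<\dots<i_{k_j}<\infty} a_{i_1,j}\cdots a_{i_{k_j},j}\,\epsilon_{n-i_1}\cdots\epsilon_{n-i_{k_j}},\qquad n\in\mathbb Z,$$ the series being taken in $L^2$. Put $\gamma_{p,q}(n)=\mathrm{Cov}(X_p(n),X_q(0))$ and $\gamma_p=\gamma_{p,p}$. Assume that every $X_j$ is short-range dependent (SRD): there are $d_j<\frac12\left(1-\frac1{k_j}\right)$ and $c_j>0$ with $|a_{i,j}|\le c_j\, i^{d_j-1}$ for all $i\ge1$, and $\sum_{n=-\infty}^{\infty}\gamma_j(n)>0$. Let $$Y_{j,N}(t)=\frac1{A_j(N)}\sum_{n=1}^{[Nt]}X_j(n),\quad t\ge0,$$ where the $A_j(N)$ are real normalization factors, positive for all large $N$, such that $\lim_{N\to\infty}\mathrm{Var}[Y_{j,N}(1)]=1$.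 Then $\sum_{n}|\gamma_{p,q}(n)|<\infty$ for all $p,q$, and with $$\sigma_p^2=\sum_{n=-\infty}^\infty\gamma_p(n),\quad \sigma_p>0,\qquad \sigma_{p,q}=\sum_{n=-\infty}^\infty\gamma_{p,q}(n),$$ there is a multivariate Gaussian process $\mathbf B(t)=(B_1(t),\dots,B_J(t))$, $t\ge 0$, whose components $B_1,\dots,B_J$ are standard Brownian motions, with $$\mathrm{Cov}(B_p(s),B_q(t))=(s\wedge t)\,\frac{\sigma_{p,q}}{\sigma_p\sigma_q}\qquad (s,t\ge0,\ 1\le p,q\le J),$$ such that, as $N\to\infty$, $(Y_{1,N}(t),\dots,Y_{J,N}(t))_{t\ge 0}$ converges to $\mathbf B$ in the sense of convergence of finite-dimensional distributions. Moreover $A_j(N)\sim\sigma_j\sqrt N$ as $N\to\infty$ for every $j$. -/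

import Mathlib

open MeasureTheory ProbabilityTheory Filter Topology
open scoped NNReal ENNReal

namespace PolyForm

/-- `{ε i}` is an i.i.d. sequence of random variables with mean `0` and variance `1`. -/
structure IsStdNoise {Ω : Type*} [MeasurableSpace Ω] (P : Measure Ω) (ε : ℤ → Ω → ℝ) : Prop where
  measurable : ∀ i, Measurable (ε i)
  indep : iIndepFun ε P
  identDistrib : ∀ i, IdentDistrib (ε i) (ε 0) P P
  memLp : MemLp (ε 0) 2 P
  mean : P[ε 0] = 0
  variance : Var[ε 0; P] = 1

/-- The index set of the sum: the tuples `1 ≤ i₁ < ⋯ < i_k < ∞`, each encoded as the set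
`{i₁, …, i_k}` of its entries. -/
abbrev Idx (k : ℕ) : Type := {s : Finset ℕ+ // s.card = k}

/-- The summand `a_{i₁} ⋯ a_{i_k} ε_{n-i₁} ⋯ ε_{n-i_k}`. -/
def term {Ω : Type*} (ε : ℤ → Ω → ℝ) (a : ℕ+ → ℝ) {k : ℕ} (n : ℤ) (s : Idx k) (ω : Ω) : ℝ :=
  ∏ i ∈ s.1, a i * ε (n - (i : ℕ)) ω

open Classical in
/-- The class in `L²(P)` of a square-integrable function (and `0` for any other function). -/
noncomputable def toL2 {Ω : Type*} [MeasurableSpace Ω] (P : Measure Ω) (f : Ω → ℝ) : Lp ℝ 2 P :=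
  if h : MemLp f 2 P then h.toLp f else 0

/-- The multilinear polynomial-form process of order `k` with coefficients `a`,
`X(n) = ∑_{1 ≤ i₁ < ⋯ < i_k < ∞} a_{i₁} ⋯ a_{i_k} ε_{n-i₁} ⋯ ε_{n-i_k}`, where the sum is taken
in `L²(P)`. See `tendsto_process` for its convergence. -/
noncomputable def process {Ω : Type*} [MeasurableSpace Ω] (P : Measure Ω) (ε : ℤ → Ω → ℝ)
    (a : ℕ+ → ℝ) (k : ℕ) (n : ℤ) : Ω → ℝ :=
  ⇑(∑' s : Idx k, toL2 P (term ε a n s))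

/-- The covariance `Cov(X(n), X'(0))` of two polynomial-form processes built on the same noise. -/
noncomputable def crossCov {Ω : Type*} [MeasurableSpace Ω] (P : Measure Ω) (ε : ℤ → Ω → ℝ)
    (a : ℕ+ → ℝ) (k : ℕ) (a' : ℕ+ → ℝ) (k' : ℕ) (n : ℤ) : ℝ :=
  cov[process P ε a k n, process P ε a' k' 0; P]

/-- Short-range dependence of the polynomial-form process of order `k` with coefficients `a`. -/
def IsSRD {Ω : Type*} [MeasurableSpace Ω] (P : Measure Ω) (ε : ℤ → Ω → ℝ)
    (a : ℕ+ → ℝ) (k : ℕ) : Prop :=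
  (∃ d : ℝ, d < 1 / 2 * (1 - 1 / (k : ℝ)) ∧ ∃ c : ℝ, 0 < c ∧
    ∀ i : ℕ+, |a i| ≤ c * ((i : ℕ) : ℝ) ^ (d - 1)) ∧
  0 < ∑' n : ℤ, crossCov P ε a k a k n

/-- The normalized partial sum `A(N)⁻¹ ∑_{n=1}^{[Nt]} X(n)`. -/
noncomputable def partialSum {Ω : Type*} (A : ℕ → ℝ) (X : ℤ → Ω → ℝ) (N : ℕ) (t : ℝ≥0)
    (ω : Ω) : ℝ :=
  1 / A N * ∑ n ∈ Finset.Icc 1 ⌊(N : ℝ≥0) * t⌋₊, X (n : ℤ) ω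

/-- Convergence in finite-dimensional distributions of the processes `Y N` to the process `B`,
as `N → ∞`. -/
def TendstoFDD {T E Ω Ω' : Type*} [TopologicalSpace E] [MeasurableSpace E]
    [SecondCountableTopology E] [OpensMeasurableSpace E] [MeasurableSpace Ω] [MeasurableSpace Ω']
    (Y : ℕ → T → Ω → E) (B : T → Ω' → E)
    (P : Measure Ω) [IsProbabilityMeasure P] (P' : Measure Ω') [IsProbabilityMeasure P'] : Prop :=
  ∀ I : Finset T, TendstoInDistribution (fun N ω (t : I) => Y N t ω) atTop
    (fun ω (t : I) => B t ω) (fun _ => P) P'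

/-! ### The series defining the process converges in `L²` -/

section WellDefined

variable {Ω : Type*} [MeasurableSpace Ω] {P : Measure Ω} {ε : ℤ → Ω → ℝ}

lemma IsStdNoise.memLp_all (h : IsStdNoise P ε) (i : ℤ) : MemLp (ε i) 2 P :=
  (h.identDistrib i).symm.memLp_snd h.memLp

lemma IsStdNoise.mean_all (h : IsStdNoise P ε) (i : ℤ) : ∫ ω, ε i ω ∂P = 0 :=
  (h.identDistrib i).integral_eq.trans h.mean

lemma IsStdNoise.sq_all (h : IsStdNoise P ε) (i : ℤ) : ∫ ω, ε i ω ^ 2 ∂P = 1 := by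
  have h1 := (h.identDistrib i).variance_eq.trans h.variance
  rwa [variance_of_integral_eq_zero (h.measurable i).aemeasurable (h.mean_all i)] at h1

lemma IsStdNoise.indep_shift (h : IsStdNoise P ε) (n : ℤ) :
    iIndepFun (fun i : ℕ+ => ε (n - (i : ℕ))) P :=
  h.indep.precomp (g := fun i : ℕ+ => n - ((i : ℕ) : ℤ)) (by
    intro i j hij
    have : ((i : ℕ) : ℤ) = ((j : ℕ) : ℤ) := by simpa using hij
    exact PNat.coe_injective (by exact_mod_cast this))

lemma IsStdNoise.memLp_prod (h : IsStdNoise P ε) (n : ℤ) (s : Finset ℕ+) :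
    MemLp (fun ω => ∏ i ∈ s, ε (n - (i : ℕ)) ω) 2 P := by
  have : IsProbabilityMeasure P := h.indep.isProbabilityMeasure
  rw [memLp_two_iff_integrable_sq
    (Finset.measurable_fun_prod s fun i _ => h.measurable _).aestronglyMeasurable]
  have hi : iIndepFun (fun i : ℕ+ => fun ω => ε (n - (i : ℕ)) ω ^ 2) P :=
    (h.indep_shift n).comp (fun _ x => x ^ 2) (fun _ => by fun_prop)
  have hm : ∀ i : ℕ+, Measurable (fun ω => ε (n - (i : ℕ)) ω ^ 2) :=
    fun i => (h.measurable _).pow_const 2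
  have key : ∀ s : Finset ℕ+, Integrable (∏ i ∈ s, fun ω => ε (n - (i : ℕ)) ω ^ 2) P := by
    intro s
    induction s using Finset.cons_induction with
    | empty => exact integrable_const (1 : ℝ)
    | cons i s his ih =>
      rw [Finset.prod_cons]
      exact (hi.indepFun_finsetProd_of_notMem hm his).symm.integrable_mul
        (h.memLp_all _).integrable_sq ih
  refine (key s).congr (ae_of_all _ fun ω => ?_)
  simp [Finset.prod_apply, Finset.prod_pow]

lemma IsStdNoise.integral_prod_mul_prod (h : IsStdNoise P ε) (n : ℤ) (s t : Finset ℕ+) :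
    ∫ ω, (∏ i ∈ s, ε (n - (i : ℕ)) ω) * ∏ i ∈ t, ε (n - (i : ℕ)) ω ∂P =
      if s = t then 1 else 0 := by
  have hX : iIndepFun (fun i : ↥(s ∪ t) => ε (n - ((i : ℕ+) : ℕ))) P :=
    (h.indep_shift n).precomp (g := fun i : ↥(s ∪ t) => (i : ℕ+)) Subtype.val_injective
  have hI := hX.integral_fun_prod_comp
    (f := fun (i : ↥(s ∪ t)) (x : ℝ) =>
      (if (i : ℕ+) ∈ s then x else 1) * (if (i : ℕ+) ∈ t then x else 1))
    (fun i => (h.measurable _).aemeasurable) (fun i => by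
      refine Measurable.aestronglyMeasurable ?_
      split_ifs <;> fun_prop)
  have e : ∀ x : ℕ+ → ℝ, (∏ i : ↥(s ∪ t), ((if (i : ℕ+) ∈ s then x i else 1) *
      (if (i : ℕ+) ∈ t then x i else 1))) = (∏ i ∈ s, x i) * ∏ i ∈ t, x i := by
    intro x
    rw [Finset.prod_coe_sort (s ∪ t)
      (fun i => (if i ∈ s then x i else 1) * (if i ∈ t then x i else 1)),
      Finset.prod_mul_distrib, Finset.prod_ite_mem, Finset.prod_ite_mem]
    congr 2 <;> ext i <;> simp +contextual
  have e' : ∀ ω, (∏ i : ↥(s ∪ t), ((if (i : ℕ+) ∈ s then ε (n - ((i : ℕ+) : ℕ)) ω else 1) *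
      (if (i : ℕ+) ∈ t then ε (n - ((i : ℕ+) : ℕ)) ω else 1))) =
      (∏ i ∈ s, ε (n - (i : ℕ)) ω) * ∏ i ∈ t, ε (n - (i : ℕ)) ω :=
    fun ω => e fun i => ε (n - (i : ℕ)) ω
  simp_rw [e'] at hI
  rw [hI]
  split_ifs with hst
  · subst hst
    refine Finset.prod_eq_one fun i _ => ?_
    have hi : (i : ℕ+) ∈ s := by simpa using i.2
    simpa [hi, ← sq] using h.sq_all _
  · have : ∃ i ∈ s ∪ t, ¬ (i ∈ s ↔ i ∈ t) := by
      by_contra! hc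
      refine hst (Finset.ext fun i => ?_)
      by_cases hi : i ∈ s ∪ t
      · exact hc i hi
      · simp only [Finset.mem_union, not_or] at hi
        simp [hi.1, hi.2]
    obtain ⟨i, hi, hne⟩ := this
    refine Finset.prod_eq_zero (Finset.mem_univ ⟨i, hi⟩) ?_
    by_cases h1 : i ∈ s <;> by_cases h2 : i ∈ t
    · simp [h1, h2] at hne
    · simpa [h1, h2] using h.mean_all _
    · simpa [h1, h2] using h.mean_all _
    · simp [h1, h2] at hne

lemma IsStdNoise.memLp_term (h : IsStdNoise P ε) (a : ℕ+ → ℝ) {k : ℕ} (n : ℤ) (s : Idx k) :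
    MemLp (term ε a n s) 2 P := by
  have : term ε a n s = fun ω => (∏ i ∈ s.1, a i) * ∏ i ∈ s.1, ε (n - (i : ℕ)) ω := by
    funext ω
    simp [term, Finset.prod_mul_distrib]
  rw [this]
  exact (h.memLp_prod n s.1).const_mul _

lemma summable_prod_sq {a : ℕ+ → ℝ} (ha : Summable fun i => a i ^ 2) (k : ℕ) :
    Summable fun s : Idx k => ‖∏ i ∈ s.1, a i‖ ^ 2 := by
  classical
  refine summable_of_sum_le (c := Real.exp (∑' i, a i ^ 2)) (fun _ => by positivity) fun F => ?_
  set U : Finset ℕ+ := F.sup Subtype.val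
  have h1 : ∑ s ∈ F, ‖∏ i ∈ s.1, a i‖ ^ 2 ≤ ∑ s ∈ U.powerset, ∏ i ∈ s, a i ^ 2 := by
    have h0 := Finset.sum_map F (Function.Embedding.subtype fun s : Finset ℕ+ => s.card = k)
      fun s => ‖∏ i ∈ s, a i‖ ^ 2
    simp only [Function.Embedding.subtype_apply] at h0
    rw [← h0]
    simp_rw [Real.norm_eq_abs, sq_abs, ← Finset.prod_pow]
    refine Finset.sum_le_sum_of_subset_of_nonneg ?_ fun _ _ _ =>
      Finset.prod_nonneg fun _ _ => sq_nonneg _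
    intro s hs
    simp only [Finset.mem_map, Function.Embedding.subtype_apply] at hs
    obtain ⟨x, hx, rfl⟩ := hs
    exact Finset.mem_powerset.2 (Finset.le_sup (f := Subtype.val) hx)
  refine h1.trans ?_
  rw [← Finset.prod_one_add]
  exact (Real.prod_one_add_le_exp_sum U fun _ => sq_nonneg _).trans
    (Real.exp_le_exp.2 (ha.sum_le_tsum U fun _ _ => sq_nonneg _))

/-- If `∑ a_i² < ∞`, the series of `process P ε a k n` converges unconditionally in `L²`. -/
theorem summable_process (h : IsStdNoise P ε) {a : ℕ+ → ℝ} (ha : Summable fun i => a i ^ 2)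
    (k : ℕ) (n : ℤ) : Summable fun s : Idx k => toL2 P (term ε a n s) := by
  classical
  set e : Idx k → Lp ℝ 2 P := fun s => (h.memLp_prod n s.1).toLp _ with he
  have hterm : ∀ s : Idx k, toL2 P (term ε a n s) = (∏ i ∈ s.1, a i) • e s := by
    intro s
    rw [toL2, dif_pos (h.memLp_term a n s), he, ← MemLp.toLp_const_smul]
    refine MemLp.toLp_congr _ _ (ae_of_all _ fun ω => ?_)
    simp [term, Finset.prod_mul_distrib]
  have hon : Orthonormal ℝ e := by
    rw [orthonormal_iff_ite]
    intro s t
    rw [L2.inner_def]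
    have := h.integral_prod_mul_prod n s.1 t.1
    simp only [Subtype.ext_iff]
    rw [← this]
    refine integral_congr_ae ?_
    filter_upwards [(h.memLp_prod n s.1).coeFn_toLp, (h.memLp_prod n t.1).coeFn_toLp]
      with ω h1 h2
    simp [he, h1, h2, mul_comm]
  simp_rw [hterm]
  exact (hon.orthogonalFamily.summable_iff_norm_sq_summable fun s => ∏ i ∈ s.1, a i).2
    (summable_prod_sq ha k)

/-- If `∑ a_i² < ∞`, then `process P ε a k n` is the `L²` limit of the finite partial sums. -/
theorem tendsto_process (h : IsStdNoise P ε) {a : ℕ+ → ℝ} (ha : Summable fun i => a i ^ 2)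
    (k : ℕ) (n : ℤ) :
    Tendsto (fun F : Finset (Idx k) =>
      eLpNorm (fun ω => ∑ s ∈ F, term ε a n s ω - process P ε a k n ω) 2 P) atTop (𝓝 0) := by
  have h1 := (Lp.tendsto_Lp_iff_tendsto_eLpNorm' _ _).1 (summable_process h ha k n).hasSum
  refine h1.congr fun F => eLpNorm_congr_ae ?_
  have h2 : ∀ s : Idx k, toL2 P (term ε a n s) =ᵐ[P] term ε a n s := fun s => by
    rw [toL2, dif_pos (h.memLp_term a n s)]
    exact MemLp.coeFn_toLp _
  have h3 : ∀ᵐ ω ∂P, ∀ s ∈ F, toL2 P (term ε a n s) ω = term ε a n s ω :=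
    (ae_ball_iff F.countable_toSet).2 fun s _ => h2 s
  filter_upwards [h3, Lp.coeFn_finsetSum F fun s => toL2 P (term ε a n s)] with ω h4 h5
  rw [Pi.sub_apply, h5]
  simp [process, Finset.sum_apply, Finset.sum_congr rfl h4]

end WellDefined

end PolyForm

namespace PolyForm

/-! ### Orthonormal expansions -/

section Orthonormal

variable {ι H : Type*} [NormedAddCommGroup H] [InnerProductSpace ℝ H] [CompleteSpace H]

/-! The products `∏ i ∈ A, ε i`, over finite sets `A` of integers, are orthonormal in `L²`. Each
process is an expansion in this one family, and moving time translates the coefficients. All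
second-order quantities are therefore correlations of coefficient families with their own
translates, and no moment of the noise beyond the second is used.

Short memory: for `b i = c * i ^ (d - 1)` the correlation `∑ b i * b (i + l)` is `O((1 + |l|) ^
(-β))` for some `β > 1 / k`, because `1 - 2 * d > 1 / k`. The order-`k` form has lag correlations
bounded by an elementary symmetric function, hence by a constant times the `k`-th power of that
bound. This is summable since `β * k > 1` (`shiftSummable_coeff_powerSeq`). It follows that
covariances are absolutely summable, that sums of `M` terms have squared norm at most `M` times a
constant (`norm_sq_sum_le`), and that this constant tends to zero for the part of the form depending
on variables older than `m` (`tendsto_totalCorr_tailPart`).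

Central limit theorem: after truncation to `m` variables, the time axis is cut into blocks of length
`L` and the first `m` terms of each are discarded. The block sums are functions of disjoint
stretches of noise, hence i.i.d., and the discarded part is small in `L²` for `m` large and then `L`
large (`norm_sumVec_sub_blocks_le`). The array theorem `tendsto_charFun_array` compares
characteristic functions with Gaussian ones of the same variance. This comparison survives `L²`
approximation (`tendsto_charFun_sub_of_approx`), so variances need only be computed at the end, as
Cesàro averages (`tendsto_average_sub`). The Cramér–Wold device yields the finite-dimensional
limits.

The limit process is built explicitly. The matrix `ρ` of normalized long-run covariances is a limit
of Gram matrices, hence positive semidefinite. Sine series of Brownian bridges driven by independent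
Gaussian vectors of covariance `ρ`, under the time change `t / (1 + t)`, give the correlated
Brownian motions. Their continuity comes from a uniform bound on dyadic-type blocks of the series
(`ae_exists_summable_bound`). -/

lemma summable_orthonormal {e : ι → H} (he : Orthonormal ℝ e) {f : ι → ℝ}
    (hf : Summable fun i => f i ^ 2) : Summable fun i => f i • e i :=
  (he.orthogonalFamily.summable_iff_norm_sq_summable f).2 (by simpa using hf)

lemma hasSum_inner_orthonormal {e : ι → H} (he : Orthonormal ℝ e) {f g : ι → ℝ}
    (hf : Summable fun i => f i ^ 2) (hg : Summable fun i => g i ^ 2) :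
    HasSum (fun i => f i * g i) (inner ℝ (∑' i, f i • e i) (∑' i, g i • e i)) := by
  classical
  have h1 : ∀ i, inner ℝ (∑' j, f j • e j) (g i • e i) = f i * g i := fun i => by
    have := ((summable_orthonormal he hf).hasSum.mapL ((innerSL ℝ).flip (g i • e i))).tsum_eq
    simp only [ContinuousLinearMap.flip_apply, innerSL_apply_apply, inner_smul_left,
      inner_smul_right, orthonormal_iff_ite.1 he] at this
    rw [inner_smul_right, ← this, tsum_eq_single i]
    · simp [mul_comm]
    · intro j hj
      simp [hj]
  have := (summable_orthonormal he hg).hasSum.mapL (innerSL ℝ (∑' j, f j • e j))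
  simpa only [innerSL_apply_apply, h1] using this

end Orthonormal

/-! ### The process as an orthonormal expansion in products of noise variables. -/

section Noise

variable {Ω : Type*} [MeasurableSpace Ω] {P : Measure Ω} {ε : ℤ → Ω → ℝ}

/-- The product `∏_{i ∈ A} ε_i`. -/
def noiseProd (ε : ℤ → Ω → ℝ) (A : Finset ℤ) (ω : Ω) : ℝ := ∏ i ∈ A, ε i ω

/-- The class of `∏_{i ∈ A} ε_i` in `L²(P)`. -/
noncomputable def noiseVec (P : Measure Ω) (ε : ℤ → Ω → ℝ) (A : Finset ℤ) : Lp ℝ 2 P :=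
  toL2 P (noiseProd ε A)

lemma toL2_ae_eq {f : Ω → ℝ} (hf : MemLp f 2 P) : toL2 P f =ᵐ[P] f := by
  rw [toL2, dif_pos hf]
  exact hf.coeFn_toLp

lemma IsStdNoise.measurable_noiseProd (h : IsStdNoise P ε) (A : Finset ℤ) :
    Measurable (noiseProd ε A) :=
  Finset.measurable_fun_prod A fun i _ => h.measurable i

lemma IsStdNoise.memLp_noiseProd (h : IsStdNoise P ε) (A : Finset ℤ) :
    MemLp (noiseProd ε A) 2 P := by
  have : IsProbabilityMeasure P := h.indep.isProbabilityMeasure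
  rw [memLp_two_iff_integrable_sq (h.measurable_noiseProd A).aestronglyMeasurable]
  have hi : iIndepFun (fun i : ℤ => fun ω => ε i ω ^ 2) P :=
    h.indep.comp (fun _ x => x ^ 2) (fun _ => by fun_prop)
  have hm : ∀ i : ℤ, Measurable (fun ω => ε i ω ^ 2) := fun i => (h.measurable _).pow_const 2
  have key : ∀ s : Finset ℤ, Integrable (∏ i ∈ s, fun ω => ε i ω ^ 2) P := by
    intro s
    induction s using Finset.cons_induction with
    | empty => exact integrable_const (1 : ℝ)
    | cons i s his ih =>
      rw [Finset.prod_cons]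
      exact (hi.indepFun_finsetProd_of_notMem hm his).symm.integrable_mul
        (h.memLp_all _).integrable_sq ih
  refine (key A).congr (ae_of_all _ fun ω => ?_)
  simp [noiseProd, Finset.prod_apply, Finset.prod_pow]

/-- By independence the expectation factors over `s ∪ t`. An index in both sets contributes the
second moment `1`, an index in only one contributes the mean `0`. -/
lemma IsStdNoise.integral_noiseProd_mul (h : IsStdNoise P ε) (s t : Finset ℤ) :
    ∫ ω, noiseProd ε s ω * noiseProd ε t ω ∂P = if s = t then 1 else 0 := by
  have hX : iIndepFun (fun i : ↥(s ∪ t) => ε (i : ℤ)) P :=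
    h.indep.precomp (g := fun i : ↥(s ∪ t) => (i : ℤ)) Subtype.val_injective
  have hI := hX.integral_fun_prod_comp
    (f := fun (i : ↥(s ∪ t)) (x : ℝ) =>
      (if (i : ℤ) ∈ s then x else 1) * (if (i : ℤ) ∈ t then x else 1))
    (fun i => (h.measurable _).aemeasurable) (fun i => by
      refine Measurable.aestronglyMeasurable ?_
      split_ifs <;> fun_prop)
  have e : ∀ ω, (∏ i : ↥(s ∪ t), ((if (i : ℤ) ∈ s then ε i ω else 1) *
      (if (i : ℤ) ∈ t then ε i ω else 1))) = noiseProd ε s ω * noiseProd ε t ω := by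
    intro ω
    rw [noiseProd, noiseProd, Finset.prod_coe_sort (s ∪ t)
      (fun i => (if i ∈ s then ε i ω else 1) * (if i ∈ t then ε i ω else 1)),
      Finset.prod_mul_distrib, Finset.prod_ite_mem, Finset.prod_ite_mem]
    congr 2 <;> ext i <;> simp +contextual
  simp_rw [e] at hI
  rw [hI]
  split_ifs with hst
  · subst hst
    refine Finset.prod_eq_one fun i _ => ?_
    have hi : (i : ℤ) ∈ s := by simpa using i.2
    simpa [hi, ← sq] using h.sq_all _
  · have : ∃ i ∈ s ∪ t, ¬ (i ∈ s ↔ i ∈ t) := by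
      by_contra! hc
      refine hst (Finset.ext fun i => ?_)
      by_cases hi : i ∈ s ∪ t
      · exact hc i hi
      · simp only [Finset.mem_union, not_or] at hi
        simp [hi.1, hi.2]
    obtain ⟨i, hi, hne⟩ := this
    refine Finset.prod_eq_zero (Finset.mem_univ ⟨i, hi⟩) ?_
    by_cases h1 : i ∈ s <;> by_cases h2 : i ∈ t
    · simp [h1, h2] at hne
    · simpa [h1, h2] using h.mean_all _
    · simpa [h1, h2] using h.mean_all _
    · simp [h1, h2] at hne

lemma IsStdNoise.orthonormal (h : IsStdNoise P ε) : Orthonormal ℝ (noiseVec P ε) := by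
  classical
  rw [orthonormal_iff_ite]
  intro s t
  rw [L2.inner_def, ← h.integral_noiseProd_mul s t]
  refine integral_congr_ae ?_
  filter_upwards [toL2_ae_eq (h.memLp_noiseProd s), toL2_ae_eq (h.memLp_noiseProd t)] with ω h1 h2
  simp [noiseVec, h1, h2, mul_comm]

/-- The coefficient of `∏_{i ∈ A} ε_i` in the polynomial form of order `k` at time `n`. -/
def coeff (b : ℤ → ℝ) (k : ℕ) (n : ℤ) (A : Finset ℤ) : ℝ :=
  if A.card = k then ∏ i ∈ A, b (n - i) else 0

/-- The value at time `n` of the polynomial form of order `k`, as an element of `L²(P)`. -/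
noncomputable def formVec (P : Measure Ω) (ε : ℤ → Ω → ℝ) (b : ℤ → ℝ) (k : ℕ) (n : ℤ) :
    Lp ℝ 2 P :=
  ∑' A, coeff b k n A • noiseVec P ε A

/-- Extension by zero of a sequence indexed by the positive integers. -/
def extendZero (a : ℕ+ → ℝ) (i : ℤ) : ℝ := if h : 0 < i then a ⟨i.toNat, by omega⟩ else 0

lemma extendZero_coe (a : ℕ+ → ℝ) (i : ℕ+) : extendZero a ((i : ℕ) : ℤ) = a i := by
  rw [extendZero, dif_pos (by exact_mod_cast i.pos)]
  rfl

lemma extendZero_of_nonpos (a : ℕ+ → ℝ) {i : ℤ} (hi : i ≤ 0) : extendZero a i = 0 :=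
  dif_neg hi.not_gt

/-- The set `{n - i₁, …, n - i_k}`. -/
def reflect (n : ℤ) : ℕ+ ↪ ℤ :=
  ⟨fun i => n - ((i : ℕ) : ℤ), fun i j hij => by
    have : ((i : ℕ) : ℤ) = ((j : ℕ) : ℤ) := by simpa using hij
    exact PNat.coe_injective (by exact_mod_cast this)⟩

lemma reflect_apply (n : ℤ) (i : ℕ+) : reflect n i = n - ((i : ℕ) : ℤ) := rfl

/-- Reflecting the index sets through `n` makes the orthonormal family independent of `n`, so that
processes at different times are expanded in the same basis. A set of size `k` that is not a
reflection contains some `i ≥ n`, where the extension by zero kills the coefficient. -/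
lemma process_eq_formVec (h : IsStdNoise P ε) (a : ℕ+ → ℝ) (k : ℕ) (n : ℤ) :
    process P ε a k n = ⇑(formVec P ε (extendZero a) k n) := by
  rw [process, formVec]
  have hinj : Function.Injective fun s : Idx k => s.1.map (reflect n) := fun s t hst =>
    Subtype.ext (Finset.map_injective _ hst)
  rw [← hinj.tsum_eq]
  · congr 2
    refine tsum_congr fun s => ?_
    have hc : coeff (extendZero a) k n (s.1.map (reflect n)) = ∏ i ∈ s.1, a i := by
      simp [coeff, s.2, reflect_apply, extendZero_coe]
    rw [hc, toL2, dif_pos (h.memLp_term a n s), noiseVec, toL2, dif_pos (h.memLp_noiseProd _),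
      ← MemLp.toLp_const_smul]
    refine MemLp.toLp_congr _ _ (ae_of_all _ fun ω => ?_)
    simp [term, noiseProd, Finset.prod_mul_distrib, reflect_apply]
  · intro A hA
    have hA' : coeff (extendZero a) k n A ≠ 0 := fun h0 => hA (by simp [h0])
    have hk : A.card = k := by
      by_contra hk
      simp [coeff, hk] at hA'
    rw [coeff, if_pos hk, Finset.prod_ne_zero_iff] at hA'
    have hpos : ∀ i ∈ A, i ∈ Set.range (reflect n) := fun i hi => by
      have : 0 < n - i := by
        by_contra hneg
        exact hA' i hi (extendZero_of_nonpos a (not_lt.1 hneg))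
      exact ⟨(n - i).toNat.toPNat (by omega), by
        rw [reflect_apply]
        change n - (((n - i).toNat : ℕ) : ℤ) = i
        omega⟩
    obtain ⟨s, hs⟩ : ∃ s : Finset ℕ+, s.map (reflect n) = A := by
      refine ⟨A.preimage (reflect n) (reflect n).injective.injOn, ?_⟩
      ext i
      simp only [Finset.mem_map, Finset.mem_preimage]
      constructor
      · rintro ⟨j, hj, rfl⟩
        exact hj
      · intro hi
        obtain ⟨j, rfl⟩ := hpos i hi
        exact ⟨j, hi, rfl⟩
    exact ⟨⟨s, by rw [← hk, ← hs, Finset.card_map]⟩, hs⟩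

lemma hasSum_inner_formVec (h : IsStdNoise P ε) {b b' : ℤ → ℝ} {k k' : ℕ} {n n' : ℤ}
    (hb : Summable fun A => coeff b k n A ^ 2) (hb' : Summable fun A => coeff b' k' n' A ^ 2) :
    HasSum (fun A => coeff b k n A * coeff b' k' n' A)
      (inner ℝ (formVec P ε b k n) (formVec P ε b' k' n')) :=
  hasSum_inner_orthonormal h.orthonormal hb hb'

/-- The mean is the inner product with the empty product `1`, and the empty set carries no
coefficient when `k > 0`. -/
lemma integral_formVec (h : IsStdNoise P ε) {b : ℤ → ℝ} {k : ℕ} (hk : 0 < k) {n : ℤ}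
    (hb : Summable fun A => coeff b k n A ^ 2) : ∫ ω, formVec P ε b k n ω ∂P = 0 := by
  classical
  have : IsProbabilityMeasure P := h.indep.isProbabilityMeasure
  have h1 : inner ℝ (noiseVec P ε ∅) (formVec P ε b k n) = 0 := by
    have := (summable_orthonormal h.orthonormal hb).hasSum.mapL (innerSL ℝ (noiseVec P ε ∅))
    refine this.unique ?_
    convert hasSum_zero with A
    simp only [innerSL_apply_apply, inner_smul_right, orthonormal_iff_ite.1 h.orthonormal]
    split_ifs with hA
    · subst hA
      simp [coeff, hk.ne]
    · simp
  rw [← h1, L2.inner_def]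
  refine integral_congr_ae ?_
  filter_upwards [toL2_ae_eq (h.memLp_noiseProd ∅)] with ω h2
  simp [noiseVec, h2, noiseProd]

lemma covariance_coe_Lp [IsProbabilityMeasure P] (f g : Lp ℝ 2 P) (hf : ∫ ω, f ω ∂P = 0) :
    cov[f, g; P] = inner ℝ f g := by
  rw [covariance_eq_sub (Lp.memLp f) (Lp.memLp g), hf, L2.inner_def]
  simp [mul_comm]

end Noise

end PolyForm

namespace PolyForm

/-! ### Summability of the covariances -/

/-- Translation of finite sets of integers. -/
def shift (l : ℤ) : Finset ℤ ≃ Finset ℤ := (Equiv.addRight l).finsetCongr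

lemma shift_apply (l : ℤ) (A : Finset ℤ) : shift l A = A.map (Equiv.addRight l).toEmbedding := rfl

lemma card_shift (l : ℤ) (A : Finset ℤ) : (shift l A).card = A.card := by
  rw [shift_apply, Finset.card_map]

lemma mem_shift {l i : ℤ} {A : Finset ℤ} : i ∈ shift l A ↔ i - l ∈ A := by
  rw [shift_apply, Finset.mem_map_equiv, Equiv.addRight_symm, Equiv.coe_addRight, sub_eq_add_neg]

lemma shift_zero (A : Finset ℤ) : shift 0 A = A := by
  ext i
  simp [mem_shift]

lemma shift_shift (l m : ℤ) (A : Finset ℤ) : shift l (shift m A) = shift (m + l) A := by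
  simp only [shift_apply, Finset.map_map]
  congr 1
  ext i
  simp [add_assoc]

lemma coeff_shift (b : ℤ → ℝ) (k : ℕ) (n l : ℤ) (A : Finset ℤ) :
    coeff b k n (shift l A) = coeff b k (n - l) A := by
  simp only [coeff, card_shift]
  split_ifs
  · rw [shift_apply, Finset.prod_map]
    refine Finset.prod_congr rfl fun i _ => ?_
    congr 1
    simp
    ring
  · rfl

lemma coeff_nonneg {b : ℤ → ℝ} (hb : ∀ i, 0 ≤ b i) (k : ℕ) (n : ℤ) (A : Finset ℤ) :
    0 ≤ coeff b k n A := by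
  unfold coeff
  split_ifs
  · exact Finset.prod_nonneg fun i _ => hb _
  · rfl

lemma abs_coeff_le {b b' : ℤ → ℝ} (hb : ∀ i, |b i| ≤ b' i) (k : ℕ) (n : ℤ) (A : Finset ℤ) :
    |coeff b k n A| ≤ coeff b' k n A := by
  unfold coeff
  split_ifs
  · rw [Finset.abs_prod]
    exact Finset.prod_le_prod (fun _ _ => abs_nonneg _) fun i _ => hb _
  · simp

/-- The `k`-th elementary symmetric function of a summable family is at most `e p ^ k`. -/
lemma hasSum_esymm_le {u : ℤ → ℝ} (hu0 : ∀ i, 0 ≤ u i) (hu : Summable u) {p : ℝ} (hp : 0 < p)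
    (hup : ∑' i, u i ≤ p) (k : ℕ) :
    Summable (fun A : Finset ℤ => if A.card = k then ∏ i ∈ A, u i else 0) ∧
      ∑' A : Finset ℤ, (if A.card = k then ∏ i ∈ A, u i else 0) ≤ Real.exp 1 * p ^ k := by
  classical
  have hnn : ∀ A : Finset ℤ, 0 ≤ (if A.card = k then ∏ i ∈ A, u i else 0) := fun A => by
    split_ifs
    · exact Finset.prod_nonneg fun i _ => hu0 i
    · rfl
  have key : ∀ F : Finset (Finset ℤ),
      ∑ A ∈ F, (if A.card = k then ∏ i ∈ A, u i else 0) ≤ Real.exp 1 * p ^ k := by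
    intro F
    set U : Finset ℤ := F.sup id
    -- Homogeneity: after dividing `u` by `p` the total mass is at most `1`, so `∏ (1 + u i / p)`,
    -- which dominates all elementary symmetric functions at once, is at most `exp 1`.
    have h1 : ∀ A ∈ F, (if A.card = k then ∏ i ∈ A, u i else 0) ≤ p ^ k * ∏ i ∈ A, u i / p := by
      intro A _
      split_ifs with hA
      · rw [Finset.prod_div_distrib, Finset.prod_const, hA, mul_div_cancel₀]
        positivity
      · exact mul_nonneg (by positivity) (Finset.prod_nonneg fun i _ => div_nonneg (hu0 i) hp.le)
    calc _ ≤ ∑ A ∈ F, p ^ k * ∏ i ∈ A, u i / p := Finset.sum_le_sum h1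
      _ ≤ ∑ A ∈ U.powerset, p ^ k * ∏ i ∈ A, u i / p := by
        refine Finset.sum_le_sum_of_subset_of_nonneg (fun A hA => Finset.mem_powerset.2
          (Finset.le_sup (f := id) hA)) fun A _ _ => mul_nonneg (by positivity)
            (Finset.prod_nonneg fun i _ => div_nonneg (hu0 i) hp.le)
      _ = p ^ k * ∏ i ∈ U, (1 + u i / p) := by rw [← Finset.mul_sum, Finset.prod_one_add]
      _ ≤ p ^ k * Real.exp 1 := by
        refine mul_le_mul_of_nonneg_left ?_ (by positivity)
        refine (Real.prod_one_add_le_exp_sum U fun i => div_nonneg (hu0 i) hp.le).trans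
          (Real.exp_le_exp.2 ?_)
        rw [← Finset.sum_div, div_le_one hp]
        exact (hu.sum_le_tsum U fun i _ => hu0 i).trans hup
      _ = _ := mul_comm _ _
  exact ⟨summable_of_sum_le hnn key, Real.tsum_le_of_sum_le hnn key⟩

/-- The sequence `c i ^ (d - 1)`, extended by zero. -/
noncomputable def powerSeq (c d : ℝ) (i : ℤ) : ℝ := if 0 < i then c * (i : ℝ) ^ (d - 1) else 0

lemma powerSeq_nonneg {c : ℝ} (hc : 0 ≤ c) (d : ℝ) (i : ℤ) : 0 ≤ powerSeq c d i := by
  unfold powerSeq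
  split_ifs with h
  · have : (0 : ℝ) < i := by exact_mod_cast h
    positivity
  · rfl

lemma summable_powerSeq {d : ℝ} (hd : d < 0) : Summable (powerSeq 1 d) := by
  refine Summable.of_nat_of_neg ?_ ?_
  · refine (Real.summable_nat_rpow.2 (by linarith : d - 1 < -1)).of_nonneg_of_le
      (fun n => powerSeq_nonneg zero_le_one _ _) fun n => ?_
    unfold powerSeq
    split_ifs
    · simp
    · positivity
  · convert summable_zero with n
    simp [powerSeq]

/-- The power `y ^ (-α)` is split in two: `y ^ (-β)` supplies the decay in the lag `l`, and the
rest, replaced by the same power of `x`, brings the exponent of `x` to `-(1 + δ)`, summable for `δ >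
0`. -/
lemma rpow_mul_rpow_add_le {α β δ x y l : ℝ} (hx : 0 < x) (hxy : x ≤ y) (hl : 0 ≤ l)
    (hy : 1 + l ≤ y) (h : β = 2 * α - 1 - δ) (hβ : 0 ≤ β) (hδ : α - 1 ≤ δ) :
    x ^ (-α) * y ^ (-α) ≤ (1 + l) ^ (-β) * x ^ (-(1 + δ)) := by
  have hy0 : 0 < y := hx.trans_le hxy
  have h1 : y ^ (-α) = y ^ (-β) * y ^ (-(1 + δ - α)) := by
    rw [← Real.rpow_add hy0]
    congr 1
    linarith
  have h2 : x ^ (-(1 + δ)) = x ^ (-α) * x ^ (-(1 + δ - α)) := by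
    rw [← Real.rpow_add hx]
    congr 1
    linarith
  have h3 : y ^ (-β) ≤ (1 + l) ^ (-β) :=
    Real.rpow_le_rpow_of_nonpos (by linarith) hy (by linarith)
  have h4 : y ^ (-(1 + δ - α)) ≤ x ^ (-(1 + δ - α)) :=
    Real.rpow_le_rpow_of_nonpos hx hxy (by linarith)
  rw [h1, h2]
  calc x ^ (-α) * (y ^ (-β) * y ^ (-(1 + δ - α)))
      ≤ x ^ (-α) * ((1 + l) ^ (-β) * x ^ (-(1 + δ - α))) := by gcongr
    _ = _ := by ring

/-- This is `rpow_mul_rpow_add_le` with `α = 1 - d`. The summable factor belongs to the smaller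
argument; adding both candidates gives a bound symmetric in `x` and `y`. -/
lemma powerSeq_mul_le {c d β δ : ℝ} (h : β = 1 - 2 * d - δ) (hβ : 0 ≤ β) (hδ : -d ≤ δ)
    (x y : ℤ) : powerSeq c d x * powerSeq c d y ≤
      c ^ 2 * (1 + |((x - y : ℤ) : ℝ)|) ^ (-β) * (powerSeq 1 (-δ) x + powerSeq 1 (-δ) y) := by
  have hnn : ∀ z, 0 ≤ powerSeq 1 (-δ) z := fun z => powerSeq_nonneg zero_le_one _ z
  have hR : 0 ≤ c ^ 2 * (1 + |((x - y : ℤ) : ℝ)|) ^ (-β) := by positivity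
  have key : ∀ x y : ℤ, 0 < x → x ≤ y → powerSeq c d x * powerSeq c d y ≤
      c ^ 2 * (1 + |((x - y : ℤ) : ℝ)|) ^ (-β) * powerSeq 1 (-δ) x := by
    intro x y hx hxy
    have hx' : (1 : ℝ) ≤ x := by exact_mod_cast hx
    have hxy' : (x : ℝ) ≤ y := by exact_mod_cast hxy
    have hl : |((x - y : ℤ) : ℝ)| = (y : ℝ) - x := by
      push_cast
      rw [abs_sub_comm, abs_of_nonneg (by linarith)]
    have := rpow_mul_rpow_add_le (α := 1 - d) (β := β) (δ := δ) (x := x) (y := y)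
      (l := (y : ℝ) - x) (by linarith) hxy' (by linarith) (by linarith) (by linarith) hβ
      (by linarith)
    rw [hl]
    simp only [powerSeq, if_pos hx, if_pos (hx.trans_le hxy), one_mul]
    rw [show d - 1 = -(1 - d) by ring, show -δ - 1 = -(1 + δ) by ring]
    calc _ = c ^ 2 * ((x : ℝ) ^ (-(1 - d)) * (y : ℝ) ^ (-(1 - d))) := by ring
      _ ≤ c ^ 2 * ((1 + ((y : ℝ) - x)) ^ (-β) * (x : ℝ) ^ (-(1 + δ))) := by gcongr
      _ = _ := by ring
  by_cases hx : 0 < x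
  · by_cases hy : 0 < y
    · rcases le_total x y with hxy | hxy
      · exact (key x y hx hxy).trans (mul_le_mul_of_nonneg_left (by linarith [hnn y]) hR)
      · have := key y x hy hxy
        rw [show ((y - x : ℤ) : ℝ) = -((x - y : ℤ) : ℝ) by push_cast; ring, abs_neg] at this
        rw [mul_comm]
        exact this.trans (mul_le_mul_of_nonneg_left (by linarith [hnn x]) hR)
    · have : powerSeq c d y = 0 := if_neg hy
      rw [this, mul_zero]
      exact mul_nonneg hR (add_nonneg (hnn _) (hnn _))
  · have : powerSeq c d x = 0 := if_neg hx
    rw [this, zero_mul]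
    exact mul_nonneg hR (add_nonneg (hnn _) (hnn _))

/-- A family of coefficients whose correlations with its translates are summable. -/
def ShiftSummable (B : Finset ℤ → ℝ) : Prop :=
  Summable fun p : ℤ × Finset ℤ => B p.2 * B (shift p.1 p.2)

lemma summable_one_add_abs_rpow {s : ℝ} (hs : 1 < s) :
    Summable fun l : ℤ => (1 + |(l : ℝ)|) ^ (-s) := by
  have h : Summable fun n : ℕ => (1 + (n : ℝ)) ^ (-s) := by
    have := (summable_nat_add_iff 1).2 (Real.summable_nat_rpow.2 (by linarith : -s < -1))
    simpa [add_comm] using this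
  exact Summable.of_nat_of_neg (by simpa using h) (by simpa using h)

lemma hasSum_comp_neg_sub {f : ℤ → ℝ} {s : ℝ} (hf : HasSum f s) (l : ℤ) :
    HasSum (fun i => f (-i - l)) s := by
  have h : (fun i => f (-i - l)) = f ∘ Equiv.subLeft (-l) := by
    funext i
    rw [Function.comp_apply, Equiv.subLeft_apply, show -i - l = -l - i by ring]
  rw [h]
  exact (Equiv.subLeft (-l)).hasSum_iff.2 hf

/-- At lag `l` the sum over `A` is the `k`-th elementary symmetric function of `u l i = b (-i) * b
(-i - l)`, where `b = powerSeq c d`. The total mass of `u l` is `O((1 + |l|) ^ (-β))`, and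
`hasSum_esymm_le` raises this to the power `k`. -/
theorem shiftSummable_coeff_powerSeq {c d : ℝ} (hc : 0 < c) {k : ℕ} (hk : 0 < k)
    (hd : d < 1 / 2 * (1 - 1 / (k : ℝ))) : ShiftSummable (coeff (powerSeq c d) k 0) := by
  have hk1 : (1 : ℝ) ≤ k := by exact_mod_cast hk
  have hk2 : 1 / (k : ℝ) ≤ 1 := by rw [div_le_one (by linarith)]; exact hk1
  -- `δ > 0` makes `i ^ (-(1 + δ))` summable, `δ > -d` is needed by `powerSeq_mul_le`, and the upper
  -- bound says `β > 1 / k`. The interval is nonempty precisely because of the bound on `d` and `1 /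
  -- k ≤ 1`.
  obtain ⟨δ, hδ1, hδ2⟩ : ∃ δ : ℝ, max 0 (-d) < δ ∧ δ < 1 - 2 * d - 1 / k :=
    exists_between (max_lt (by linarith) (by linarith))
  obtain ⟨hδ0, hδd⟩ := max_lt_iff.1 hδ1
  set β := 1 - 2 * d - δ with hβ
  have hβk : 1 / (k : ℝ) < β := by linarith
  have hβ0 : 0 < β := lt_trans (by positivity) hβk
  have hg : Summable (powerSeq 1 (-δ)) := summable_powerSeq (by linarith)
  set G := ∑' i, powerSeq 1 (-δ) i with hG
  have hG0 : 0 ≤ G := tsum_nonneg fun i => powerSeq_nonneg zero_le_one _ _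
  have hb := powerSeq_nonneg hc.le d
  let u : ℤ → ℤ → ℝ := fun l i => powerSeq c d (-i) * powerSeq c d (-i - l)
  let v : ℤ → ℤ → ℝ := fun l i => c ^ 2 * (1 + |(l : ℝ)|) ^ (-β) *
    (powerSeq 1 (-δ) (-i) + powerSeq 1 (-δ) (-i - l))
  have hu0 : ∀ l i, 0 ≤ u l i := fun l i => mul_nonneg (hb _) (hb _)
  have huv : ∀ l i, u l i ≤ v l i := fun l i => by
    have := powerSeq_mul_le (c := c) hβ hβ0.le hδd.le (-i) (-i - l)
    rwa [show -i - (-i - l) = l by ring] at this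
  have hv : ∀ l, HasSum (v l) (c ^ 2 * (1 + |(l : ℝ)|) ^ (-β) * (G + G)) := fun l => by
    have h1 := hasSum_comp_neg_sub hg.hasSum 0
    have h2 := hasSum_comp_neg_sub hg.hasSum l
    simp only [sub_zero] at h1
    exact (h1.add h2).mul_left _
  have hus : ∀ l, Summable (u l) := fun l => (hv l).summable.of_nonneg_of_le (hu0 l) (huv l)
  -- The extra `1` makes `p l` positive using only `0 ≤ G`.
  let p : ℤ → ℝ := fun l => c ^ 2 * (1 + |(l : ℝ)|) ^ (-β) * (G + G + 1)
  have hp : ∀ l, 0 < p l := fun l => by positivity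
  have hup : ∀ l, ∑' i, u l i ≤ p l := fun l => by
    refine ((hus l).tsum_le_tsum (huv l) (hv l).summable).trans ?_
    rw [(hv l).tsum_eq]
    exact mul_le_mul_of_nonneg_left (by linarith) (by positivity)
  have hco : ∀ l A, coeff (powerSeq c d) k 0 A * coeff (powerSeq c d) k 0 (shift l A) =
      if A.card = k then ∏ i ∈ A, u l i else 0 := fun l A => by
    rw [coeff_shift]
    unfold coeff
    split_ifs
    · rw [← Finset.prod_mul_distrib]
      refine Finset.prod_congr rfl fun i _ => ?_
      simp only [u]
      congr 2 <;> ring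
    · simp
  have hes := fun l => hasSum_esymm_le (hu0 l) (hus l) (hp l) (hup l) k
  unfold ShiftSummable
  simp_rw [hco]
  rw [summable_prod_of_nonneg]
  · refine ⟨fun l => (hes l).1, ?_⟩
    refine Summable.of_nonneg_of_le (fun l => tsum_nonneg fun A => ?_) (fun l => (hes l).2) ?_
    · dsimp only
      split_ifs
      · exact Finset.prod_nonneg fun i _ => hu0 l i
      · rfl
    · have hs : Summable fun l : ℤ => (1 + |(l : ℝ)|) ^ (-(β * k)) :=
        summable_one_add_abs_rpow (by rwa [div_lt_iff₀ (by linarith)] at hβk)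
      refine (hs.mul_left (Real.exp 1 * (c ^ 2 * (G + G + 1)) ^ k)).congr fun l => ?_
      have hpl : p l = c ^ 2 * (G + G + 1) * (1 + |(l : ℝ)|) ^ (-β) := by
        simp only [p]
        ring
      rw [hpl, ← neg_mul, Real.rpow_mul (by positivity), Real.rpow_natCast]
      simp only [mul_pow]
      ring
  · intro q
    change 0 ≤ if q.2.card = k then ∏ i ∈ q.2, u q.1 i else 0
    split_ifs
    · exact Finset.prod_nonneg fun i _ => hu0 _ i
    · exact le_rfl

lemma ShiftSummable.of_le {B B' : Finset ℤ → ℝ} (hB : ShiftSummable B) (h0 : ∀ A, 0 ≤ B' A)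
    (hle : ∀ A, B' A ≤ B A) : ShiftSummable B' :=
  Summable.of_nonneg_of_le (fun _ => mul_nonneg (h0 _) (h0 _))
    (fun _ => mul_le_mul (hle _) (hle _) (h0 _) ((h0 _).trans (hle _))) hB

lemma ShiftSummable.summable_sq {B : Finset ℤ → ℝ} (hB : ShiftSummable B) :
    Summable fun A => B A ^ 2 := by
  have := Summable.comp_injective hB (i := fun A : Finset ℤ => ((0 : ℤ), A))
    fun A A' h => by simpa using h
  simpa [Function.comp_def, shift_zero, sq] using this

/-- The total correlation `∑_l ∑_A B(A) B(A + l)`. -/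
noncomputable def totalCorr (B : Finset ℤ → ℝ) : ℝ :=
  ∑' p : ℤ × Finset ℤ, B p.2 * B (shift p.1 p.2)

lemma totalCorr_nonneg {B : Finset ℤ → ℝ} (h0 : ∀ A, 0 ≤ B A) : 0 ≤ totalCorr B :=
  tsum_nonneg fun _ => mul_nonneg (h0 _) (h0 _)

/-! ### Norms of sums of translated expansions. -/

section NormBound

variable {H : Type*} [NormedAddCommGroup H] [InnerProductSpace ℝ H] [CompleteSpace H]

lemma summable_sq_of_shiftSummable {B : Finset ℤ → ℝ} (hB : ShiftSummable B) {β : Finset ℤ → ℝ}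
    {n : ℤ} (hβ : ∀ A, |β A| ≤ B (shift (-n) A)) : Summable fun A => β A ^ 2 := by
  have h := ((shift (-n)).summable_iff (f := fun A => B A ^ 2)).2 hB.summable_sq
  refine h.of_nonneg_of_le (fun A => sq_nonneg _) fun A => ?_
  rw [← sq_abs]
  exact pow_le_pow_left₀ (abs_nonneg _) (hβ A) 2

lemma hasSum_corr_shift {B : Finset ℤ → ℝ} (hB : ShiftSummable B) (n n' : ℤ) :
    HasSum (fun A => B (shift (-n) A) * B (shift (-n') A))
      (∑' A, B A * B (shift (n - n') A)) := by
  have h1 := Summable.comp_injective hB (i := fun A : Finset ℤ => ((n - n' : ℤ), A))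
    fun A A' h => by simpa using h
  have h3 : (fun A => B (shift (-n) A) * B (shift (-n') A)) =
      (fun A => B A * B (shift (n - n') A)) ∘ shift (-n) := by
    funext A
    rw [Function.comp_apply, shift_shift, show -n + (n - n') = -n' by ring]
  rw [h3]
  exact (shift (-n)).hasSum_iff.2 h1.hasSum

/-- A sum of `#F` orthonormal expansions, dominated by the translates of a single family `B`,
has squared norm at most `#F` times the total correlation of `B`. -/
theorem norm_sq_sum_le {e : Finset ℤ → H} (he : Orthonormal ℝ e) {B : Finset ℤ → ℝ}
    (h0 : ∀ A, 0 ≤ B A) (hB : ShiftSummable B) {β : ℤ → Finset ℤ → ℝ}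
    (hβ : ∀ n A, |β n A| ≤ B (shift (-n) A)) (F : Finset ℤ) :
    ‖∑ n ∈ F, ∑' A, β n A • e A‖ ^ 2 ≤ F.card * totalCorr B := by
  have hprod : totalCorr B = ∑' l : ℤ, ∑' A, B A * B (shift l A) := Summable.tsum_prod hB
  have hl : Summable fun l : ℤ => ∑' A, B A * B (shift l A) := Summable.prod hB
  have hl0 : ∀ l : ℤ, 0 ≤ ∑' A, B A * B (shift l A) := fun l =>
    tsum_nonneg fun _ => mul_nonneg (h0 _) (h0 _)
  have hsq := fun n => summable_sq_of_shiftSummable hB (hβ n)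
  have hin : ∀ n n', inner ℝ (∑' A, β n A • e A) (∑' A, β n' A • e A) ≤
      ∑' A, B A * B (shift (n - n') A) := fun n n' => by
    refine hasSum_le (fun A => ?_) (hasSum_inner_orthonormal he (hsq n) (hsq n'))
      (hasSum_corr_shift hB n n')
    refine (le_abs_self _).trans ?_
    rw [abs_mul]
    exact mul_le_mul (hβ n A) (hβ n' A) (abs_nonneg _) (h0 _)
  rw [← real_inner_self_eq_norm_sq, sum_inner]
  calc _ ≤ ∑ n ∈ F, totalCorr B := Finset.sum_le_sum fun n _ => by
        rw [inner_sum]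
        calc _ ≤ ∑ n' ∈ F, ∑' A, B A * B (shift (n - n') A) :=
              Finset.sum_le_sum fun n' _ => hin n n'
          -- For fixed `n` the lags `n - n'` are distinct, so this is a partial sum of the
          -- nonnegative series defining `totalCorr B`.
          _ = ∑ l ∈ F.map (Equiv.subLeft n).toEmbedding, ∑' A, B A * B (shift l A) := by
              rw [Finset.sum_map]
              rfl
          _ ≤ _ := by
              rw [hprod]
              exact hl.sum_le_tsum _ fun l _ => hl0 l
    _ = _ := by simp

end NormBound

/-- The part of `B` carried by the sets that meet `(-∞, -m)`. -/
noncomputable def tailPart (B : Finset ℤ → ℝ) (m : ℕ) (A : Finset ℤ) : ℝ :=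
  open Classical in if ∃ i ∈ A, (m : ℤ) < -i then B A else 0

lemma tailPart_nonneg {B : Finset ℤ → ℝ} (h0 : ∀ A, 0 ≤ B A) (m : ℕ) (A : Finset ℤ) :
    0 ≤ tailPart B m A := by
  unfold tailPart
  split_ifs
  · exact h0 A
  · rfl

lemma tailPart_le {B : Finset ℤ → ℝ} (h0 : ∀ A, 0 ≤ B A) (m : ℕ) (A : Finset ℤ) :
    tailPart B m A ≤ B A := by
  unfold tailPart
  split_ifs
  · rfl
  · exact h0 A

/-- Dominated convergence, with the correlations of `B` itself as the bound: a given finite set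
meets `(-∞, -m)` for only finitely many `m`. -/
lemma tendsto_totalCorr_tailPart {B : Finset ℤ → ℝ} (h0 : ∀ A, 0 ≤ B A) (hB : ShiftSummable B) :
    Tendsto (fun m => totalCorr (tailPart B m)) atTop (𝓝 0) := by
  have : ∑' p : ℤ × Finset ℤ, (0 : ℝ) = 0 := tsum_zero
  rw [← this]
  refine tendsto_tsum_of_dominated_convergence hB (fun p => ?_) (Eventually.of_forall fun m p => ?_)
  · refine tendsto_const_nhds.congr' ?_
    obtain ⟨M, hM⟩ := (p.2.image fun i => (-i).toNat).bddAbove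
    filter_upwards [eventually_ge_atTop M] with m hm
    have : tailPart B m p.2 = 0 := by
      refine if_neg ?_
      rintro ⟨i, hi, hmi⟩
      have h1 : (-i).toNat ≤ M := hM (by simpa using ⟨i, hi, rfl⟩)
      omega
    simp [this]
  · rw [Real.norm_of_nonneg (mul_nonneg (tailPart_nonneg h0 _ _) (tailPart_nonneg h0 _ _))]
    exact mul_le_mul (tailPart_le h0 _ _) (tailPart_le h0 _ _) (tailPart_nonneg h0 _ _) (h0 _)

/-- The sequence obtained from `b` by discarding the entries of index larger than `m`. -/
def truncSeq (b : ℤ → ℝ) (m : ℕ) (i : ℤ) : ℝ := if i ≤ m then b i else 0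

/-- Truncation either leaves a coefficient unchanged or annihilates it, the latter only when `A`
contains an index more than `m` steps before `n`. -/
lemma abs_coeff_sub_truncSeq_le {b b' : ℤ → ℝ} (hb : ∀ i, |b i| ≤ b' i) (k m : ℕ) (n : ℤ)
    (A : Finset ℤ) : |coeff b k n A - coeff (truncSeq b m) k n A| ≤
      tailPart (coeff b' k 0) m (shift (-n) A) := by
  have h0 : ∀ i, 0 ≤ b' i := fun i => (abs_nonneg _).trans (hb i)
  have hs : coeff b' k 0 (shift (-n) A) = coeff b' k n A := by
    rw [coeff_shift]
    simp
  by_cases h : ∃ i ∈ A, (m : ℤ) < n - i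
  · have h' : ∃ i ∈ shift (-n) A, (m : ℤ) < -i := by
      obtain ⟨i, hi, him⟩ := h
      exact ⟨i + -n, by simpa [shift_apply] using hi, by linarith⟩
    rw [tailPart, if_pos h', hs]
    have : coeff (truncSeq b m) k n A = 0 := by
      unfold coeff
      split_ifs
      · obtain ⟨i, hi, him⟩ := h
        exact Finset.prod_eq_zero hi (if_neg (by omega))
      · rfl
    rw [this, sub_zero]
    exact abs_coeff_le hb k n A
  · push Not at h
    have : coeff (truncSeq b m) k n A = coeff b k n A := by
      unfold coeff
      split_ifs
      · exact Finset.prod_congr rfl fun i hi => if_pos (h i hi)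
      · rfl
    rw [this, sub_self, abs_zero]
    exact tailPart_nonneg (coeff_nonneg h0 k 0) _ _

end PolyForm

namespace PolyForm

/-! ### Covariances of the processes -/

lemma powerSeq_mono {c c' d d' : ℝ} (hc : 0 ≤ c) (hcc : c ≤ c') (hdd : d ≤ d') (i : ℤ) :
    powerSeq c d i ≤ powerSeq c' d' i := by
  unfold powerSeq
  split_ifs with h
  · have h1 : (1 : ℝ) ≤ i := by exact_mod_cast h
    have h2 : (i : ℝ) ^ (d - 1) ≤ (i : ℝ) ^ (d' - 1) :=
      Real.rpow_le_rpow_of_exponent_le h1 (by linarith)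
    have h3 : (0 : ℝ) ≤ (i : ℝ) ^ (d - 1) := Real.rpow_nonneg (by linarith) _
    exact mul_le_mul hcc h2 h3 (hc.trans hcc)
  · rfl

lemma abs_extendZero_le {a : ℕ+ → ℝ} {c d : ℝ}
    (h : ∀ i : ℕ+, |a i| ≤ c * ((i : ℕ) : ℝ) ^ (d - 1)) (i : ℤ) :
    |extendZero a i| ≤ powerSeq c d i := by
  unfold extendZero powerSeq
  split_ifs with hi
  · have h1 := h ⟨i.toNat, by omega⟩
    have h2 : ((i.toNat : ℕ) : ℝ) = (i : ℝ) := by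
      have : ((i.toNat : ℕ) : ℤ) = i := Int.toNat_of_nonneg hi.le
      exact_mod_cast this
    rw [← h2]
    exact h1
  · simp

/-- The coefficients of the form decay fast enough for short-range dependence. -/
def DecayBound (b : ℤ → ℝ) (k : ℕ) (c d : ℝ) : Prop :=
  0 < c ∧ d < 1 / 2 * (1 - 1 / (k : ℝ)) ∧ ∀ i, |b i| ≤ powerSeq c d i

lemma DecayBound.shiftSummable {b : ℤ → ℝ} {k : ℕ} {c d : ℝ} (h : DecayBound b k c d)
    (hk : 0 < k) : ShiftSummable (coeff (powerSeq c d) k 0) :=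
  shiftSummable_coeff_powerSeq h.1 hk h.2.1

lemma DecayBound.abs_coeff_le {b : ℤ → ℝ} {k : ℕ} {c d : ℝ} (h : DecayBound b k c d)
    (n : ℤ) (A : Finset ℤ) : |coeff b k n A| ≤ coeff (powerSeq c d) k 0 (shift (-n) A) := by
  rw [coeff_shift, show (0 : ℤ) - -n = n by ring]
  exact PolyForm.abs_coeff_le h.2.2 k n A

lemma DecayBound.truncSeq {b : ℤ → ℝ} {k : ℕ} {c d : ℝ} (h : DecayBound b k c d) (m : ℕ) :
    DecayBound (truncSeq b m) k c d := by
  refine ⟨h.1, h.2.1, fun i => ?_⟩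
  unfold PolyForm.truncSeq
  split_ifs
  · exact h.2.2 i
  · simpa using powerSeq_nonneg h.1.le d i

lemma DecayBound.summable_coeff_sq {b : ℤ → ℝ} {k : ℕ} {c d : ℝ} (h : DecayBound b k c d)
    (hk : 0 < k) (n : ℤ) : Summable fun A => coeff b k n A ^ 2 :=
  summable_sq_of_shiftSummable (h.shiftSummable hk) (h.abs_coeff_le n)

lemma DecayBound.mono {b : ℤ → ℝ} {k : ℕ} {c d c' d' : ℝ} (h : DecayBound b k c d)
    (hc : c ≤ c') (hd : d ≤ d') (hd' : d' < 1 / 2 * (1 - 1 / (k : ℝ))) : DecayBound b k c' d' :=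
  ⟨h.1.trans_le hc, hd', fun i => (h.2.2 i).trans (powerSeq_mono h.1.le hc hd i)⟩

section Covariance

variable {Ω : Type*} [MeasurableSpace Ω] {P : Measure Ω} {ε : ℤ → Ω → ℝ}
  {b b' : ℤ → ℝ} {k k' : ℕ} {c d c' d' : ℝ}

lemma inner_formVec_shift (h : IsStdNoise P ε) (hk : 0 < k) (hk' : 0 < k')
    (hb : DecayBound b k c d) (hb' : DecayBound b' k' c' d') (n m : ℤ) :
    inner ℝ (formVec P ε b k n) (formVec P ε b' k' m) =
      inner ℝ (formVec P ε b k (n - m)) (formVec P ε b' k' 0) := by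
  have h1 := hasSum_inner_formVec h (hb.summable_coeff_sq hk n) (hb'.summable_coeff_sq hk' m)
  have h2 := hasSum_inner_formVec h (hb.summable_coeff_sq hk (n - m))
    (hb'.summable_coeff_sq hk' 0)
  have h3 := (shift (-m)).hasSum_iff.2 h2
  refine h1.unique ?_
  convert! h3 using 2 with A
  rw [Function.comp_apply, coeff_shift, coeff_shift]
  congr 2 <;> ring

/-- The inner product at time `n` is dominated by the correlation of `B` at lag `n`, and these are
the marginal sums of a summable family on `ℤ × Finset ℤ`. -/
lemma summable_abs_inner_of_le {H : Type*} [NormedAddCommGroup H] [InnerProductSpace ℝ H]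
    [CompleteSpace H] {e : Finset ℤ → H} (he : Orthonormal ℝ e) {B : Finset ℤ → ℝ}
    (h0 : ∀ A, 0 ≤ B A) (hB : ShiftSummable B) {β : ℤ → Finset ℤ → ℝ} {β' : Finset ℤ → ℝ}
    (hβ : ∀ n A, |β n A| ≤ B (shift (-n) A)) (hβ' : ∀ A, |β' A| ≤ B (shift (-0) A)) :
    Summable fun n : ℤ => |inner ℝ (∑' A, β n A • e A) (∑' A, β' A • e A)| := by
  have hl : Summable fun l : ℤ => ∑' A, B A * B (shift l A) := Summable.prod hB
  refine hl.of_nonneg_of_le (fun _ => abs_nonneg _) fun n => ?_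
  have h1 := hasSum_inner_orthonormal he (summable_sq_of_shiftSummable hB (hβ n))
    (summable_sq_of_shiftSummable hB hβ')
  have h2 := hasSum_corr_shift hB n 0
  rw [sub_zero] at h2
  have hle : ∀ A, ‖β n A * β' A‖ ≤ B (shift (-n) A) * B (shift (-0) A) := fun A => by
    rw [Real.norm_eq_abs, abs_mul]
    exact mul_le_mul (hβ n A) (hβ' A) (abs_nonneg _) (h0 _)
  rw [← h1.tsum_eq, ← Real.norm_eq_abs]
  exact tsum_of_norm_bounded h2 hle

/-- Forms of different orders are orthogonal, since no set has two cardinalities. Forms of equal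
order are dominated by one power sequence, with the larger `c` and the larger `d`. -/
lemma summable_abs_inner_formVec (h : IsStdNoise P ε) (hk : 0 < k) (hk' : 0 < k')
    (hb : DecayBound b k c d) (hb' : DecayBound b' k' c' d') :
    Summable fun n : ℤ => |inner ℝ (formVec P ε b k n) (formVec P ε b' k' 0)| := by
  by_cases hkk : k = k'
  · subst hkk
    have hd : max d d' < 1 / 2 * (1 - 1 / (k : ℝ)) := max_lt hb.2.1 hb'.2.1
    have hb1 := hb.mono (le_max_left c c') (le_max_left d d') hd
    have hb2 := hb'.mono (le_max_right c c') (le_max_right d d') hd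
    exact summable_abs_inner_of_le h.orthonormal
      (coeff_nonneg (powerSeq_nonneg hb1.1.le _) k 0) (hb1.shiftSummable hk)
      (fun n A => hb1.abs_coeff_le n A) (hb2.abs_coeff_le 0)
  · have : ∀ n : ℤ, inner ℝ (formVec P ε b k n) (formVec P ε b' k' 0) = 0 := fun n => by
      have h1 := hasSum_inner_formVec h (hb.summable_coeff_sq hk n) (hb'.summable_coeff_sq hk' 0)
      refine h1.unique ?_
      convert! hasSum_zero with A
      unfold coeff
      split_ifs with h1 h2
      · exact absurd (h1.symm.trans h2) hkk
      all_goals simp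
    simp [this]

end Covariance

/-! ### Averages of a summable function of the difference -/

lemma card_filter_sub_eq_le (M M' : ℕ) (l : ℤ) :
    ((Finset.Icc 1 M ×ˢ Finset.Icc 1 M').filter
      fun p : ℕ × ℕ => (p.1 : ℤ) - p.2 = l).card ≤ min M M' := by
  refine le_min ?_ ?_
  · calc _ ≤ (Finset.Icc 1 M).card := by
          refine Finset.card_le_card_of_injOn Prod.fst (fun p hp => ?_) fun p hp q hq hpq => ?_
          · simp only [Finset.coe_filter, Finset.mem_product, Set.mem_ofPred_eq] at hp
            exact hp.1.1
          · simp only [Finset.coe_filter, Set.mem_ofPred_eq] at hp hq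
            exact Prod.ext hpq (by omega)
      _ = M := by simp
  · calc _ ≤ (Finset.Icc 1 M').card := by
          refine Finset.card_le_card_of_injOn Prod.snd (fun p hp => ?_) fun p hp q hq hpq => ?_
          · simp only [Finset.coe_filter, Finset.mem_product, Set.mem_ofPred_eq] at hp
            exact hp.1.2
          · simp only [Finset.coe_filter, Set.mem_ofPred_eq] at hp hq
            exact Prod.ext (by omega) hpq
      _ = M' := by simp

/-- Pairs of difference `l` are produced by adding the positive part of `l` to the first copy of `r`
and its negative part to the second. -/
lemma le_card_filter_sub_eq (M M' : ℕ) (l : ℤ) :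
    min M M' - l.natAbs ≤ ((Finset.Icc 1 M ×ˢ Finset.Icc 1 M').filter
      fun p : ℕ × ℕ => (p.1 : ℤ) - p.2 = l).card := by
  calc min M M' - l.natAbs = (Finset.Icc 1 (min M M' - l.natAbs)).card := by simp
    _ ≤ _ := by
      refine Finset.card_le_card_of_injOn (fun r => (r + l.toNat, r + (-l).toNat))
        (fun r hr => ?_) fun r _ r' _ hrr => ?_
      · simp only [Finset.coe_Icc, Set.mem_Icc] at hr
        simp only [Finset.coe_filter, Finset.mem_product, Finset.mem_Icc, Set.mem_ofPred_eq]
        have h1 := min_le_left M M'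
        have h2 := min_le_right M M'
        omega
      · simp only [Prod.mk.injEq] at hrr
        omega

/-- Grouping by the lag `l`, the weight of `γ l` is the number of pairs of difference `l` over `N`.
It lies between `(min M M' - |l|) / N` and `min M M' / N`, hence tends to `min s t`, and dominated
convergence applies. -/
theorem tendsto_average_sub {γ : ℤ → ℝ} (hγ : Summable fun n => |γ n|) {M M' : ℕ → ℕ} {s t : ℝ}
    (hM : Tendsto (fun N => (M N : ℝ) / N) atTop (𝓝 s))
    (hM' : Tendsto (fun N => (M' N : ℝ) / N) atTop (𝓝 t)) :
    Tendsto (fun N : ℕ => (∑ n ∈ Finset.Icc 1 (M N), ∑ m ∈ Finset.Icc 1 (M' N),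
      γ ((n : ℤ) - m)) / N) atTop (𝓝 (min s t * ∑' n, γ n)) := by
  let S : ℕ → Finset (ℕ × ℕ) := fun N => Finset.Icc 1 (M N) ×ˢ Finset.Icc 1 (M' N)
  let f : ℕ × ℕ → ℤ := fun p => (p.1 : ℤ) - p.2
  let C : ℕ → ℤ → ℕ := fun N l => ((S N).filter fun p => f p = l).card
  have hmin : Tendsto (fun N => ((min (M N) (M' N) : ℕ) : ℝ) / N) atTop (𝓝 (min s t)) := by
    refine (hM.min hM').congr fun N => ?_
    rw [Nat.cast_min, min_div_div_right (Nat.cast_nonneg N)]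
  have h1 : ∀ N, (∑ n ∈ Finset.Icc 1 (M N), ∑ m ∈ Finset.Icc 1 (M' N), γ ((n : ℤ) - m)) / N =
      ∑' l, (C N l : ℝ) / N * γ l := fun N => by
    rw [← Finset.sum_product' (f := fun n m : ℕ => γ ((n : ℤ) - m))]
    have h2 := Finset.sum_comp (s := S N) γ f
    rw [tsum_eq_sum (s := (S N).image f)]
    · rw [show (∑ x ∈ Finset.Icc 1 (M N) ×ˢ Finset.Icc 1 (M' N), γ ((x.1 : ℤ) - x.2)) =
        ∑ a ∈ S N, γ (f a) from rfl, h2, Finset.sum_div]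
      refine Finset.sum_congr rfl fun l _ => ?_
      rw [nsmul_eq_mul]
      simp only [C]
      ring
    · intro l hl
      have : C N l = 0 := by
        refine Finset.card_eq_zero.2 (Finset.filter_eq_empty_iff.2 fun p hp hpl => hl ?_)
        exact Finset.mem_image.2 ⟨p, hp, hpl⟩
      simp [this]
  simp_rw [h1]
  rw [← tsum_mul_left]
  refine tendsto_tsum_of_dominated_convergence (bound := fun l => (min s t + 1) * |γ l|)
    (hγ.mul_left _) (fun l => ?_) ?_
  · refine Tendsto.mul_const _ ?_
    have hlow : Tendsto (fun N : ℕ => ((min (M N) (M' N) : ℕ) : ℝ) / N - (l.natAbs : ℝ) / N)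
        atTop (𝓝 (min s t)) := by
      simpa using hmin.sub (tendsto_const_div_atTop_nhds_zero_nat (l.natAbs : ℝ))
    refine tendsto_of_tendsto_of_tendsto_of_le_of_le hlow hmin (fun N => ?_) fun N => ?_
    · have h2 : min (M N) (M' N) ≤ C N l + l.natAbs :=
        Nat.sub_le_iff_le_add.1 (le_card_filter_sub_eq (M N) (M' N) l)
      have h3 : ((min (M N) (M' N) : ℕ) : ℝ) ≤ C N l + l.natAbs := by exact_mod_cast h2
      rw [← sub_div]
      exact div_le_div_of_nonneg_right (by linarith) (Nat.cast_nonneg N)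
    · have : C N l ≤ min (M N) (M' N) := card_filter_sub_eq_le (M N) (M' N) l
      exact div_le_div_of_nonneg_right (Nat.cast_le.2 this) (Nat.cast_nonneg N)
  · filter_upwards [hmin.eventually_lt_const (lt_add_one _)] with N hN l
    have : C N l ≤ min (M N) (M' N) := card_filter_sub_eq_le (M N) (M' N) l
    have h3 : (C N l : ℝ) / N ≤ min s t + 1 :=
      (div_le_div_of_nonneg_right (Nat.cast_le.2 this) (Nat.cast_nonneg N)).trans hN.le
    rw [norm_mul, Real.norm_of_nonneg (by positivity), Real.norm_eq_abs]
    exact mul_le_mul_of_nonneg_right h3 (abs_nonneg _)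

end PolyForm

namespace PolyForm

/-! ### A central limit theorem for arrays built on an i.i.d. sequence -/

lemma norm_prod_sub_prod_le {ι R : Type*} [NormedCommRing R] [NormOneClass R] (s : Finset ι)
    {z w : ι → R} (hz : ∀ i ∈ s, ‖z i‖ ≤ 1) (hw : ∀ i ∈ s, ‖w i‖ ≤ 1) :
    ‖∏ i ∈ s, z i - ∏ i ∈ s, w i‖ ≤ ∑ i ∈ s, ‖z i - w i‖ := by
  classical
  induction s using Finset.induction_on with
  | empty => simp
  | insert i s hi ih =>
    simp only [Finset.mem_insert, forall_eq_or_imp] at hz hw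
    rw [Finset.prod_insert hi, Finset.prod_insert hi, Finset.sum_insert hi]
    have h1 : ‖∏ j ∈ s, w j‖ ≤ 1 :=
      (Finset.norm_prod_le s w).trans (Finset.prod_le_one (fun _ _ => norm_nonneg _) hw.2)
    calc ‖z i * ∏ j ∈ s, z j - w i * ∏ j ∈ s, w j‖
        = ‖z i * (∏ j ∈ s, z j - ∏ j ∈ s, w j) + (z i - w i) * ∏ j ∈ s, w j‖ := by
          congr 1
          ring
      _ ≤ ‖z i‖ * ‖∏ j ∈ s, z j - ∏ j ∈ s, w j‖ + ‖z i - w i‖ * ‖∏ j ∈ s, w j‖ :=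
          (norm_add_le _ _).trans (add_le_add (norm_mul_le _ _) (norm_mul_le _ _))
      _ ≤ 1 * (∑ j ∈ s, ‖z j - w j‖) + ‖z i - w i‖ * 1 := by
          gcongr
          · exact hz.1
          · exact ih hz.2 hw.2
      _ = _ := by ring

/-! ### Second-order comparison of characteristic functions with Gaussian ones. -/

section Taylor

variable {Ω : Type*} [MeasurableSpace Ω] {P : Measure Ω} [IsProbabilityMeasure P]

lemma charFun_sub_taylor_isLittleO {X : Ω → ℝ} (hX : MemLp X 2 P) (h0 : P[X] = 0) :
    (fun t : ℝ => charFun (P.map X) t - (1 - ((P[X ^ 2] : ℝ) : ℂ) * (t : ℂ) ^ 2 / 2))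
      =o[𝓝 0] fun t : ℝ => t ^ 2 := by
  have hm : AEMeasurable X P := hX.aestronglyMeasurable.aemeasurable
  have : IsProbabilityMeasure (P.map X) := Measure.isProbabilityMeasure_map hm
  have hint : MemLp id 2 (P.map X) :=
    (memLp_map_measure_iff aestronglyMeasurable_id hm).2 (by simpa using hX)
  have h := taylor_isLittleO_univ (x₀ := 0) (contDiff_charFun (n := 2) (by exact_mod_cast hint))
  simp_rw [taylorWithinEval_charFun_two_zero hm hint, h0] at h
  simpa using h

/-- The Gaussian law of the same variance has the same second-order Taylor polynomial, so the two
expansions are subtracted. -/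
lemma charFun_sub_gaussian_isLittleO {X : Ω → ℝ} (hX : MemLp X 2 P) (h0 : P[X] = 0) :
    (fun t : ℝ => charFun (P.map X) t - Complex.exp (-((P[X ^ 2] * t ^ 2 / 2 : ℝ) : ℂ)))
      =o[𝓝 0] fun t : ℝ => t ^ 2 := by
  have hv : 0 ≤ P[X ^ 2] := integral_nonneg fun ω => sq_nonneg _
  set v : ℝ≥0 := ⟨P[X ^ 2], hv⟩ with hvdef
  have h1 := charFun_sub_taylor_isLittleO hX h0
  have h2 := charFun_sub_taylor_isLittleO (P := gaussianReal 0 v) (X := id)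
    (memLp_id_gaussianReal 2) (by simp)
  have h3 : (gaussianReal 0 v)[(id : ℝ → ℝ) ^ 2] = (v : ℝ) := by
    have := variance_id_gaussianReal (μ := 0) (v := v)
    rw [variance_eq_integral measurable_id.aemeasurable] at this
    simpa using this
  rw [h3, Measure.map_id] at h2
  refine (h1.sub h2).congr_left fun t => ?_
  have e : Complex.exp (-((P[X ^ 2] * t ^ 2 / 2 : ℝ) : ℂ)) = charFun (gaussianReal 0 v) t := by
    rw [charFun_gaussianReal]
    congr 1
    have : ((v : ℝ) : ℂ) = ((P[X ^ 2] : ℝ) : ℂ) := rfl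
    rw [this]
    push_cast
    ring
  rw [e]
  exact sub_sub_sub_cancel_right _ _ _

end Taylor

/-- Both characteristic functions are products over `b`, and a difference of products of numbers in
the unit disc is at most the sum of the differences. Since `ι` is finite, the `o(t ^ 2)` errors are
uniform over all rows. The reference Gaussian has the actual variance of the row, so no convergence
of variances is required. -/
theorem tendsto_charFun_array {Ω E ι : Type*} [MeasurableSpace Ω] [MeasurableSpace E] [Finite ι]
    {P : Measure Ω} [IsProbabilityMeasure P] {ξ : ℕ → Ω → E}
    (hind : iIndepFun ξ P) (hid : ∀ b, IdentDistrib (ξ b) (ξ 0) P P) {g : ι → E → ℝ}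
    (hg : ∀ i, Measurable (g i)) (hmean : ∀ i, ∫ ω, g i (ξ 0 ω) ∂P = 0)
    (hL2 : ∀ i, MemLp (fun ω => g i (ξ 0 ω)) 2 P) {K : ℕ → ℕ} {C : ℝ}
    (hK : ∀ N, (K N : ℝ) ≤ C * N) (s : ℕ → ℕ → ι) :
    Tendsto (fun N : ℕ =>
      charFun (P.map fun ω => ∑ b ∈ Finset.range (K N), g (s N b) (ξ b ω)) (√(N : ℝ))⁻¹ -
      Complex.exp (-(((∫ ω, (∑ b ∈ Finset.range (K N), g (s N b) (ξ b ω)) ^ 2 ∂P) *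
        (√(N : ℝ))⁻¹ ^ 2 / 2 : ℝ) : ℂ))) atTop (𝓝 0) := by
  have hidg : ∀ i b, IdentDistrib (fun ω => g i (ξ b ω)) (fun ω => g i (ξ 0 ω)) P P :=
    fun i b => (hid b).comp (hg i)
  set v : ι → ℝ := fun i => ∫ ω, g i (ξ 0 ω) ^ 2 ∂P with hv
  have hv0 : ∀ i, 0 ≤ v i := fun i => integral_nonneg fun ω => sq_nonneg _
  have hLb : ∀ i b, MemLp (fun ω => g i (ξ b ω)) 2 P := fun i b => (hidg i b).symm.memLp_snd (hL2 i)
  have hmb : ∀ i b, ∫ ω, g i (ξ b ω) ∂P = 0 := fun i b => (hidg i b).integral_eq.trans (hmean i)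
  have hind' : ∀ N, iIndepFun (fun b ω => g (s N b) (ξ b ω)) P := fun N =>
    hind.comp (fun b => g (s N b)) fun b => hg _
  have hvar : ∀ N, ∫ ω, (∑ b ∈ Finset.range (K N), g (s N b) (ξ b ω)) ^ 2 ∂P =
      ∑ b ∈ Finset.range (K N), v (s N b) := fun N => by
    have h1 := IndepFun.variance_sum (μ := P) (X := fun b ω => g (s N b) (ξ b ω))
      (s := Finset.range (K N)) (fun b _ => hLb _ b) (fun b _ b' _ hbb => (hind' N).indepFun hbb)
    rw [variance_of_integral_eq_zero] at h1
    · simp only [Finset.sum_apply] at h1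
      rw [h1]
      refine Finset.sum_congr rfl fun b _ => ?_
      rw [(hidg (s N b) b).variance_eq, variance_of_integral_eq_zero
        (hL2 _).aestronglyMeasurable.aemeasurable (hmean _)]
    · exact (memLp_finsetSum' _ fun b _ => hLb _ b).aestronglyMeasurable.aemeasurable
    · simp only [Finset.sum_apply]
      rw [integral_finsetSum _ fun b _ => (hLb _ b).integrable one_le_two]
      exact Finset.sum_eq_zero fun b _ => hmb _ b
  have hchar : ∀ N (x : ℝ), charFun (P.map fun ω => ∑ b ∈ Finset.range (K N),
      g (s N b) (ξ b ω)) x = ∏ b ∈ Finset.range (K N),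
        charFun (P.map fun ω => g (s N b) (ξ 0 ω)) x := fun N x => by
    rw [((hind' N).restrict (Finset.range (K N))).charFun_map_fun_finsetSum_eq_prod
      fun b _ => (hLb _ b).aestronglyMeasurable.aemeasurable, Finset.prod_apply]
    exact Finset.prod_congr rfl fun b _ => by rw [(hidg (s N b) b).map_eq]
  rw [Metric.tendsto_atTop']
  intro η hη
  have hC : 0 ≤ C := by
    have := hK 1
    have h2 : (0 : ℝ) ≤ K 1 := Nat.cast_nonneg _
    norm_num at this
    linarith
  -- At most `C * N` factors, each with error `η / (C + 1) / N`, add up to less than `η`.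
  have hη' : 0 < η / (C + 1) := by positivity
  have hsmall : ∀ᶠ x : ℝ in 𝓝 0, ∀ i, ‖charFun (P.map fun ω => g i (ξ 0 ω)) x -
      Complex.exp (-((v i * x ^ 2 / 2 : ℝ) : ℂ))‖ ≤ η / (C + 1) * ‖x ^ 2‖ := by
    rw [eventually_all]
    intro i
    exact (charFun_sub_gaussian_isLittleO (hL2 i) (hmean i)).bound hη'
  have hx : Tendsto (fun N : ℕ => (√(N : ℝ))⁻¹) atTop (𝓝 0) :=
    tendsto_inv_atTop_zero.comp (Real.tendsto_sqrt_atTop.comp tendsto_natCast_atTop_atTop)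
  obtain ⟨N₀, hN₀⟩ := eventually_atTop.1 (hx.eventually hsmall)
  refine ⟨N₀, fun N hN => ?_⟩
  have hN0 : (0 : ℝ) < N := by exact_mod_cast (Nat.zero_le _).trans_lt hN
  have hsq : (√(N : ℝ))⁻¹ ^ 2 = (N : ℝ)⁻¹ := by rw [inv_pow, Real.sq_sqrt hN0.le]
  rw [dist_zero_right, hvar, hchar]
  have hexp : Complex.exp (-(((∑ b ∈ Finset.range (K N), v (s N b)) * (√(N : ℝ))⁻¹ ^ 2 / 2 : ℝ)
      : ℂ)) = ∏ b ∈ Finset.range (K N),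
        Complex.exp (-((v (s N b) * (√(N : ℝ))⁻¹ ^ 2 / 2 : ℝ) : ℂ)) := by
    rw [← Complex.exp_sum]
    congr 1
    push_cast
    rw [Finset.sum_neg_distrib, Finset.sum_mul, Finset.sum_div]
  rw [hexp]
  have hprob : ∀ i, IsProbabilityMeasure (P.map fun ω => g i (ξ 0 ω)) := fun i =>
    Measure.isProbabilityMeasure_map (hL2 i).aestronglyMeasurable.aemeasurable
  calc _ ≤ ∑ b ∈ Finset.range (K N), ‖charFun (P.map fun ω => g (s N b) (ξ 0 ω)) (√(N : ℝ))⁻¹ -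
        Complex.exp (-((v (s N b) * (√(N : ℝ))⁻¹ ^ 2 / 2 : ℝ) : ℂ))‖ := by
        refine norm_prod_sub_prod_le _ (fun b _ => ?_) fun b _ => ?_
        · have := hprob (s N b)
          exact norm_charFun_le_one _
        · rw [← Complex.ofReal_neg, ← Complex.ofReal_exp, Complex.norm_real,
            Real.norm_of_nonneg (Real.exp_nonneg _), Real.exp_le_one_iff]
          have := hv0 (s N b)
          have : 0 ≤ v (s N b) * (√(N : ℝ))⁻¹ ^ 2 / 2 := by positivity
          linarith
    _ ≤ ∑ b ∈ Finset.range (K N), η / (C + 1) * (N : ℝ)⁻¹ := by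
        refine Finset.sum_le_sum fun b _ => ?_
        refine (hN₀ N hN.le (s N b)).trans_eq ?_
        rw [hsq, Real.norm_of_nonneg (by positivity)]
    _ = K N * (η / (C + 1) * (N : ℝ)⁻¹) := by simp
    _ ≤ C * N * (η / (C + 1) * (N : ℝ)⁻¹) := by
        gcongr
        exact hK N
    _ = C / (C + 1) * η := by
        field_simp
    _ < η := by
        have : C / (C + 1) < 1 := by
          rw [div_lt_one (by linarith)]
          linarith
        nlinarith

end PolyForm

namespace PolyForm

/-! ### Approximation of the partial sums by sums over independent blocks -/

section Blocks

variable {Ω : Type*} [MeasurableSpace Ω] {P : Measure Ω} {ε : ℤ → Ω → ℝ}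
  {b : ℤ → ℝ} {k : ℕ} {c d : ℝ}

/-- The form truncated to the `m` most recent variables, as a polynomial in the noise `x`. -/
noncomputable def truncForm (b : ℤ → ℝ) (k m : ℕ) (n : ℤ) (x : ℤ → ℝ) : ℝ :=
  ∑ A ∈ Finset.powersetCard k (Finset.Ico (-(m : ℤ)) 0), ∏ i ∈ A, b (-i) * x (n + i)

lemma truncForm_congr (b : ℤ → ℝ) (k m : ℕ) {n n' : ℤ} {x x' : ℤ → ℝ}
    (h : ∀ i : ℤ, -(m : ℤ) ≤ i → i < 0 → x (n + i) = x' (n' + i)) :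
    truncForm b k m n x = truncForm b k m n' x' := by
  refine Finset.sum_congr rfl fun A hA => Finset.prod_congr rfl fun i hi => ?_
  have := Finset.mem_Ico.1 ((Finset.mem_powersetCard.1 hA).1 hi)
  rw [h i this.1 this.2]

/-- After translation by `n`, only subsets of `[-m, 0)` keep a nonzero coefficient. The series is
then a finite sum, and the `L²` class has a pointwise polynomial representative. -/
lemma formVec_truncSeq_ae_eq (h : IsStdNoise P ε) (hb : ∀ i ≤ 0, b i = 0) (k m : ℕ) (n : ℤ) :
    formVec P ε (truncSeq b m) k n =ᵐ[P] fun ω => truncForm b k m n fun i => ε i ω := by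
  have h1 : formVec P ε (truncSeq b m) k n = ∑ A ∈ Finset.powersetCard k
      (Finset.Ico (-(m : ℤ)) 0), (∏ i ∈ A, b (-i)) • noiseVec P ε (shift n A) := by
    rw [formVec, ← (shift n).tsum_eq, tsum_eq_sum (s := Finset.powersetCard k
      (Finset.Ico (-(m : ℤ)) 0))]
    · refine Finset.sum_congr rfl fun A hA => ?_
      obtain ⟨hA1, hA2⟩ := Finset.mem_powersetCard.1 hA
      rw [coeff_shift, sub_self, coeff, if_pos hA2]
      congr 1
      refine Finset.prod_congr rfl fun i hi => ?_
      have := Finset.mem_Ico.1 (hA1 hi)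
      rw [zero_sub, truncSeq, if_pos (by omega)]
    · intro A hA
      rw [coeff_shift, sub_self, coeff]
      split_ifs with hA2
      · have : ∃ i ∈ A, i ∉ Finset.Ico (-(m : ℤ)) 0 := by
          by_contra! hc
          exact hA (Finset.mem_powersetCard.2 ⟨hc, hA2⟩)
        obtain ⟨i, hi, him⟩ := this
        rw [Finset.prod_eq_zero hi, zero_smul]
        rw [Finset.mem_Ico, not_and_or] at him
        rw [zero_sub, truncSeq]
        split_ifs
        · exact hb _ (by omega)
        · rfl
      · rw [zero_smul]
  rw [h1]
  have h2 : ∀ᵐ ω ∂P, ∀ A ∈ Finset.powersetCard k (Finset.Ico (-(m : ℤ)) 0),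
      ((∏ i ∈ A, b (-i)) • noiseVec P ε (shift n A) : Lp ℝ 2 P) ω =
        ∏ i ∈ A, b (-i) * ε (n + i) ω := by
    refine (ae_ball_iff (Finset.countable_toSet _)).2 fun A _ => ?_
    filter_upwards [Lp.coeFn_smul (∏ i ∈ A, b (-i)) (noiseVec P ε (shift n A)),
      toL2_ae_eq (h.memLp_noiseProd (shift n A))] with ω h3 h4
    rw [h3, Pi.smul_apply, noiseVec, h4, noiseProd, shift_apply, Finset.prod_map,
      Finset.prod_mul_distrib, smul_eq_mul]
    congr 1
    refine Finset.prod_congr rfl fun i _ => ?_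
    simp [add_comm]
  filter_upwards [h2, Lp.coeFn_finsetSum (Finset.powersetCard k (Finset.Ico (-(m : ℤ)) 0))
    fun A => (∏ i ∈ A, b (-i)) • noiseVec P ε (shift n A)] with ω h3 h4
  rw [h4, Finset.sum_apply, Finset.sum_congr rfl h3]
  rfl

/-- The partial sum `∑_{n=1}^M X(n)` in `L²(P)`. -/
noncomputable def sumVec (P : Measure Ω) (ε : ℤ → Ω → ℝ) (b : ℤ → ℝ) (k M : ℕ) : Lp ℝ 2 P :=
  ∑ n ∈ Finset.Icc 1 M, formVec P ε b k (n : ℤ)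

/-- The sum over one block of length `L`, of which the first `m` terms are left out, of the
truncated form. -/
noncomputable def blockVec (P : Measure Ω) (ε : ℤ → Ω → ℝ) (b : ℤ → ℝ) (k m L β : ℕ) : Lp ℝ 2 P :=
  ∑ l ∈ Finset.Ico m L, formVec P ε (truncSeq b m) k ((1 + β * L + l : ℕ) : ℤ)

/-- The indices covered by the first `K` blocks. -/
def blockIdx (m L K : ℕ) : Finset ℕ :=
  (Finset.range K ×ˢ Finset.Ico m L).image fun p => 1 + p.1 * L + p.2

lemma blockIdx_injOn (m L K : ℕ) : Set.InjOn (fun p : ℕ × ℕ => 1 + p.1 * L + p.2)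
    (Finset.range K ×ˢ Finset.Ico m L : Finset (ℕ × ℕ)) := by
  rintro ⟨β, l⟩ hp ⟨β', l'⟩ hp' h
  simp only [Finset.coe_product, Set.mem_prod, Finset.mem_coe, Finset.mem_Ico] at hp hp'
  have h1 : l + L * β = l' + L * β' := by
    dsimp only at h
    nlinarith
  have hL : 0 < L := by omega
  have h2 : l = l' := by
    have := congrArg (· % L) h1
    simpa [Nat.add_mul_mod_self_left, Nat.mod_eq_of_lt hp.2.2, Nat.mod_eq_of_lt hp'.2.2] using this
  subst h2
  have h3 : β = β' := Nat.eq_of_mul_eq_mul_left hL (by omega)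
  rw [h3]

lemma card_blockIdx (m L K : ℕ) : (blockIdx m L K).card = K * (L - m) := by
  rw [blockIdx, Finset.card_image_of_injOn (blockIdx_injOn m L K)]
  simp

lemma blockIdx_subset (m L M : ℕ) : blockIdx m L (M / L) ⊆ Finset.Icc 1 M := by
  intro n hn
  obtain ⟨⟨β, l⟩, hp, rfl⟩ := Finset.mem_image.1 hn
  simp only [Finset.mem_product, Finset.mem_range, Finset.mem_Ico] at hp
  have h1 : (β + 1) * L ≤ M / L * L := Nat.mul_le_mul_right L hp.1
  have h2 := Nat.div_mul_le_self M L
  rw [Finset.mem_Icc]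
  constructor
  · omega
  · dsimp only
    nlinarith [hp.2.2]

lemma sum_blockVec (m L K : ℕ) : ∑ β ∈ Finset.range K, blockVec P ε b k m L β =
    ∑ n ∈ blockIdx m L K, formVec P ε (truncSeq b m) k (n : ℤ) := by
  rw [blockIdx, Finset.sum_image (blockIdx_injOn m L K), Finset.sum_product]
  rfl

lemma norm_sum_formVec_le (h : IsStdNoise P ε) (hk : 0 < k) (hb : DecayBound b k c d)
    (F : Finset ℕ) : ‖∑ n ∈ F, formVec P ε b k (n : ℤ)‖ ≤
      √(F.card * totalCorr (coeff (powerSeq c d) k 0)) := by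
  refine Real.le_sqrt_of_sq_le ?_
  have := norm_sq_sum_le h.orthonormal (coeff_nonneg (powerSeq_nonneg hb.1.le d) k 0)
    (hb.shiftSummable hk) (fun n A => hb.abs_coeff_le n A) (F.map Nat.castEmbedding)
  rw [Finset.sum_map, Finset.card_map] at this
  exact this

lemma norm_sum_formVec_sub_le (h : IsStdNoise P ε) (hk : 0 < k) (hb : DecayBound b k c d)
    (m : ℕ) (F : Finset ℕ) :
    ‖∑ n ∈ F, (formVec P ε b k (n : ℤ) - formVec P ε (truncSeq b m) k (n : ℤ))‖ ≤
      √(F.card * totalCorr (tailPart (coeff (powerSeq c d) k 0) m)) := by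
  refine Real.le_sqrt_of_sq_le ?_
  have h0 := coeff_nonneg (powerSeq_nonneg hb.1.le d) k 0
  have hs : ShiftSummable (tailPart (coeff (powerSeq c d) k 0) m) :=
    (hb.shiftSummable hk).of_le (tailPart_nonneg h0 m) (tailPart_le h0 m)
  have := norm_sq_sum_le h.orthonormal (tailPart_nonneg h0 m) hs
    (fun n A => abs_coeff_sub_truncSeq_le hb.2.2 k m n A) (F.map Nat.castEmbedding)
  rw [Finset.sum_map, Finset.card_map] at this
  refine le_of_eq_of_le ?_ this
  congr 3 with n
  rw [formVec, formVec, ← Summable.tsum_sub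
    (summable_orthonormal h.orthonormal (hb.summable_coeff_sq hk n))
    (summable_orthonormal h.orthonormal ((hb.truncSeq m).summable_coeff_sq hk n))]
  simp only [sub_smul]
  rfl

/-- Two errors: truncating all `M` terms, and dropping the truncated terms outside the blocks. The
dropped indices number at most `M * (m / L)` for the gaps plus `L` for the incomplete last block. -/
theorem norm_sumVec_sub_blocks_le (h : IsStdNoise P ε) (hk : 0 < k) (hb : DecayBound b k c d)
    {m L : ℕ} (hL : 0 < L) (hmL : m ≤ L) (M : ℕ) :
    ‖sumVec P ε b k M - ∑ β ∈ Finset.range (M / L), blockVec P ε b k m L β‖ ≤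
      √(M * totalCorr (tailPart (coeff (powerSeq c d) k 0) m)) +
        √((M * (m / L : ℝ) + L) * totalCorr (coeff (powerSeq c d) k 0)) := by
  have hsub := blockIdx_subset m L M
  have hΓ : 0 ≤ totalCorr (coeff (powerSeq c d) k 0) :=
    totalCorr_nonneg (coeff_nonneg (powerSeq_nonneg hb.1.le d) k 0)
  have hdec : sumVec P ε b k M - ∑ β ∈ Finset.range (M / L), blockVec P ε b k m L β =
      ∑ n ∈ Finset.Icc 1 M, (formVec P ε b k (n : ℤ) - formVec P ε (truncSeq b m) k (n : ℤ)) +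
        ∑ n ∈ Finset.Icc 1 M \ blockIdx m L (M / L), formVec P ε (truncSeq b m) k (n : ℤ) := by
    rw [sum_blockVec, sumVec, Finset.sum_sub_distrib, Finset.sum_sdiff_eq_sub hsub]
    abel
  have hcard : ((Finset.Icc 1 M \ blockIdx m L (M / L)).card : ℝ) ≤ M * (m / L : ℝ) + L := by
    have h1 : (Finset.Icc 1 M \ blockIdx m L (M / L)).card + M / L * (L - m) = M := by
      have := Finset.card_sdiff_add_card_eq_card hsub
      rwa [card_blockIdx, Nat.card_Icc, Nat.add_sub_cancel] at this
    have h2 : M < M / L * L + L := by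
      have := Nat.div_add_mod M L
      have := Nat.mod_lt M hL
      nlinarith
    have h3 : ((M / L : ℕ) : ℝ) ≤ M / L := Nat.cast_div_le
    have h1' : ((Finset.Icc 1 M \ blockIdx m L (M / L)).card : ℝ) +
        ((M / L : ℕ) : ℝ) * ((L : ℝ) - m) = M := by
      rw [← Nat.cast_sub hmL]
      exact_mod_cast h1
    have h2' : (M : ℝ) < ((M / L : ℕ) : ℝ) * L + L := by exact_mod_cast h2
    have h4 : ((M / L : ℕ) : ℝ) * m ≤ M * (m / L : ℝ) := by
      calc _ ≤ (M / L : ℝ) * m := by gcongr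
        _ = _ := by ring
    nlinarith
  rw [hdec]
  refine (norm_add_le _ _).trans (add_le_add ?_ ?_)
  · simpa using norm_sum_formVec_sub_le h hk hb m (Finset.Icc 1 M)
  · exact (norm_sum_formVec_le h hk (hb.truncSeq m) _).trans (Real.sqrt_le_sqrt (by gcongr))

/-- The configuration of the noise in the block number `β`. -/
def noiseBlock (ε : ℤ → Ω → ℝ) (L β : ℕ) (ω : Ω) (i : Fin L) : ℝ :=
  ε ((1 + β * L + (i : ℕ) : ℕ) : ℤ) ω

/-- The block sum as a function of the noise in the block. -/
noncomputable def blockFun (b : ℤ → ℝ) (k m L : ℕ) (x : Fin L → ℝ) : ℝ :=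
  ∑ l ∈ Finset.Ico m L, truncForm b k m (l : ℤ) fun i =>
    if h : 0 ≤ i ∧ i < L then x ⟨i.toNat, by omega⟩ else 0

lemma measurable_blockFun (b : ℤ → ℝ) (k m L : ℕ) : Measurable (blockFun b k m L) := by
  unfold blockFun truncForm
  refine Finset.measurable_fun_sum _ fun l _ => Finset.measurable_fun_sum _ fun A _ =>
    Finset.measurable_fun_prod _ fun i _ => Measurable.const_mul ?_ _
  dsimp only
  split_ifs
  · fun_prop
  · fun_prop

lemma blockVec_ae_eq (h : IsStdNoise P ε) (hb : ∀ i ≤ 0, b i = 0) (k m L β : ℕ) :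
    blockVec P ε b k m L β =ᵐ[P] fun ω => blockFun b k m L (noiseBlock ε L β ω) := by
  have h1 : ∀ᵐ ω ∂P, ∀ l ∈ Finset.Ico m L,
      formVec P ε (truncSeq b m) k ((1 + β * L + l : ℕ) : ℤ) ω =
        truncForm b k m ((1 + β * L + l : ℕ) : ℤ) fun i => ε i ω :=
    (ae_ball_iff (Finset.countable_toSet _)).2 fun l _ => formVec_truncSeq_ae_eq h hb k m _
  filter_upwards [h1, Lp.coeFn_finsetSum (Finset.Ico m L) fun l =>
    formVec P ε (truncSeq b m) k ((1 + β * L + l : ℕ) : ℤ)] with ω h2 h3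
  rw [blockVec, h3, Finset.sum_apply, blockFun]
  refine Finset.sum_congr rfl fun l hl => ?_
  rw [h2 l hl]
  rw [Finset.mem_Ico] at hl
  refine truncForm_congr b k m fun i hi1 hi2 => ?_
  -- As `m ≤ l < L` and `-m ≤ i < 0`, the position `l + i` lies in `[0, L)`: leaving out the first
  -- `m` terms confines the block sum to its own noise, and the default `0` in `blockFun` is never
  -- read.
  rw [dif_pos ⟨by omega, by omega⟩, noiseBlock]
  congr 1
  push_cast
  rw [Int.toNat_of_nonneg (by omega)]
  ring

/-- Distinct pairs `(β, i)` use distinct noise variables, so the joint law is a product over pairs;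
currying turns it into a product over `β` of the block laws. -/
lemma iIndepFun_noiseBlock (h : IsStdNoise P ε) (L : ℕ) : iIndepFun (noiseBlock ε L) P := by
  have : IsProbabilityMeasure P := h.indep.isProbabilityMeasure
  have hinj : Function.Injective fun p : ℕ × Fin L => ((1 + p.1 * L + (p.2 : ℕ) : ℕ) : ℤ) := by
    rintro ⟨β, l⟩ ⟨β', l'⟩ hp
    have hp' : 1 + β * L + (l : ℕ) = 1 + β' * L + (l' : ℕ) := Int.ofNat_inj.1 hp
    have := blockIdx_injOn 0 L (β + β' + 1) (x₁ := (β, (l : ℕ))) (x₂ := (β', (l' : ℕ)))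
      (by simp) (by simp) hp'
    simp only [Prod.mk.injEq] at this
    exact Prod.ext this.1 (Fin.ext this.2)
  have h1 := h.indep.precomp hinj
  have hmeas : ∀ p : ℕ × Fin L, Measurable (ε ((1 + p.1 * L + (p.2 : ℕ) : ℕ) : ℤ)) :=
    fun p => h.measurable _
  have hmb : ∀ β, Measurable (noiseBlock ε L β) := fun β =>
    measurable_pi_lambda _ fun i => h.measurable _
  have hrow : ∀ β, iIndepFun (fun i : Fin L => fun ω => noiseBlock ε L β ω i) P := fun β =>
    h1.precomp (g := fun i : Fin L => (β, i)) fun i j hij => by simpa using hij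
  rw [iIndepFun_iff_map_fun_eq_infinitePi_map hmb]
  have h2 := (iIndepFun_iff_map_fun_eq_infinitePi_map hmeas).1 h1
  have hpr : ∀ p : ℕ × Fin L,
      IsProbabilityMeasure (P.map (ε ((1 + p.1 * L + (p.2 : ℕ) : ℕ) : ℤ))) :=
    fun p => Measure.isProbabilityMeasure_map (hmeas p).aemeasurable
  have hpr' : ∀ (β : ℕ) (i : Fin L),
      IsProbabilityMeasure (P.map (ε ((1 + β * L + (i : ℕ) : ℕ) : ℤ))) := fun β i => hpr (β, i)
  have h3 := Measure.infinitePi_map_curry (ι := ℕ) (κ := Fin L) (X := ℝ)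
    (fun β i => P.map (ε ((1 + β * L + (i : ℕ) : ℕ) : ℤ)))
  rw [← h2, Measure.map_map (by fun_prop) (by fun_prop)] at h3
  convert! h3 using 2
  funext β
  exact (iIndepFun_iff_map_fun_eq_infinitePi_map fun i => h.measurable _).1 (hrow β)

lemma identDistrib_noiseBlock (h : IsStdNoise P ε) (L β : ℕ) :
    IdentDistrib (noiseBlock ε L β) (noiseBlock ε L 0) P P := by
  have : IsProbabilityMeasure P := h.indep.isProbabilityMeasure
  have hmb : ∀ β, Measurable (noiseBlock ε L β) := fun β =>
    measurable_pi_lambda _ fun i => h.measurable _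
  have hrow : ∀ β, iIndepFun (fun i : Fin L => fun ω => noiseBlock ε L β ω i) P := fun β =>
    h.indep.precomp (g := fun i : Fin L => ((1 + β * L + (i : ℕ) : ℕ) : ℤ)) fun i j hij => by
      have : 1 + β * L + (i : ℕ) = 1 + β * L + (j : ℕ) := Int.ofNat_inj.1 hij
      exact Fin.ext (by omega)
  have hmap := fun β => (iIndepFun_iff_map_fun_eq_pi_map
    fun i => (h.measurable _).aemeasurable).1 (hrow β)
  refine ⟨(hmb β).aemeasurable, (hmb 0).aemeasurable, ?_⟩
  refine (hmap β).trans (Eq.trans ?_ (hmap 0).symm)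
  congr 1
  funext i
  exact (h.identDistrib _).map_eq.trans (h.identDistrib _).map_eq.symm

end Blocks

end PolyForm

namespace PolyForm

/-! ### Asymptotic normality of linear combinations of partial sums -/

/-! ### Stability of characteristic functions under `L²` perturbations. -/

section CharFun

variable {Ω : Type*} [MeasurableSpace Ω] {P : Measure Ω} [IsProbabilityMeasure P]

/-- The map `y ↦ exp (i * x * y)` is `|x|`-Lipschitz, and the `L¹` norm is at most the `L²` norm
because the variance of `|f - g|` is nonnegative. -/
lemma norm_charFun_sub_le (f g : Lp ℝ 2 P) (x : ℝ) :
    ‖charFun (P.map f) x - charFun (P.map g) x‖ ≤ |x| * ‖f - g‖ := by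
  have hf : AEMeasurable f P := (Lp.aestronglyMeasurable f).aemeasurable
  have hg : AEMeasurable g P := (Lp.aestronglyMeasurable g).aemeasurable
  have hint : ∀ h : Lp ℝ 2 P, Integrable (fun ω => Complex.exp (x * h ω * Complex.I)) P :=
    fun h => by
    have hh : AEMeasurable h P := (Lp.aestronglyMeasurable h).aemeasurable
    refine Integrable.of_bound (by fun_prop) 1 (ae_of_all _ fun ω => ?_)
    rw [← Complex.ofReal_mul, Complex.norm_exp_ofReal_mul_I]
  have hd : MemLp (fun ω => f ω - g ω) 2 P := (Lp.memLp f).sub (Lp.memLp g)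
  rw [charFun_apply_real, charFun_apply_real, integral_map hf (by fun_prop),
    integral_map hg (by fun_prop), ← integral_sub (hint f) (hint g)]
  have h1 : ∀ ω, ‖Complex.exp (x * f ω * Complex.I) - Complex.exp (x * g ω * Complex.I)‖ ≤
      |x| * |f ω - g ω| := fun ω => by
    have := Real.norm_exp_I_mul_ofReal_sub_one_le (x := x * (f ω - g ω))
    have e : Complex.exp (x * f ω * Complex.I) - Complex.exp (x * g ω * Complex.I) =
        Complex.exp (((x * g ω : ℝ) : ℂ) * Complex.I) *
          (Complex.exp (Complex.I * ((x * (f ω - g ω) : ℝ) : ℂ)) - 1) := by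
      rw [mul_sub, ← Complex.exp_add, mul_one]
      congr 2
      · push_cast
        ring
      · push_cast
        ring
    rw [e, norm_mul, Complex.norm_exp_ofReal_mul_I, one_mul]
    refine this.trans_eq ?_
    rw [Real.norm_eq_abs, abs_mul]
  have h2 : ∫ ω, |f ω - g ω| ∂P ≤ ‖f - g‖ := by
    have hv := variance_nonneg (fun ω => |f ω - g ω|) P
    rw [variance_eq_sub (X := fun ω => |f ω - g ω|) hd.abs] at hv
    have hn : ‖f - g‖ ^ 2 = ∫ ω, |f ω - g ω| ^ 2 ∂P := by
      rw [← real_inner_self_eq_norm_sq, L2.inner_def]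
      refine integral_congr_ae ?_
      filter_upwards [Lp.coeFn_sub f g] with ω hω
      rw [hω]
      simp [sq]
    refine abs_le_of_sq_le_sq' ?_ (norm_nonneg _) |>.2
    rw [hn]
    simpa using hv
  calc _ ≤ ∫ ω, |x| * |f ω - g ω| ∂P :=
        norm_integral_le_of_norm_le ((hd.abs.integrable one_le_two).const_mul _)
          (ae_of_all _ h1)
    _ = |x| * ∫ ω, |f ω - g ω| ∂P := integral_const_mul _ _
    _ ≤ _ := by gcongr

/-- The derivative is bounded by `1`, as `|z| ≤ 1 + z ^ 2 / 2 ≤ exp (z ^ 2 / 2)`. Taking `x`, `y` to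
be `L²` norms compares the Gaussian reference terms. -/
lemma abs_exp_neg_sq_sub_le (x y : ℝ) :
    |Real.exp (-(x ^ 2 / 2)) - Real.exp (-(y ^ 2 / 2))| ≤ |x - y| := by
  have hder : ∀ z ∈ (Set.univ : Set ℝ), HasDerivWithinAt (fun z : ℝ => Real.exp (-(z ^ 2 / 2)))
      (Real.exp (-(z ^ 2 / 2)) * -z) Set.univ z := fun z _ => by
    have h1 : HasDerivAt (fun z : ℝ => -(z ^ 2 / 2)) (-z) z := by
      have := ((hasDerivAt_id z).fun_pow 2).div_const 2 |>.fun_neg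
      simpa using this
    exact h1.exp.hasDerivWithinAt
  have hbd : ∀ z ∈ (Set.univ : Set ℝ), ‖Real.exp (-(z ^ 2 / 2)) * -z‖ ≤ 1 := fun z _ => by
    rw [norm_mul, norm_neg, Real.norm_of_nonneg (Real.exp_nonneg _), Real.exp_neg,
      Real.norm_eq_abs, inv_mul_le_iff₀ (Real.exp_pos _), mul_one]
    have h1 := Real.add_one_le_exp (z ^ 2 / 2)
    nlinarith [sq_nonneg (|z| - 1), sq_abs z]
  have := convex_univ.norm_image_sub_le_of_norm_hasDerivWithin_le hder hbd
    (Set.mem_univ y) (Set.mem_univ x)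
  simpa [Real.norm_eq_abs] using this

/-- If `h N` is approximated, up to an arbitrarily small error, by sequences with asymptotically
Gaussian characteristic functions, then `h N` has an asymptotically Gaussian characteristic
function. -/
lemma tendsto_charFun_sub_of_approx {h : ℕ → Lp ℝ 2 P}
    (happ : ∀ η > 0, ∃ g : ℕ → Lp ℝ 2 P, (∀ᶠ N in atTop, ‖h N - g N‖ ≤ η) ∧
      Tendsto (fun N => charFun (P.map (g N)) 1 - Complex.exp (-((‖g N‖ ^ 2 / 2 : ℝ) : ℂ)))
        atTop (𝓝 0)) :
    Tendsto (fun N => charFun (P.map (h N)) 1 - Complex.exp (-((‖h N‖ ^ 2 / 2 : ℝ) : ℂ)))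
      atTop (𝓝 0) := by
  rw [Metric.tendsto_atTop']
  intro η hη
  obtain ⟨g, hg1, hg2⟩ := happ (η / 4) (by linarith)
  have hg3 := (Metric.tendsto_nhds.1 hg2) (η / 4) (by linarith)
  obtain ⟨N₀, hN₀⟩ := eventually_atTop.1 (hg1.and hg3)
  refine ⟨N₀, fun N hN => ?_⟩
  obtain ⟨h1, h2⟩ := hN₀ N hN.le
  rw [dist_zero_right] at h2 ⊢
  have h3 := norm_charFun_sub_le (h N) (g N) 1
  have h4 : ‖Complex.exp (-((‖g N‖ ^ 2 / 2 : ℝ) : ℂ)) -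
      Complex.exp (-((‖h N‖ ^ 2 / 2 : ℝ) : ℂ))‖ ≤ ‖h N - g N‖ := by
    rw [← Complex.ofReal_neg, ← Complex.ofReal_exp, ← Complex.ofReal_neg, ← Complex.ofReal_exp,
      ← Complex.ofReal_sub, Complex.norm_real, Real.norm_eq_abs]
    refine (abs_exp_neg_sq_sub_le _ _).trans ?_
    rw [norm_sub_rev]
    exact abs_norm_sub_norm_le _ _
  rw [abs_one, one_mul] at h3
  calc _ = ‖(charFun (P.map (h N)) 1 - charFun (P.map (g N)) 1) +
        (charFun (P.map (g N)) 1 - Complex.exp (-((‖g N‖ ^ 2 / 2 : ℝ) : ℂ))) +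
        (Complex.exp (-((‖g N‖ ^ 2 / 2 : ℝ) : ℂ)) -
          Complex.exp (-((‖h N‖ ^ 2 / 2 : ℝ) : ℂ)))‖ := by
        congr 1
        ring
    _ ≤ η / 4 + η / 4 + η / 4 :=
        (norm_add₃_le).trans (add_le_add_three (h3.trans h1) h2.le (h4.trans h1))
    _ < η := by linarith

end CharFun

/-! ### From independent blocks to partial sums. -/

section Core

variable {Ω : Type*} [MeasurableSpace Ω] {P : Measure Ω} {ε : ℤ → Ω → ℝ}

lemma integral_coe_finsetSum {ι : Type*} (s : Finset ι) (f : ι → Lp ℝ 2 P)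
    [IsFiniteMeasure P] :
    ∫ ω, (∑ i ∈ s, f i : Lp ℝ 2 P) ω ∂P = ∑ i ∈ s, ∫ ω, f i ω ∂P := by
  rw [integral_congr_ae (Lp.coeFn_finsetSum s f)]
  simp only [Finset.sum_apply]
  exact integral_finsetSum _ fun i _ => (Lp.memLp (f i)).integrable one_le_two

variable {R : Type*} [Fintype R] {k : R → ℕ} {b : R → ℤ → ℝ} {c d : R → ℝ}

/-- Asymptotic normality of linear combinations of sums over disjoint blocks. -/
lemma tendsto_charFun_blocks [IsProbabilityMeasure P] (h : IsStdNoise P ε) (hk : ∀ r, 0 < k r)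
    (hb0 : ∀ r, ∀ i ≤ 0, b r i = 0) (hb : ∀ r, DecayBound (b r) (k r) (c r) (d r))
    (θ : R → ℝ) {K : R → ℕ → ℕ} {C : ℝ} (hK : ∀ r N, (K r N : ℝ) ≤ C * N) (m L : ℕ) :
    Tendsto (fun N : ℕ =>
      charFun (P.map ((√(N : ℝ))⁻¹ • ∑ r, θ r • ∑ β ∈ Finset.range (K r N),
        blockVec P ε (b r) (k r) m L β : Lp ℝ 2 P)) 1 -
      Complex.exp (-((‖(√(N : ℝ))⁻¹ • ∑ r, θ r • ∑ β ∈ Finset.range (K r N),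
        blockVec P ε (b r) (k r) m L β‖ ^ 2 / 2 : ℝ) : ℂ))) atTop (𝓝 0) := by
  classical
  let u : R → (Fin L → ℝ) → ℝ := fun r => blockFun (b r) (k r) m L
  -- Block `β` enters the `r`-th sum only if `β < K r N`, so its contribution depends on the set of
  -- active `r`. There are finitely many such sets, as `tendsto_charFun_array` demands. The length
  -- `Kt N` need only exceed every `K r N`: later blocks have no active `r`.
  let g : Finset R → (Fin L → ℝ) → ℝ := fun S x => ∑ r ∈ S, θ r * u r x
  let S : ℕ → ℕ → Finset R := fun N β => Finset.univ.filter fun r => β < K r N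
  let Kt : ℕ → ℕ := fun N => ∑ r, K r N
  have hu : ∀ r, Measurable (u r) := fun r => measurable_blockFun _ _ _ _
  have hae : ∀ r β, blockVec P ε (b r) (k r) m L β =ᵐ[P] fun ω => u r (noiseBlock ε L β ω) :=
    fun r β => blockVec_ae_eq h (hb0 r) (k r) m L β
  have hmean : ∀ r β, ∫ ω, blockVec P ε (b r) (k r) m L β ω ∂P = 0 := fun r β => by
    rw [blockVec, integral_coe_finsetSum]
    exact Finset.sum_eq_zero fun l _ => integral_formVec h (hk r)
      (((hb r).truncSeq m).summable_coeff_sq (hk r) _)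
  have hL2u : ∀ r, MemLp (fun ω => u r (noiseBlock ε L 0 ω)) 2 P := fun r =>
    (memLp_congr_ae (hae r 0)).1 (Lp.memLp _)
  have hmeanu : ∀ r, ∫ ω, u r (noiseBlock ε L 0 ω) ∂P = 0 := fun r => by
    rw [← integral_congr_ae (hae r 0)]
    exact hmean r 0
  have key := tendsto_charFun_array (iIndepFun_noiseBlock h L) (identDistrib_noiseBlock h L)
    (g := g) (fun S => by fun_prop) (fun S => by
      simp only [g]
      rw [integral_finsetSum _ fun r _ => ((hL2u r).integrable one_le_two).const_mul _]
      refine Finset.sum_eq_zero fun r _ => ?_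
      rw [integral_const_mul, hmeanu, mul_zero])
    (fun S => memLp_finsetSum _ fun r _ => (hL2u r).const_mul _)
    (K := Kt) (C := Fintype.card R * C) (fun N => by
      simp only [Kt]
      push_cast
      calc ∑ r, (K r N : ℝ) ≤ ∑ r : R, C * N := Finset.sum_le_sum fun r _ => hK r N
        _ = _ := by simp [mul_assoc]) S
  have hrw : ∀ N, (fun ω => ∑ β ∈ Finset.range (Kt N), g (S N β) (noiseBlock ε L β ω)) =ᵐ[P]
      (∑ r, θ r • ∑ β ∈ Finset.range (K r N), blockVec P ε (b r) (k r) m L β : Lp ℝ 2 P) :=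
    fun N => by
    have h1 : ∀ᵐ ω ∂P, ∀ r β, blockVec P ε (b r) (k r) m L β ω = u r (noiseBlock ε L β ω) :=
      ae_all_iff.2 fun r => ae_all_iff.2 fun β => hae r β
    have h2 : ∀ᵐ ω ∂P, ∀ r, (∑ β ∈ Finset.range (K r N), blockVec P ε (b r) (k r) m L β :
        Lp ℝ 2 P) ω = ∑ β ∈ Finset.range (K r N), blockVec P ε (b r) (k r) m L β ω :=
      ae_all_iff.2 fun r => by
        filter_upwards [Lp.coeFn_finsetSum (Finset.range (K r N))
          fun β => blockVec P ε (b r) (k r) m L β] with ω hω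
        rw [hω, Finset.sum_apply]
    have h3 : ∀ᵐ ω ∂P, ∀ r, (θ r • ∑ β ∈ Finset.range (K r N),
        blockVec P ε (b r) (k r) m L β : Lp ℝ 2 P) ω = θ r * (∑ β ∈ Finset.range (K r N),
        blockVec P ε (b r) (k r) m L β : Lp ℝ 2 P) ω :=
      ae_all_iff.2 fun r => Lp.coeFn_smul _ _
    filter_upwards [h1, h2, h3, Lp.coeFn_finsetSum Finset.univ fun r => θ r •
      ∑ β ∈ Finset.range (K r N), blockVec P ε (b r) (k r) m L β] with ω w1 w2 w3 w4
    rw [w4, Finset.sum_apply]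
    simp only [w3, w2, w1, g, S, Finset.sum_filter]
    rw [Finset.sum_comm]
    refine Finset.sum_congr rfl fun r _ => ?_
    rw [Finset.mul_sum, ← Finset.sum_filter]
    refine Finset.sum_congr ?_ fun _ _ => rfl
    ext β
    simp only [Finset.mem_filter, Finset.mem_range, and_iff_right_iff_imp]
    intro hβ
    exact hβ.trans_le (Finset.single_le_sum (f := fun r => K r N) (fun _ _ => Nat.zero_le _)
      (Finset.mem_univ r))
  refine key.congr fun N => ?_
  set V : Lp ℝ 2 P := ∑ r, θ r • ∑ β ∈ Finset.range (K r N), blockVec P ε (b r) (k r) m L β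
  congr 1
  · rw [Measure.map_congr (hrw N)]
    have hsm : ((√(N : ℝ))⁻¹ • V : Lp ℝ 2 P) =ᵐ[P] fun ω => (√(N : ℝ))⁻¹ * V ω := Lp.coeFn_smul _ _
    rw [Measure.map_congr hsm, charFun_map_mul_comp (Lp.aestronglyMeasurable V).aemeasurable,
      mul_one]
  · have hn : ‖V‖ ^ 2 = ∫ ω, (∑ β ∈ Finset.range (Kt N),
        g (S N β) (noiseBlock ε L β ω)) ^ 2 ∂P := by
      rw [← real_inner_self_eq_norm_sq, L2.inner_def]
      refine integral_congr_ae ?_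
      filter_upwards [hrw N] with ω hω
      rw [hω, sq]
      rfl
    rw [← hn, norm_smul, mul_pow, Real.norm_of_nonneg (by positivity), mul_comm (_ ^ 2)]

/-- **Central limit theorem** for linear combinations of partial sums of polynomial forms. -/
theorem tendsto_charFun_sumVec [IsProbabilityMeasure P] (h : IsStdNoise P ε) (hk : ∀ r, 0 < k r)
    (hb0 : ∀ r, ∀ i ≤ 0, b r i = 0) (hb : ∀ r, DecayBound (b r) (k r) (c r) (d r))
    (θ : R → ℝ) {M : R → ℕ → ℕ} {C : ℝ} (hC : 0 ≤ C) (hM : ∀ r N, (M r N : ℝ) ≤ C * N) :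
    Tendsto (fun N : ℕ =>
      charFun (P.map ((√(N : ℝ))⁻¹ • ∑ r, θ r • sumVec P ε (b r) (k r) (M r N) : Lp ℝ 2 P)) 1 -
      Complex.exp (-((‖(√(N : ℝ))⁻¹ • ∑ r, θ r • sumVec P ε (b r) (k r) (M r N)‖ ^ 2 / 2 : ℝ)
        : ℂ))) atTop (𝓝 0) := by
  refine tendsto_charFun_sub_of_approx fun η hη => ?_
  let Γ : R → ℝ := fun r => totalCorr (coeff (powerSeq (c r) (d r)) (k r) 0)
  let τ : R → ℕ → ℝ := fun r m => totalCorr (tailPart (coeff (powerSeq (c r) (d r)) (k r) 0) m)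
  have h0 : ∀ r A, 0 ≤ coeff (powerSeq (c r) (d r)) (k r) 0 A := fun r =>
    coeff_nonneg (powerSeq_nonneg (hb r).1.le _) _ _
  have hΓ : ∀ r, 0 ≤ Γ r := fun r => totalCorr_nonneg (h0 r)
  have hτ : ∀ r m, 0 ≤ τ r m := fun r m => totalCorr_nonneg (tailPart_nonneg (h0 r) m)
  -- Order of choice: `m` controls the truncation error, then `L`, depending on `m`, the gap
  -- proportion `m / L`, and finally `N` the leftover `L / N`.
  have hlim1 : Tendsto (fun m => ∑ r, |θ r| * √(C * τ r m)) atTop (𝓝 0) := by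
    have : ∀ r, Tendsto (fun m => |θ r| * √(C * τ r m)) atTop (𝓝 0) := fun r => by
      have := ((tendsto_totalCorr_tailPart (h0 r) ((hb r).shiftSummable (hk r))).const_mul
        C).sqrt.const_mul |θ r|
      simpa using this
    simpa using tendsto_finsetSum Finset.univ fun r _ => this r
  obtain ⟨m, hm⟩ := (hlim1.eventually_lt_const (by linarith : (0 : ℝ) < η / 2)).exists
  have hlim2 : Tendsto (fun L : ℕ => ∑ r, |θ r| * √(C * (m / L : ℝ) * Γ r)) atTop (𝓝 0) := by
    have : ∀ r, Tendsto (fun L : ℕ => |θ r| * √(C * (m / L : ℝ) * Γ r)) atTop (𝓝 0) :=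
      fun r => by
      have := (((tendsto_const_div_atTop_nhds_zero_nat (m : ℝ)).const_mul C).mul_const
        (Γ r)).sqrt.const_mul |θ r|
      simpa using this
    simpa using tendsto_finsetSum Finset.univ fun r _ => this r
  obtain ⟨L, hL, hL1⟩ := ((hlim2.eventually_lt_const (by linarith : (0 : ℝ) < η / 2)).and
    (eventually_ge_atTop (max 1 m))).exists
  have hL0 : 0 < L := (le_max_left 1 m).trans hL1
  have hmL : m ≤ L := (le_max_right 1 m).trans hL1
  have hlim3 : Tendsto (fun N : ℕ => ∑ r, |θ r| * (√(C * τ r m) +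
      √((C * (m / L : ℝ) + L / N) * Γ r))) atTop
      (𝓝 (∑ r, |θ r| * (√(C * τ r m) + √(C * (m / L : ℝ) * Γ r)))) := by
    refine tendsto_finsetSum Finset.univ fun r _ => Tendsto.const_mul _ (Tendsto.const_add _ ?_)
    have := (((tendsto_const_div_atTop_nhds_zero_nat (L : ℝ)).const_add
      (C * (m / L : ℝ))).mul_const (Γ r)).sqrt
    simpa using this
  have hlt : ∑ r, |θ r| * (√(C * τ r m) + √(C * (m / L : ℝ) * Γ r)) < η := by
    simp only [mul_add, Finset.sum_add_distrib]
    linarith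
  refine ⟨fun N => (√(N : ℝ))⁻¹ • ∑ r, θ r • ∑ β ∈ Finset.range (M r N / L),
    blockVec P ε (b r) (k r) m L β, ?_, tendsto_charFun_blocks h hk hb0 hb θ (C := C)
      (fun r N => ?_) m L⟩
  · filter_upwards [hlim3.eventually_lt_const hlt, eventually_gt_atTop 0] with N hN hN0
    refine le_trans ?_ hN.le
    have hN' : (0 : ℝ) < N := by exact_mod_cast hN0
    rw [← smul_sub, ← Finset.sum_sub_distrib, norm_smul, Real.norm_of_nonneg (by positivity)]
    calc _ ≤ (√(N : ℝ))⁻¹ * ∑ r, |θ r| * (√(M r N * τ r m) +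
          √((M r N * (m / L : ℝ) + L) * Γ r)) := by
          gcongr
          refine (norm_sum_le _ _).trans (Finset.sum_le_sum fun r _ => ?_)
          rw [← smul_sub, norm_smul, Real.norm_eq_abs]
          gcongr
          exact norm_sumVec_sub_blocks_le h (hk r) (hb r) hL0 hmL (M r N)
      _ ≤ (√(N : ℝ))⁻¹ * ∑ r, |θ r| * (√(N * (C * τ r m)) +
          √(N * ((C * (m / L : ℝ) + L / N) * Γ r))) := by
          refine mul_le_mul_of_nonneg_left (Finset.sum_le_sum fun r _ => mul_le_mul_of_nonneg_left
            (add_le_add (Real.sqrt_le_sqrt ?_) (Real.sqrt_le_sqrt ?_)) (abs_nonneg _))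
            (by positivity)
          · calc (M r N : ℝ) * τ r m ≤ C * N * τ r m :=
                  mul_le_mul_of_nonneg_right (hM r N) (hτ r m)
              _ = _ := by ring
          · have e : (N : ℝ) * ((C * (m / L : ℝ) + L / N) * Γ r) =
                (C * N * (m / L : ℝ) + L) * Γ r := by
              field_simp
            rw [e]
            refine mul_le_mul_of_nonneg_right ?_ (hΓ r)
            have := mul_le_mul_of_nonneg_right (hM r N) (by positivity : (0 : ℝ) ≤ m / L)
            linarith
      _ = _ := by
          rw [Finset.mul_sum]
          refine Finset.sum_congr rfl fun r _ => ?_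
          rw [Real.sqrt_mul hN'.le, Real.sqrt_mul hN'.le]
          field_simp
  · refine le_trans ?_ (hM r N)
    exact_mod_cast Nat.div_le_self _ _

end Core

end PolyForm

namespace PolyForm

/-! ### Random sine series with continuous sums -/

/-- The eigenfunctions `√2 sin(nπx)/(nπ)` of the covariance of the Brownian bridge. -/
noncomputable def sineCoeff (n : ℕ) (x : ℝ) : ℝ :=
  √2 * Real.sin (n * (Real.pi * x)) / (n * Real.pi)

lemma sineCoeff_zero (x : ℝ) : sineCoeff 0 x = 0 := by simp [sineCoeff]

/-- A product of sines is half a difference of cosines, and `∑ cos (2πnz) / n ^ 2 = π ^ 2 * (z ^ 2 -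
z + 1 / 6)` on `[0, 1]`, applied at `z = |x - y| / 2` and `z = (x + y) / 2`. -/
lemma hasSum_sineCoeff_mul {x y : ℝ} (hx : x ∈ Set.Icc (0 : ℝ) 1) (hy : y ∈ Set.Icc (0 : ℝ) 1) :
    HasSum (fun n => sineCoeff n x * sineCoeff n y) (min x y - x * y) := by
  have h1 := hasSum_one_div_nat_pow_mul_cos one_ne_zero (x := |x - y| / 2)
    ⟨by positivity, by
      have : |x - y| ≤ 1 := abs_le.2 ⟨by linarith [hx.1, hy.2], by linarith [hx.2, hy.1]⟩
      linarith⟩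
  have h2 := hasSum_one_div_nat_pow_mul_cos one_ne_zero (x := (x + y) / 2)
    ⟨by linarith [hx.1, hy.1], by linarith [hx.2, hy.2]⟩
  have hB : ∀ z : ℝ, (Polynomial.map (algebraMap ℚ ℝ) (Polynomial.bernoulli (2 * 1))).eval z =
      z ^ 2 - z + 6⁻¹ := fun z => bernoulliFun_two z
  rw [hB] at h1 h2
  have h3 := (h1.sub h2).div_const (Real.pi ^ 2)
  convert! h3 using 1
  · funext n
    rcases eq_or_ne n 0 with rfl | hn
    · simp [sineCoeff]
    have hc : Real.cos (2 * Real.pi * n * (|x - y| / 2)) =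
        Real.cos (n * (Real.pi * x) - n * (Real.pi * y)) := by
      rw [show 2 * Real.pi * n * (|x - y| / 2) = |n * (Real.pi * x) - n * (Real.pi * y)| by
        rw [← mul_sub, ← mul_sub, abs_mul, abs_mul, abs_of_nonneg Real.pi_pos.le,
          abs_of_nonneg (Nat.cast_nonneg (α := ℝ) n)]
        ring, Real.cos_abs]
    rw [hc, show 2 * Real.pi * n * ((x + y) / 2) = n * (Real.pi * x) + n * (Real.pi * y) by ring,
      Real.cos_sub, Real.cos_add, sineCoeff, sineCoeff]
    have hn' : (n : ℝ) ≠ 0 := by exact_mod_cast hn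
    have := Real.pi_ne_zero
    have h2 : √2 * √2 = (2 : ℝ) := Real.mul_self_sqrt (by norm_num)
    field_simp
    linear_combination ((n : ℝ) ^ 2 * Real.sin (n * Real.pi * x) * Real.sin (n * Real.pi * y)) * h2
  · have := Real.pi_ne_zero
    rcases le_total x y with h | h
    · rw [min_eq_left h, abs_of_nonpos (by linarith)]
      norm_num
      field_simp
      ring
    · rw [min_eq_right h, abs_of_nonneg (by linarith)]
      norm_num
      field_simp
      ring

/-- The correlation of lag `d` of the finite sequence `(c n)`, `n ∈ I`. -/
def lagCorr (I : Finset ℕ) (c : ℕ → ℝ) (d : ℤ) : ℝ :=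
  ∑ p ∈ (I ×ˢ I).filter fun p : ℕ × ℕ => (p.1 : ℤ) - p.2 = d, c p.1 * c p.2

/-- Adding the square of the cosine sum gives `|∑ c n * exp (i * n * θ)| ^ 2`, in which `θ` appears
only through factors `cos (d * θ)`, one per lag. The resulting bound is uniform in `θ`. -/
lemma sq_sum_sin_le (I : Finset ℕ) (c : ℕ → ℝ) (D : Finset ℤ)
    (hD : ∀ n ∈ I, ∀ m ∈ I, (n : ℤ) - m ∈ D) (θ : ℝ) :
    (∑ n ∈ I, c n * Real.sin (n * θ)) ^ 2 ≤ ∑ d ∈ D, |lagCorr I c d| := by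
  have h1 : (∑ n ∈ I, c n * Real.sin (n * θ)) ^ 2 + (∑ n ∈ I, c n * Real.cos (n * θ)) ^ 2 =
      ∑ d ∈ D, Real.cos (d * θ) * lagCorr I c d := by
    rw [sq, sq, Finset.sum_mul_sum, Finset.sum_mul_sum, ← Finset.sum_product', ← Finset.sum_product',
      ← Finset.sum_add_distrib, ← Finset.sum_fiberwise_of_maps_to (s := I ×ˢ I) (t := D)
        (g := fun p : ℕ × ℕ => (p.1 : ℤ) - p.2)]
    · refine Finset.sum_congr rfl fun d _ => ?_
      rw [lagCorr, Finset.mul_sum]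
      refine Finset.sum_congr rfl fun p hp => ?_
      have hd := (Finset.mem_filter.1 hp).2
      rw [← hd]
      push_cast
      rw [sub_mul, Real.cos_sub]
      ring
    · intro p hp
      rw [Finset.mem_product] at hp
      exact hD _ hp.1 _ hp.2
  calc _ ≤ (∑ n ∈ I, c n * Real.sin (n * θ)) ^ 2 + (∑ n ∈ I, c n * Real.cos (n * θ)) ^ 2 :=
        le_add_of_nonneg_right (sq_nonneg _)
    _ = _ := h1
    _ ≤ _ := Finset.sum_le_sum fun d _ => by
        refine (le_abs_self _).trans ?_
        rw [abs_mul]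
        exact mul_le_of_le_one_left (abs_nonneg _) (Real.abs_cos_le_one _)

/-- It trades absolute values for squares, whose expectations are computable; `δ` is to be taken of
the expected size of `x`. -/
lemma abs_le_add_sq_div (x : ℝ) {δ : ℝ} (hδ : 0 < δ) : |x| ≤ δ + δ⁻¹ * x ^ 2 := by
  rw [← sq_abs x, ← sub_nonneg]
  have : δ + δ⁻¹ * |x| ^ 2 - |x| = δ⁻¹ * ((|x| - δ / 2) ^ 2 + 3 / 4 * δ ^ 2) := by
    field_simp
    ring
  rw [this]
  positivity

/-- A bound, uniform in `θ`, for `∑_{n ∈ I} c n sin(nθ)`. -/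
noncomputable def sineBound (I : Finset ℕ) (D : Finset ℤ) (q : ℝ) (c : ℕ → ℝ) : ℝ :=
  q⁻¹ + q * (lagCorr I c 0 + ∑ d ∈ D.erase 0, ((q ^ 6)⁻¹ + q ^ 6 * lagCorr I c d ^ 2))

lemma lagCorr_zero (I : Finset ℕ) (c : ℕ → ℝ) : lagCorr I c 0 = ∑ n ∈ I, c n ^ 2 := by
  rw [lagCorr]
  refine Finset.sum_nbij' (fun p => p.1) (fun n => (n, n)) ?_ ?_ ?_ ?_ ?_
  · intro p hp
    exact (Finset.mem_product.1 (Finset.mem_filter.1 hp).1).1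
  · intro n hn
    simp [hn]
  · intro p hp
    have := (Finset.mem_filter.1 hp).2
    exact Prod.ext rfl (by dsimp only; omega)
  · intro n _
    rfl
  · intro p hp
    have : p.1 = p.2 := by
      have := (Finset.mem_filter.1 hp).2
      omega
    rw [← this, sq]

lemma abs_sum_sin_le (I : Finset ℕ) (c : ℕ → ℝ) (D : Finset ℤ)
    (hD : ∀ n ∈ I, ∀ m ∈ I, (n : ℤ) - m ∈ D) (h0 : (0 : ℤ) ∈ D) {q : ℝ} (hq : 0 < q) (θ : ℝ) :
    |∑ n ∈ I, c n * Real.sin (n * θ)| ≤ sineBound I D q c := by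
  have h1 := abs_le_add_sq_div (∑ n ∈ I, c n * Real.sin (n * θ)) (inv_pos.2 hq)
  rw [inv_inv] at h1
  refine h1.trans ?_
  unfold sineBound
  gcongr
  refine (sq_sum_sin_le I c D hD θ).trans ?_
  rw [← Finset.add_sum_erase D _ h0]
  refine add_le_add ?_ (Finset.sum_le_sum fun d _ => ?_)
  · rw [abs_of_nonneg]
    rw [lagCorr_zero]
    exact Finset.sum_nonneg fun n _ => sq_nonneg _
  · have := abs_le_add_sq_div (lagCorr I c d) (by positivity : 0 < (q ^ 6)⁻¹)
    rwa [inv_inv] at this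

/-- The indices of the block number `i` of the series. -/
def sineBlock (i : ℕ) : Finset ℕ := Finset.Ico (16 ^ i) (16 ^ (i + 1))

/-- The sum of the block number `i` of the series `∑ √2 sin(nπx)/(nπ) ε_n`. -/
noncomputable def sineBlockSum {Ω : Type*} (ε : ℤ → Ω → ℝ) (i : ℕ) (ω : Ω) (x : ℝ) : ℝ :=
  ∑ n ∈ sineBlock i, sineCoeff n x * ε n ω

lemma continuous_sineBlockSum {Ω : Type*} (ε : ℤ → Ω → ℝ) (i : ℕ) (ω : Ω) :
    Continuous (sineBlockSum ε i ω) := by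
  unfold sineBlockSum sineCoeff
  fun_prop

section Noise

variable {Ω : Type*} [MeasurableSpace Ω] {P : Measure Ω} {ε : ℤ → Ω → ℝ}

/-- The normalized noise `ε_n / n`. -/
noncomputable def scaledNoise (ε : ℤ → Ω → ℝ) (ω : Ω) (n : ℕ) : ℝ := ε n ω / n

lemma integrable_sq_and_integral_lagCorr_zero (h : IsStdNoise P ε) (I : Finset ℕ) :
    Integrable (fun ω => lagCorr I (scaledNoise ε ω) 0) P ∧
      ∫ ω, lagCorr I (scaledNoise ε ω) 0 ∂P = ∑ n ∈ I, ((n : ℝ) ^ 2)⁻¹ := by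
  simp only [lagCorr_zero, scaledNoise, div_pow]
  have hi : ∀ n ∈ I, Integrable (fun ω => ε n ω ^ 2 / (n : ℝ) ^ 2) P := fun n _ =>
    (h.memLp_all n).integrable_sq.div_const _
  refine ⟨integrable_finsetSum _ hi, ?_⟩
  rw [integral_finsetSum _ hi]
  refine Finset.sum_congr rfl fun n _ => ?_
  rw [integral_div, h.sq_all, one_div]

/-- For `d ≠ 0` the products `ε n * ε m` with `n - m = d` are orthonormal: two such pairs with the
same underlying set coincide, since a swap would change the lag to `-d`. No fourth moment is
involved. -/
lemma integrable_sq_and_integral_lagCorr_sq (h : IsStdNoise P ε) (I : Finset ℕ) {d : ℤ}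
    (hd : d ≠ 0) :
    Integrable (fun ω => lagCorr I (scaledNoise ε ω) d ^ 2) P ∧
      ∫ ω, lagCorr I (scaledNoise ε ω) d ^ 2 ∂P =
        ∑ p ∈ (I ×ˢ I).filter fun p : ℕ × ℕ => (p.1 : ℤ) - p.2 = d,
          ((p.1 : ℝ) ^ 2)⁻¹ * ((p.2 : ℝ) ^ 2)⁻¹ := by
  set S := (I ×ˢ I).filter fun p : ℕ × ℕ => (p.1 : ℤ) - p.2 = d with hS
  have hpd : ∀ p ∈ S, (p.1 : ℤ) - p.2 = d := fun p hp => (Finset.mem_filter.1 hp).2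
  have e : ∀ p ∈ S, ∀ ω, scaledNoise ε ω p.1 * scaledNoise ε ω p.2 =
      ((p.1 : ℝ)⁻¹ * (p.2 : ℝ)⁻¹) * noiseProd ε {(p.1 : ℤ), (p.2 : ℤ)} ω := fun p hp ω => by
    have hne : (p.1 : ℤ) ≠ p.2 := fun h0 => hd (by rw [← hpd p hp, h0, sub_self])
    rw [noiseProd, Finset.prod_pair hne, scaledNoise, scaledNoise]
    ring
  have e2 : ∀ ω, lagCorr I (scaledNoise ε ω) d ^ 2 = ∑ p ∈ S, ∑ p' ∈ S,
      (((p.1 : ℝ)⁻¹ * (p.2 : ℝ)⁻¹) * ((p'.1 : ℝ)⁻¹ * (p'.2 : ℝ)⁻¹)) *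
        (noiseProd ε {(p.1 : ℤ), (p.2 : ℤ)} ω * noiseProd ε {(p'.1 : ℤ), (p'.2 : ℤ)} ω) :=
    fun ω => by
    rw [lagCorr, sq, Finset.sum_mul_sum]
    refine Finset.sum_congr rfl fun p hp => Finset.sum_congr rfl fun p' hp' => ?_
    rw [e p hp, e p' hp']
    ring
  have hint : ∀ p p' : ℕ × ℕ, Integrable (fun ω =>
      (((p.1 : ℝ)⁻¹ * (p.2 : ℝ)⁻¹) * ((p'.1 : ℝ)⁻¹ * (p'.2 : ℝ)⁻¹)) *
        (noiseProd ε {(p.1 : ℤ), (p.2 : ℤ)} ω * noiseProd ε {(p'.1 : ℤ), (p'.2 : ℤ)} ω)) P :=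
    fun p p' => ((h.memLp_noiseProd _).integrable_mul (h.memLp_noiseProd _)).const_mul _
  simp_rw [e2]
  refine ⟨integrable_finsetSum _ fun p _ => integrable_finsetSum _ fun p' _ => hint p p', ?_⟩
  rw [integral_finsetSum _ fun p _ => integrable_finsetSum _ fun p' _ => hint p p']
  refine Finset.sum_congr rfl fun p hp => ?_
  rw [integral_finsetSum _ fun p' _ => hint p p', Finset.sum_eq_single_of_mem p hp]
  · rw [integral_const_mul, h.integral_noiseProd_mul, if_pos rfl]
    ring
  · intro p' hp' hne
    rw [integral_const_mul, h.integral_noiseProd_mul, if_neg, mul_zero]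
    intro heq
    apply hne
    have h1 : (p.1 : ℤ) ∈ ({(p'.1 : ℤ), (p'.2 : ℤ)} : Finset ℤ) := by rw [← heq]; simp
    have h2 : (p.2 : ℤ) ∈ ({(p'.1 : ℤ), (p'.2 : ℤ)} : Finset ℤ) := by rw [← heq]; simp
    simp only [Finset.mem_insert, Finset.mem_singleton] at h1 h2
    have h3 := hpd p hp
    have h4 := hpd p' hp'
    exact Prod.ext (by omega) (by omega)

/-- The weights in `sineBound` fit indices of order `q ^ 4`. The diagonal term is then `O(q ^ (-4))`
and each other correlation has root mean square `O(q ^ (-6))`. Over `O(q ^ 4)` lags this totals `O(q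
^ (-2))`, so the sine sum is of order `q⁻¹`. -/
lemma integral_sineBound_le (h : IsStdNoise P ε) (I : Finset ℕ) (D : Finset ℤ) {q : ℝ}
    (hq : 1 ≤ q) (hI : ∀ n ∈ I, q ^ 4 ≤ (n : ℝ)) (hIc : (I.card : ℝ) ≤ 16 * q ^ 4)
    (hDc : (D.card : ℝ) ≤ 32 * q ^ 4) :
    Integrable (fun ω => sineBound I D q (scaledNoise ε ω)) P ∧
      ∫ ω, sineBound I D q (scaledNoise ε ω) ∂P ≤ 600 * q⁻¹ := by
  have : IsProbabilityMeasure P := h.indep.isProbabilityMeasure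
  have hq0 : 0 < q := by linarith
  have h0 := integrable_sq_and_integral_lagCorr_zero h I
  have hd := fun d (hd : d ∈ D.erase 0) =>
    integrable_sq_and_integral_lagCorr_sq h I (Finset.ne_of_mem_erase hd)
  have hi1 : ∀ d ∈ D.erase 0, Integrable (fun ω => (q ^ 6)⁻¹ + q ^ 6 *
      lagCorr I (scaledNoise ε ω) d ^ 2) P := fun d hdd =>
    (integrable_const _).add ((hd d hdd).1.const_mul _)
  have hi2 := integrable_finsetSum _ hi1
  have hI4 : ∀ n ∈ I, ((n : ℝ) ^ 2)⁻¹ ≤ (q ^ 8)⁻¹ := fun n hn => by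
    have := pow_le_pow_left₀ (by positivity) (hI n hn) 2
    gcongr
    linarith [this, show (q ^ 4) ^ 2 = q ^ 8 by ring]
  have b0 : ∫ ω, lagCorr I (scaledNoise ε ω) 0 ∂P ≤ 16 * q ^ 4 * (q ^ 8)⁻¹ := by
    rw [h0.2]
    calc _ ≤ ∑ n ∈ I, (q ^ 8)⁻¹ := Finset.sum_le_sum hI4
      _ = I.card * (q ^ 8)⁻¹ := by simp
      _ ≤ _ := by gcongr
  have bd : ∀ d ∈ D.erase 0, ∫ ω, lagCorr I (scaledNoise ε ω) d ^ 2 ∂P ≤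
      16 * q ^ 4 * (q ^ 16)⁻¹ := fun d hdd => by
    rw [(hd d hdd).2]
    calc _ ≤ ∑ p ∈ (I ×ˢ I).filter fun p : ℕ × ℕ => (p.1 : ℤ) - p.2 = d, (q ^ 16)⁻¹ := by
          refine Finset.sum_le_sum fun p hp => ?_
          have hp' := Finset.mem_product.1 (Finset.mem_filter.1 hp).1
          calc _ ≤ (q ^ 8)⁻¹ * (q ^ 8)⁻¹ :=
                mul_le_mul (hI4 _ hp'.1) (hI4 _ hp'.2) (by positivity) (by positivity)
            _ = _ := by rw [← mul_inv, ← pow_add]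
      _ = ((I ×ˢ I).filter fun p : ℕ × ℕ => (p.1 : ℤ) - p.2 = d).card * (q ^ 16)⁻¹ := by simp
      _ ≤ I.card * (q ^ 16)⁻¹ := by
          gcongr
          refine Finset.card_le_card_of_injOn Prod.fst (fun p hp => ?_) fun p hp p' hp' hpp => ?_
          · simp only [Finset.coe_filter, Finset.mem_product, Set.mem_ofPred_eq] at hp
            exact hp.1.1
          · simp only [Finset.coe_filter, Set.mem_ofPred_eq] at hp hp'
            exact Prod.ext hpp (by omega)
      _ ≤ _ := by gcongr
  have hi3 : Integrable (fun ω => lagCorr I (scaledNoise ε ω) 0 + ∑ d ∈ D.erase 0,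
      ((q ^ 6)⁻¹ + q ^ 6 * lagCorr I (scaledNoise ε ω) d ^ 2)) P := h0.1.add hi2
  refine ⟨(integrable_const _).add (hi3.const_mul _), ?_⟩
  unfold sineBound
  rw [integral_add (integrable_const _) (hi3.const_mul _), integral_const_mul,
    integral_add h0.1 hi2, integral_finsetSum _ hi1]
  have hsum : ∑ d ∈ D.erase 0, ∫ ω, ((q ^ 6)⁻¹ + q ^ 6 * lagCorr I (scaledNoise ε ω) d ^ 2) ∂P ≤
      32 * q ^ 4 * ((q ^ 6)⁻¹ + q ^ 6 * (16 * q ^ 4 * (q ^ 16)⁻¹)) := by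
    calc _ ≤ ∑ d ∈ D.erase 0, ((q ^ 6)⁻¹ + q ^ 6 * (16 * q ^ 4 * (q ^ 16)⁻¹)) := by
          refine Finset.sum_le_sum fun d hdd => ?_
          rw [integral_add (integrable_const _) ((hd d hdd).1.const_mul _), integral_const_mul]
          simp only [integral_const, probReal_univ, smul_eq_mul, one_mul]
          gcongr
          exact bd d hdd
      _ = ((D.erase 0).card : ℝ) * ((q ^ 6)⁻¹ + q ^ 6 * (16 * q ^ 4 * (q ^ 16)⁻¹)) := by
          rw [Finset.sum_const, nsmul_eq_mul]
      _ ≤ _ := by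
          gcongr
          refine le_trans ?_ hDc
          exact_mod_cast Finset.card_erase_le
  simp only [integral_const, probReal_univ, smul_eq_mul, one_mul]
  calc _ ≤ q⁻¹ + q * (16 * q ^ 4 * (q ^ 8)⁻¹ +
        32 * q ^ 4 * ((q ^ 6)⁻¹ + q ^ 6 * (16 * q ^ 4 * (q ^ 16)⁻¹))) := by gcongr
    _ = 545 * q⁻¹ + 16 * (q ^ 3)⁻¹ := by
        field_simp
        ring
    _ ≤ 545 * q⁻¹ + 16 * q⁻¹ := by
        gcongr
        exact le_self_pow₀ hq (by norm_num)
    _ ≤ _ := by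
        have := inv_pos.2 hq0
        linarith

/-- The blocks of the series are almost surely bounded by the terms of a convergent series. -/
theorem ae_exists_summable_bound (h : IsStdNoise P ε) :
    ∀ᵐ ω ∂P, ∃ u : ℕ → ℝ, Summable u ∧ ∀ i x, |sineBlockSum ε i ω x| ≤ u i := by
  have : IsProbabilityMeasure P := h.indep.isProbabilityMeasure
  let D : ℕ → Finset ℤ := fun i => Finset.Ico (-(16 ^ (i + 1) : ℤ)) (16 ^ (i + 1))
  let F : ℕ → Ω → ℝ := fun i ω => sineBound (sineBlock i) (D i) (2 ^ i) (scaledNoise ε ω)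
  have hq4 : ∀ i : ℕ, ((2 : ℝ) ^ i) ^ 4 = 16 ^ i := fun i => by
    rw [← pow_mul, mul_comm, pow_mul]
    norm_num
  have hb : ∀ i ω x, |sineBlockSum ε i ω x| ≤ F i ω := fun i ω x => by
    have h1 := abs_sum_sin_le (sineBlock i) (scaledNoise ε ω) (D i) (fun n hn m hm => by
      simp only [sineBlock, Finset.mem_Ico] at hn hm
      simp only [D, Finset.mem_Ico]
      have h1 : (n : ℤ) < 16 ^ (i + 1) := by exact_mod_cast hn.2
      have h2 : (m : ℤ) < 16 ^ (i + 1) := by exact_mod_cast hm.2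
      omega) (by
        simp only [D, Finset.mem_Ico]
        have : (0 : ℤ) < 16 ^ (i + 1) := by positivity
        omega) (q := 2 ^ i) (by positivity) (Real.pi * x)
    refine le_trans ?_ h1
    have e : sineBlockSum ε i ω x = (√2 / Real.pi) *
        ∑ n ∈ sineBlock i, scaledNoise ε ω n * Real.sin (n * (Real.pi * x)) := by
      rw [sineBlockSum, Finset.mul_sum]
      refine Finset.sum_congr rfl fun n _ => ?_
      rw [sineCoeff, scaledNoise]
      have := Real.pi_ne_zero
      rcases eq_or_ne (n : ℝ) 0 with hn | hn
      · rw [hn]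
        simp
      · field_simp
    rw [e, abs_mul]
    refine mul_le_of_le_one_left (abs_nonneg _) ?_
    rw [abs_of_nonneg (by positivity), div_le_one Real.pi_pos]
    have : √2 ≤ 2 := by
      rw [Real.sqrt_le_left (by norm_num)]
      norm_num
    linarith [Real.pi_gt_three]
  have hF := fun i => integral_sineBound_le h (sineBlock i) (D i) (q := 2 ^ i)
    (one_le_pow₀ (by norm_num)) (fun n hn => by
      rw [hq4]
      exact_mod_cast (Finset.mem_Ico.1 hn).1) (by
      rw [hq4, sineBlock, Nat.card_Ico]
      have : 16 ^ (i + 1) - 16 ^ i ≤ 16 * 16 ^ i := by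
        rw [pow_succ]
        omega
      exact_mod_cast this) (by
      rw [hq4]
      have : (D i).card = 32 * 16 ^ i := by
        simp only [D, Int.card_Ico]
        have e : (16 ^ (i + 1) - -(16 ^ (i + 1)) : ℤ) = ((32 * 16 ^ i : ℕ) : ℤ) := by
          push_cast
          ring
        rw [e, Int.toNat_natCast]
      rw [this]
      push_cast
      rfl)
  have hF0 : ∀ i ω, 0 ≤ F i ω := fun i ω => (abs_nonneg _).trans (hb i ω 0)
  have hsum : Summable fun i : ℕ => 600 * ((2 : ℝ) ^ i)⁻¹ := by
    have := (summable_geometric_of_lt_one (by norm_num) (by norm_num : (1 / 2 : ℝ) < 1)).mul_left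
      600
    simpa using this
  -- The expectations are dominated by a geometric series, so `∑ F i ω` has finite expectation and
  -- is finite almost surely.
  have hlin : ∑' i, ∫⁻ ω, ENNReal.ofReal (F i ω) ∂P < ∞ := by
    calc _ ≤ ∑' i : ℕ, ENNReal.ofReal (600 * ((2 : ℝ) ^ i)⁻¹) := by
          refine ENNReal.tsum_le_tsum fun i => ?_
          rw [← ofReal_integral_eq_lintegral_ofReal (hF i).1 (ae_of_all _ (hF0 i))]
          exact ENNReal.ofReal_le_ofReal (hF i).2
      _ < ∞ := by
          rw [← ENNReal.ofReal_tsum_of_nonneg (fun i => by positivity) hsum]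
          exact ENNReal.ofReal_lt_top
  rw [← lintegral_tsum fun i => (hF i).1.aestronglyMeasurable.aemeasurable.ennreal_ofReal] at hlin
  have hae := ae_lt_top' (AEMeasurable.tsum fun i =>
    (hF i).1.aestronglyMeasurable.aemeasurable.ennreal_ofReal) hlin.ne
  filter_upwards [hae] with ω hω
  refine ⟨fun i => F i ω, ?_, fun i x => hb i ω x⟩
  have := ENNReal.summable_toReal hω.ne
  exact this.congr fun i => ENNReal.toReal_ofReal (hF0 i ω)

end Noise

end PolyForm

namespace PolyForm

/-! ### Centered Gaussian families -/

section GaussianFamily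

variable {ι Ω : Type*} [MeasurableSpace Ω] {P : Measure Ω}

/-- The finite linear combinations of the family `Z` are centered Gaussian with the variances
given by the kernel `K`. -/
structure IsCenteredGaussianFamily (Z : ι → Ω → ℝ) (K : ι → ι → ℝ) (P : Measure Ω) : Prop where
  aemeasurable : ∀ i, AEMeasurable (Z i) P
  symm : ∀ i j, K i j = K j i
  charFun_eq : ∀ (S : Finset ι) (θ : ι → ℝ) (s : ℝ),
    charFun (P.map fun ω => ∑ i ∈ S, θ i * Z i ω) s =
      Complex.exp (-((s ^ 2 * (∑ i ∈ S, ∑ j ∈ S, θ i * θ j * K i j) / 2 : ℝ) : ℂ))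

namespace IsCenteredGaussianFamily

variable {Z : ι → Ω → ℝ} {K : ι → ι → ℝ}

lemma aemeasurable_sum (h : IsCenteredGaussianFamily Z K P) (S : Finset ι) (θ : ι → ℝ) :
    AEMeasurable (fun ω => ∑ i ∈ S, θ i * Z i ω) P :=
  Finset.aemeasurable_fun_sum _ fun i _ => (h.aemeasurable i).const_mul _

variable [IsProbabilityMeasure P]

/-- A characteristic function has modulus at most `1`, which fixes the sign of the exponent. -/
lemma nonneg (h : IsCenteredGaussianFamily Z K P) (S : Finset ι) (θ : ι → ℝ) :
    0 ≤ ∑ i ∈ S, ∑ j ∈ S, θ i * θ j * K i j := by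
  have := Measure.isProbabilityMeasure_map (h.aemeasurable_sum S θ)
  have h1 := norm_charFun_le_one (μ := P.map fun ω => ∑ i ∈ S, θ i * Z i ω) (t := (1 : ℝ))
  rw [h.charFun_eq, ← Complex.ofReal_neg, Complex.norm_exp, Complex.ofReal_re,
    Real.exp_le_one_iff] at h1
  linarith

lemma map_eq (h : IsCenteredGaussianFamily Z K P) (S : Finset ι) (θ : ι → ℝ) :
    P.map (fun ω => ∑ i ∈ S, θ i * Z i ω) =
      gaussianReal 0 (∑ i ∈ S, ∑ j ∈ S, θ i * θ j * K i j).toNNReal := by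
  have := Measure.isProbabilityMeasure_map (h.aemeasurable_sum S θ)
  refine Measure.ext_of_charFun (funext fun s => ?_)
  rw [h.charFun_eq, charFun_gaussianReal]
  congr 1
  rw [Real.coe_toNNReal _ (h.nonneg S θ)]
  push_cast
  ring

lemma memLp_sum (h : IsCenteredGaussianFamily Z K P) (S : Finset ι) (θ : ι → ℝ) :
    MemLp (fun ω => ∑ i ∈ S, θ i * Z i ω) 2 P := by
  have h1 : MemLp id 2 (P.map fun ω => ∑ i ∈ S, θ i * Z i ω) := by
    rw [h.map_eq]
    exact memLp_id_gaussianReal 2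
  exact (memLp_map_measure_iff (by fun_prop) (h.aemeasurable_sum S θ)).1 h1

lemma memLp (h : IsCenteredGaussianFamily Z K P) (i : ι) : MemLp (Z i) 2 P := by
  simpa using h.memLp_sum {i} fun _ => 1

lemma integral_eq_zero (h : IsCenteredGaussianFamily Z K P) (i : ι) : ∫ ω, Z i ω ∂P = 0 := by
  have h1 : ∫ x, x ∂(P.map fun ω => ∑ i ∈ {i}, 1 * Z i ω) = 0 := by
    rw [h.map_eq {i} fun _ => 1, integral_id_gaussianReal]
  rw [integral_map (h.aemeasurable_sum {i} fun _ => 1) (by fun_prop)] at h1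
  simpa using h1

lemma variance_sum (h : IsCenteredGaussianFamily Z K P) (S : Finset ι) (θ : ι → ℝ) :
    Var[fun ω => ∑ i ∈ S, θ i * Z i ω; P] = ∑ i ∈ S, ∑ j ∈ S, θ i * θ j * K i j := by
  have h1 := variance_id_map (h.aemeasurable_sum S θ)
  rw [h.map_eq, variance_id_gaussianReal, Real.coe_toNNReal _ (h.nonneg S θ)] at h1
  exact h1.symm

lemma covariance_eq (h : IsCenteredGaussianFamily Z K P) (i j : ι) :
    cov[Z i, Z j; P] = K i j := by
  classical
  have h1 : ∀ i, Var[Z i; P] = K i i := fun i => by simpa using h.variance_sum {i} fun _ => 1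
  rcases eq_or_ne i j with rfl | hij
  · rw [covariance_self (h.aemeasurable i), h1]
  have h2 := h.variance_sum {i, j} fun _ => 1
  simp only [Finset.sum_pair hij, one_mul] at h2
  rw [variance_fun_add (h.memLp i) (h.memLp j), h1, h1, h.symm j i] at h2
  linarith

/-- A continuous linear functional on `I → κ → ℝ` is a finite combination of coordinates, and
`map_eq` gives the law of such combinations. -/
lemma isGaussian_process {T κ : Type*} [Fintype κ] {B : T → Ω → κ → ℝ} {K : T × κ → T × κ → ℝ}
    (h : IsCenteredGaussianFamily (fun (i : T × κ) ω => B i.1 ω i.2) K P) :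
    IsGaussianProcess B P where
  hasGaussianLaw I := by
    classical
    have hm : AEMeasurable (fun ω => I.restrict (B · ω)) P :=
      aemeasurable_pi_lambda _ fun t => aemeasurable_pi_lambda _ fun p => h.aemeasurable (t, p)
    refine ⟨isGaussian_of_map_eq_gaussianReal fun L => ?_⟩
    have e : (L ∘ fun ω => I.restrict (B · ω)) = fun ω => ∑ i ∈ I ×ˢ Finset.univ,
        (fun i : T × κ => if hi : i.1 ∈ I then
          L (Pi.single ⟨i.1, hi⟩ (Pi.single i.2 1)) else 0) i * B i.1 ω i.2 := by
      funext ω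
      rw [Finset.sum_product, ← Finset.sum_coe_sort]
      have h2 : I.restrict (B · ω) = ∑ t : I, ∑ p : κ,
          B t ω p • (Pi.single t (Pi.single p 1) : I → κ → ℝ) := by
        funext t p
        simp [Finset.sum_apply, Pi.single_apply, ite_apply, apply_ite]
      rw [Function.comp_apply, h2, map_sum]
      refine Finset.sum_congr rfl fun t _ => ?_
      rw [map_sum]
      refine Finset.sum_congr rfl fun p _ => ?_
      rw [map_smul, smul_eq_mul, mul_comm]
      simp
    exact ⟨0, _, ((AEMeasurable.map_map_of_aemeasurable (by fun_prop) hm).trans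
      (congrArg P.map e)).trans (h.map_eq _ _)⟩

end IsCenteredGaussianFamily

end GaussianFamily

/-! ### Correlated Brownian motions as random sine series -/

section Construction

lemma tendsto_charFun_of_ae_tendsto {Ω : Type*} [MeasurableSpace Ω] {P : Measure Ω}
    [IsProbabilityMeasure P] {f : ℕ → Ω → ℝ} {g : Ω → ℝ} (hf : ∀ n, AEMeasurable (f n) P)
    (hfg : ∀ᵐ ω ∂P, Tendsto (fun n => f n ω) atTop (𝓝 (g ω))) (s : ℝ) :
    Tendsto (fun n => charFun (P.map (f n)) s) atTop (𝓝 (charFun (P.map g) s)) := by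
  have hg : AEMeasurable g P := aemeasurable_of_tendsto_metrizable_ae atTop hf hfg
  have e : ∀ f : Ω → ℝ, AEMeasurable f P →
      charFun (P.map f) s = ∫ ω, Complex.exp (s * f ω * Complex.I) ∂P := fun f hf => by
    rw [charFun_apply_real, integral_map hf (by fun_prop)]
  simp_rw [e _ (hf _), e _ hg]
  refine tendsto_integral_of_dominated_convergence (fun _ => 1)
    (fun n => by have := hf n; fun_prop) (integrable_const _) (fun n => ae_of_all _ fun ω => ?_) ?_
  · rw [← Complex.ofReal_mul, Complex.norm_exp_ofReal_mul_I]
  · filter_upwards [hfg] with ω hω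
    exact (Complex.continuous_exp.tendsto _).comp
      ((((Complex.continuous_ofReal.tendsto _).comp hω).const_mul _).mul_const _)

lemma charFun_map_inner {E : Type*} [NormedAddCommGroup E] [InnerProductSpace ℝ E]
    [MeasurableSpace E] [BorelSpace E] [SecondCountableTopology E] (μ : Measure E) (v : E) (s : ℝ) :
    charFun (μ.map fun x => inner ℝ x v) s = charFun μ (s • v) := by
  rw [charFun_apply_real, charFun_apply, integral_map (by fun_prop) (by fun_prop)]
  simp only [inner_smul_right, Complex.ofReal_mul]

lemma sum_range_sineBlock (f : ℕ → ℝ) (m : ℕ) :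
    ∑ n ∈ Finset.range (16 ^ m), f n = f 0 + ∑ i ∈ Finset.range m, ∑ n ∈ sineBlock i, f n := by
  induction m with
  | zero => simp
  | succ m ih =>
    rw [Finset.sum_range_succ, ← add_assoc, ← ih, sineBlock]
    exact (Finset.sum_range_add_sum_Ico f (Nat.pow_le_pow_right (by norm_num) m.le_succ)).symm

/-- The random sine series `∑ √2 sin(nπx)/(nπ) ε_n`, summed in blocks. -/
noncomputable def sineSeries {Ω : Type*} (ε : ℤ → Ω → ℝ) (ω : Ω) (x : ℝ) : ℝ :=
  ∑' i, sineBlockSum ε i ω x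

/-- The Weierstrass test applies to the blocks. Convergence is asserted only along the lengths `16 ^
m`, which is enough to identify the law of the sum. -/
lemma ae_sineSeries {Ω : Type*} [MeasurableSpace Ω] {P : Measure Ω} {ε : ℤ → Ω → ℝ}
    (h : IsStdNoise P ε) : ∀ᵐ ω ∂P, Continuous (sineSeries ε ω) ∧
      ∀ x, Tendsto (fun m => ∑ n ∈ Finset.range (16 ^ m), sineCoeff n x * ε n ω) atTop
        (𝓝 (sineSeries ε ω x)) := by
  filter_upwards [ae_exists_summable_bound h] with ω ⟨u, hu, hb⟩
  refine ⟨continuous_tsum (fun i => continuous_sineBlockSum ε i ω) hu hb, fun x => ?_⟩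
  have h1 : Summable fun i => sineBlockSum ε i ω x := hu.of_norm_bounded fun i => hb i x
  refine h1.hasSum.tendsto_sum_nat.congr fun m => ?_
  rw [sum_range_sineBlock, sineCoeff_zero, zero_mul, zero_add]
  rfl

variable {κ : Type*} [Fintype κ] [DecidableEq κ]

/-- The law of a sequence of independent centered Gaussian vectors with covariance matrix `ρ`. -/
noncomputable def gaussianNoise (ρ : Matrix κ κ ℝ) : Measure (ℤ → EuclideanSpace ℝ κ) :=
  Measure.infinitePi fun _ => multivariateGaussian 0 ρ

instance (ρ : Matrix κ κ ℝ) : IsProbabilityMeasure (gaussianNoise ρ) := by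
  unfold gaussianNoise
  infer_instance

variable {ρ : Matrix κ κ ℝ}

/-- It makes the almost sure continuity of the sine series available for each coordinate of the
Gaussian vectors. -/
lemma isStdNoise_eval (hρ : ρ.PosSemidef) {p : κ} (hp : ρ p p = 1) :
    IsStdNoise (gaussianNoise ρ) fun n ω => ω n p := by
  have hmp : ∀ n : ℤ, MeasurePreserving (fun ω : ℤ → EuclideanSpace ℝ κ => ω n p)
      (gaussianNoise ρ) (gaussianReal 0 1) := fun n => by
    have h1 := (measurePreserving_eval_multivariateGaussian (μ := 0) hρ (i := p)).comp
      (measurePreserving_eval_infinitePi (fun _ : ℤ => multivariateGaussian 0 ρ) n)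
    rw [hp] at h1
    simpa [Function.comp_def, gaussianNoise] using h1
  have hm := fun n => (hmp n).measurable
  have hid : MemLp id 2 ((gaussianNoise ρ).map fun ω => ω 0 p) := by
    rw [(hmp 0).map_eq]
    exact memLp_id_gaussianReal 2
  refine ⟨hm, ?_, fun n => ⟨(hm n).aemeasurable, (hm 0).aemeasurable, ?_⟩, ?_, ?_, ?_⟩
  · exact iIndepFun_infinitePi (P := fun _ : ℤ => multivariateGaussian 0 ρ)
      (X := fun _ x => x p) fun _ => by fun_prop
  · rw [(hmp n).map_eq, (hmp 0).map_eq]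
  · exact (memLp_map_measure_iff (by fun_prop) (hm 0).aemeasurable).1 hid
  · have h1 := integral_map (hm 0).aemeasurable (μ := gaussianNoise ρ) (f := fun x => x)
      (by fun_prop)
    rw [← h1, (hmp 0).map_eq, integral_id_gaussianReal]
  · rw [← variance_id_map (hm 0).aemeasurable, (hmp 0).map_eq, variance_id_gaussianReal]
    rfl

/-- The sequence of Brownian motions obtained from the sine series of the Brownian bridge. -/
noncomputable def brownianSeries (t : ℝ≥0) (ω : ℤ → EuclideanSpace ℝ κ) (p : κ) : ℝ :=
  (1 + t) * sineSeries (fun n ω => ω n p) ω (t / (1 + t))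

lemma div_one_add_mem_Icc (t : ℝ≥0) : (t : ℝ) / (1 + t) ∈ Set.Icc (0 : ℝ) 1 :=
  ⟨by positivity, by rw [div_le_one (by positivity)]; linarith⟩

/-- The time change `t ↦ t / (1 + t)` with the factor `1 + t` turns the covariance of the Brownian
bridge into that of Brownian motion on the half-line. -/
lemma one_add_mul_min_sub (s t : ℝ≥0) :
    (1 + s : ℝ) * (1 + t) * (min (s / (1 + s) : ℝ) (t / (1 + t)) - s / (1 + s) * (t / (1 + t))) =
      min (s : ℝ) t := by
  have hs : (0 : ℝ) < 1 + s := by positivity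
  have ht : (0 : ℝ) < 1 + t := by positivity
  rcases le_total (s : ℝ) t with h | h
  · rw [min_eq_left h, min_eq_left (by rw [div_le_div_iff₀ hs ht]; linarith)]
    field_simp
    ring
  · rw [min_eq_right h, min_eq_right (by rw [div_le_div_iff₀ ht hs]; linarith)]
    field_simp
    ring

/-- The vector of the coefficients of the `n`-th Gaussian vector in a linear combination. -/
noncomputable def seriesVec (S : Finset (ℝ≥0 × κ)) (θ : ℝ≥0 × κ → ℝ) (n : ℕ) :
    EuclideanSpace ℝ κ :=
  ∑ i ∈ S, (θ i * ((1 + i.1) * sineCoeff n (i.1 / (1 + i.1)))) • EuclideanSpace.single i.2 1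

lemma inner_seriesVec (S : Finset (ℝ≥0 × κ)) (θ : ℝ≥0 × κ → ℝ) (n : ℕ) (x : EuclideanSpace ℝ κ) :
    inner ℝ x (seriesVec S θ n) =
      ∑ i ∈ S, θ i * ((1 + i.1) * (sineCoeff n (i.1 / (1 + i.1)) * x i.2)) := by
  rw [seriesVec, inner_sum]
  refine Finset.sum_congr rfl fun i _ => ?_
  rw [inner_smul_right, EuclideanSpace.inner_single_right]
  simp
  ring

lemma hasSum_seriesVec (S : Finset (ℝ≥0 × κ)) (θ : ℝ≥0 × κ → ℝ) :
    HasSum (fun n => seriesVec S θ n ⬝ᵥ ρ.mulVec (seriesVec S θ n))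
      (∑ i ∈ S, ∑ j ∈ S, θ i * θ j * (min (i.1 : ℝ) j.1 * ρ i.2 j.2)) := by
  have h1 : ∀ n, seriesVec S θ n ⬝ᵥ ρ.mulVec (seriesVec S θ n) = ∑ i ∈ S, ∑ j ∈ S,
      (θ i * θ j * ρ i.2 j.2 * ((1 + i.1) * (1 + j.1))) *
        (sineCoeff n (i.1 / (1 + i.1)) * sineCoeff n (j.1 / (1 + j.1))) := fun n => by
    simp only [seriesVec, WithLp.ofLp_sum, WithLp.ofLp_smul, PiLp.ofLp_single,
      sum_dotProduct, Matrix.mulVec_sum, dotProduct_sum, smul_dotProduct, Matrix.mulVec_smul,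
      dotProduct_smul, single_one_dotProduct, Matrix.mulVec_single_one, Matrix.col_apply,
      smul_eq_mul]
    rw [Finset.sum_comm]
    refine Finset.sum_congr rfl fun i _ => ?_
    rw [Finset.mul_sum]
    refine Finset.sum_congr rfl fun j _ => ?_
    ring
  simp_rw [h1]
  refine hasSum_sum fun i _ => hasSum_sum fun j _ => ?_
  have h2 := (hasSum_sineCoeff_mul (div_one_add_mem_Icc i.1) (div_one_add_mem_Icc j.1)).mul_left
    (θ i * θ j * ρ i.2 j.2 * ((1 + i.1) * (1 + j.1)))
  rw [mul_assoc _ _ (min _ _ - _), one_add_mul_min_sub] at h2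
  convert! h2 using 1
  ring

/-- A linear combination of values is the almost sure limit of sums of independent Gaussian scalars
`⟨ω n, seriesVec S θ n⟩`. Their characteristic functions are explicit, the variances add up to the
required value by `hasSum_seriesVec`, and the limits are compared. -/
theorem isCenteredGaussianFamily_brownianSeries (hρ : ρ.PosSemidef) (hρ1 : ∀ p, ρ p p = 1) :
    IsCenteredGaussianFamily (fun (i : ℝ≥0 × κ) ω => brownianSeries i.1 ω i.2)
      (fun i j => min (i.1 : ℝ) j.1 * ρ i.2 j.2) (gaussianNoise ρ) where
  aemeasurable i := by
    refine AEMeasurable.const_mul ?_ _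
    refine aemeasurable_of_tendsto_metrizable_ae atTop (fun m => ?_)
      ((ae_sineSeries (isStdNoise_eval hρ (hρ1 i.2))).mono fun ω h => h.2 _)
    exact Finset.aemeasurable_fun_sum _ fun n _ =>
      ((isStdNoise_eval hρ (hρ1 i.2)).measurable n).aemeasurable.const_mul _
  symm i j := by
    rw [min_comm]
    congr 1
    simpa using hρ.isHermitian.apply j.2 i.2
  charFun_eq S θ s := by
    set V := fun n => seriesVec S θ n ⬝ᵥ ρ.mulVec (seriesVec S θ n)
    have hlim : ∀ᵐ ω ∂(gaussianNoise ρ), Tendsto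
        (fun m => ∑ n ∈ Finset.range (16 ^ m), inner ℝ (ω (n : ℤ)) (seriesVec S θ n)) atTop
        (𝓝 (∑ i ∈ S, θ i * brownianSeries i.1 ω i.2)) := by
      have h1 := ae_all_iff.2 fun p => ae_sineSeries (isStdNoise_eval hρ (hρ1 p))
      filter_upwards [h1] with ω hω
      simp_rw [inner_seriesVec]
      have h2 := tendsto_finsetSum S fun i _ =>
        (((hω i.2).2 (i.1 / (1 + i.1))).const_mul (1 + i.1 : ℝ)).const_mul (θ i)
      refine h2.congr fun m => ?_
      rw [Finset.sum_comm]
      simp_rw [Finset.mul_sum]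
    have hm : ∀ n : ℕ, Measurable fun ω : ℤ → EuclideanSpace ℝ κ =>
      inner ℝ (ω (n : ℤ)) (seriesVec S θ n) := fun n => by fun_prop
    have h1 := tendsto_charFun_of_ae_tendsto
      (fun m => (Finset.measurable_fun_sum _ fun n _ => hm n).aemeasurable) hlim s
    have hind : iIndepFun (fun (n : ℕ) (ω : ℤ → EuclideanSpace ℝ κ) =>
        inner ℝ (ω (n : ℤ)) (seriesVec S θ n)) (gaussianNoise ρ) := by
      have h2 := iIndepFun_infinitePi (P := fun _ : ℤ => multivariateGaussian 0 ρ)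
        (X := fun (n : ℤ) x => inner ℝ x (seriesVec S θ n.toNat)) fun _ => by fun_prop
      have h3 := h2.precomp (g := fun n : ℕ => (n : ℤ)) Nat.cast_injective
      simp only [Int.toNat_natCast] at h3
      exact h3
    have hone : ∀ n : ℕ, charFun ((gaussianNoise ρ).map fun ω =>
        inner ℝ (ω (n : ℤ)) (seriesVec S θ n)) s = Complex.exp (-((s ^ 2 * V n / 2 : ℝ) : ℂ)) := by
      intro n
      have h2 : (gaussianNoise ρ).map (fun ω => inner ℝ (ω (n : ℤ)) (seriesVec S θ n)) =
          (multivariateGaussian 0 ρ).map fun x => inner ℝ x (seriesVec S θ n) := by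
        rw [← (measurePreserving_eval_infinitePi (fun _ : ℤ => multivariateGaussian 0 ρ) n).map_eq,
          Measure.map_map (by fun_prop) (by fun_prop)]
        rfl
      rw [h2, charFun_map_inner, charFun_multivariateGaussian hρ]
      congr 1
      simp only [V, WithLp.ofLp_smul, smul_dotProduct, dotProduct_smul, Matrix.mulVec_smul,
        inner_zero_right, smul_eq_mul]
      push_cast
      ring
    have h3 : Tendsto (fun m => charFun ((gaussianNoise ρ).map fun ω =>
        ∑ n ∈ Finset.range (16 ^ m), inner ℝ (ω (n : ℤ)) (seriesVec S θ n)) s) atTop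
        (𝓝 (Complex.exp (-((s ^ 2 * (∑ i ∈ S, ∑ j ∈ S,
          θ i * θ j * (min (i.1 : ℝ) j.1 * ρ i.2 j.2)) / 2 : ℝ) : ℂ)))) := by
      have e : ∀ m, charFun ((gaussianNoise ρ).map fun ω =>
          ∑ n ∈ Finset.range (16 ^ m), inner ℝ (ω (n : ℤ)) (seriesVec S θ n)) s =
          Complex.exp (-((s ^ 2 * (∑ n ∈ Finset.range (16 ^ m), V n) / 2 : ℝ) : ℂ)) := fun m => by
        rw [(hind.restrict _).charFun_map_fun_finsetSum_eq_prod fun n _ => (hm n).aemeasurable,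
          Finset.prod_apply, Finset.prod_congr rfl fun n _ => hone n, ← Complex.exp_sum,
          Finset.sum_neg_distrib, ← Complex.ofReal_sum, Finset.mul_sum, Finset.sum_div]
      simp_rw [e]
      have h4 := (hasSum_seriesVec (ρ := ρ) S θ).tendsto_sum_nat.comp
        (tendsto_pow_atTop_atTop_of_one_lt (by norm_num : 1 < 16))
      exact (Complex.continuous_exp.tendsto _).comp ((Complex.continuous_ofReal.tendsto _).comp
        ((h4.const_mul (s ^ 2)).div_const 2)).neg
    exact tendsto_nhds_unique h1 h3

theorem isBrownianReal_brownianSeries (hρ : ρ.PosSemidef) (hρ1 : ∀ p, ρ p p = 1) (p : κ) :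
    IsBrownianReal (fun t ω => brownianSeries t ω p) (gaussianNoise ρ) := by
  have h := isCenteredGaussianFamily_brownianSeries hρ hρ1
  have hG : IsGaussianProcess (fun t ω => brownianSeries t ω p) (gaussianNoise ρ) :=
    h.isGaussian_process.comp_left fun _ => ContinuousLinearMap.proj p
  have hpre := hG.isPreBrownianReal_of_covariance (fun t => h.integral_eq_zero (t, p))
    fun s t hst => by
      have := h.covariance_eq (s, p) (t, p)
      rw [this]
      simp [hρ1, hst]
  exact { hpre with
    cont := by
      filter_upwards [ae_sineSeries (isStdNoise_eval hρ (hρ1 p))] with ω hω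
      unfold brownianSeries
      exact Continuous.mul (by fun_prop) (hω.1.comp
        (Continuous.div (by fun_prop) (by fun_prop) fun t => by positivity)) }

end Construction

end PolyForm

namespace PolyForm

/-! ### Convergence of finite-dimensional distributions and characteristic functions -/

section Criterion

lemma charFun_map_toLp {ι Ω : Type*} [Fintype ι] [MeasurableSpace Ω] {P : Measure Ω}
    {X : ι → Ω → ℝ} (hX : ∀ i, AEMeasurable (X i) P) (θ : EuclideanSpace ℝ ι) :
    charFun (P.map fun ω => WithLp.toLp 2 fun i => X i ω) θ =
      charFun (P.map fun ω => ∑ i, θ i * X i ω) 1 := by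
  have hm : AEMeasurable (fun ω => WithLp.toLp 2 fun i => X i ω) P :=
    (WithLp.measurable_toLp 2 _).comp_aemeasurable (aemeasurable_pi_lambda _ hX)
  rw [charFun_apply, charFun_apply_real, integral_map hm (by fun_prop),
    integral_map (Finset.aemeasurable_fun_sum _ fun i _ => (hX i).const_mul _) (by fun_prop)]
  simp [PiLp.inner_apply]

/-- A Cramér–Wold criterion for the convergence of finite-dimensional distributions. -/
theorem tendstoFDD_of_tendsto_charFun {T κ Ω Ω' : Type*} [Fintype κ] [MeasurableSpace Ω]
    [MeasurableSpace Ω'] {P : Measure Ω} [IsProbabilityMeasure P] {P' : Measure Ω'}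
    [IsProbabilityMeasure P'] {Y : ℕ → T → Ω → κ → ℝ} {B : T → Ω' → κ → ℝ}
    (hY : ∀ N t p, AEMeasurable (fun ω => Y N t ω p) P)
    (hB : ∀ t p, AEMeasurable (fun ω => B t ω p) P')
    (h : ∀ (S : Finset (T × κ)) (θ : T × κ → ℝ),
      Tendsto (fun N => charFun (P.map fun ω => ∑ i ∈ S, θ i * Y N i.1 ω i.2) 1) atTop
        (𝓝 (charFun (P'.map fun ω => ∑ i ∈ S, θ i * B i.1 ω i.2) 1))) :
    TendstoFDD Y B P P' := by
  classical
  intro I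
  set S : Finset (T × κ) := I ×ˢ Finset.univ with hS
  have hmY : ∀ N, AEMeasurable (fun ω => WithLp.toLp 2 fun i : S => Y N i.1.1 ω i.1.2) P :=
    fun N => (WithLp.measurable_toLp 2 _).comp_aemeasurable
      (aemeasurable_pi_lambda _ fun i => hY N _ _)
  have hmB : AEMeasurable (fun ω => WithLp.toLp 2 fun i : S => B i.1.1 ω i.1.2) P' :=
    (WithLp.measurable_toLp 2 _).comp_aemeasurable (aemeasurable_pi_lambda _ fun i => hB _ _)
  have h1 : TendstoInDistribution (fun N ω => WithLp.toLp 2 fun i : S => Y N i.1.1 ω i.1.2) atTop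
      (fun ω => WithLp.toLp 2 fun i : S => B i.1.1 ω i.1.2) (fun _ => P) P' := by
    refine ⟨hmY, hmB, ProbabilityMeasure.tendsto_iff_tendsto_charFun.2 fun θ => ?_⟩
    simp only [ProbabilityMeasure.coe_mk]
    rw [charFun_map_toLp (fun i : S => hB _ _)]
    simp_rw [charFun_map_toLp (fun i : S => hY _ _ _)]
    have e : ∀ f : T × κ → ℝ, ∑ i : S, θ i * f i =
        ∑ i ∈ S, (if hi : i ∈ S then θ ⟨i, hi⟩ else 0) * f i := fun f => by
      rw [← Finset.sum_coe_sort S]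
      simp
    have e1 : ∀ N ω, ∑ i : S, θ i * Y N i.1.1 ω i.1.2 = _ := fun N ω => e fun i => Y N i.1 ω i.2
    have e2 : ∀ ω, ∑ i : S, θ i * B i.1.1 ω i.1.2 = _ := fun ω => e fun i => B i.1 ω i.2
    simp_rw [e1, e2]
    exact h S _
  -- The Euclidean structure serves only the characteristic function criterion; regrouping the
  -- coordinates by time is a continuous map.
  exact h1.continuous_comp (F := I → κ → ℝ)
    (g := fun (x : EuclideanSpace ℝ S) t p => x ⟨(t, p), by simp [hS]⟩)
    (continuous_pi fun t => continuous_pi fun p => by fun_prop)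

end Criterion

/-! ### Second-order asymptotics of the partial sums -/

lemma floor_mul_eq (N : ℕ) (t : ℝ≥0) : ⌊(N : ℝ≥0) * t⌋₊ = ⌊(t : ℝ) * N⌋₊ := by
  rw [mul_comm]
  exact Nonneg.nat_floor_coe (α := ℝ) (t * (N : ℝ≥0))

lemma floor_mul_le (N : ℕ) (t : ℝ≥0) : (⌊(N : ℝ≥0) * t⌋₊ : ℝ) ≤ t * N := by
  rw [floor_mul_eq]
  exact Nat.floor_le (by positivity)

lemma tendsto_floor_mul_div (t : ℝ≥0) :
    Tendsto (fun N : ℕ => (⌊(N : ℝ≥0) * t⌋₊ : ℝ) / N) atTop (𝓝 t) := by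
  simp_rw [floor_mul_eq]
  exact (tendsto_nat_floor_mul_div_atTop t.2).comp tendsto_natCast_atTop_atTop

section PartialSums

variable {Ω : Type*} [MeasurableSpace Ω] {P : Measure Ω} {ε : ℤ → Ω → ℝ}

/-- The long-run covariance `∑ₙ Cov(X(n), X'(0))`. -/
noncomputable def longRunCov (P : Measure Ω) (ε : ℤ → Ω → ℝ) (b : ℤ → ℝ) (k : ℕ) (b' : ℤ → ℝ)
    (k' : ℕ) : ℝ :=
  ∑' n : ℤ, inner ℝ (formVec P ε b k n) (formVec P ε b' k' 0)

variable {b b' : ℤ → ℝ} {k k' : ℕ} {c d c' d' : ℝ}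

lemma tendsto_inner_sumVec (h : IsStdNoise P ε) (hk : 0 < k) (hk' : 0 < k')
    (hb : DecayBound b k c d) (hb' : DecayBound b' k' c' d') {M M' : ℕ → ℕ} {s t : ℝ}
    (hM : Tendsto (fun N => (M N : ℝ) / N) atTop (𝓝 s))
    (hM' : Tendsto (fun N => (M' N : ℝ) / N) atTop (𝓝 t)) :
    Tendsto (fun N : ℕ => inner ℝ (sumVec P ε b k (M N)) (sumVec P ε b' k' (M' N)) / N) atTop
      (𝓝 (min s t * longRunCov P ε b k b' k')) := by
  refine (tendsto_average_sub (summable_abs_inner_formVec h hk hk' hb hb') hM hM').congr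
    fun N => ?_
  simp_rw [sumVec, sum_inner, inner_sum]
  congr 1
  exact Finset.sum_congr rfl fun n _ => Finset.sum_congr rfl fun m _ =>
    (inner_formVec_shift h hk hk' hb hb' n m).symm

lemma tendsto_natCast_div_self : Tendsto (fun N : ℕ => (N : ℝ) / N) atTop (𝓝 1) := by
  refine tendsto_const_nhds.congr' ?_
  filter_upwards [eventually_gt_atTop 0] with N hN
  exact (div_self (by positivity)).symm

/-- Both sides are limits of the inner products of the partial sums up to `N`, divided by `N`, which
are symmetric. -/
lemma longRunCov_comm (h : IsStdNoise P ε) (hk : 0 < k) (hk' : 0 < k')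
    (hb : DecayBound b k c d) (hb' : DecayBound b' k' c' d') :
    longRunCov P ε b k b' k' = longRunCov P ε b' k' b k := by
  have h1 := tendsto_inner_sumVec h hk hk' hb hb' tendsto_natCast_div_self tendsto_natCast_div_self
  have h2 := tendsto_inner_sumVec h hk' hk hb' hb tendsto_natCast_div_self tendsto_natCast_div_self
  simp_rw [real_inner_comm] at h2
  simpa using tendsto_nhds_unique h1 h2

lemma partialSum_ae_eq (h : IsStdNoise P ε) (a : ℕ+ → ℝ) (A : ℕ → ℝ) (N : ℕ) (t : ℝ≥0) :
    partialSum A (process P ε a k) N t =ᵐ[P]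
      ⇑((A N)⁻¹ • sumVec P ε (extendZero a) k ⌊(N : ℝ≥0) * t⌋₊) := by
  filter_upwards [Lp.coeFn_smul (A N)⁻¹ (sumVec P ε (extendZero a) k ⌊(N : ℝ≥0) * t⌋₊),
    Lp.coeFn_finsetSum (Finset.Icc 1 ⌊(N : ℝ≥0) * t⌋₊) fun n : ℕ =>
      formVec P ε (extendZero a) k (n : ℤ)] with ω h1 h2
  rw [h1, Pi.smul_apply, sumVec, h2, partialSum, Finset.sum_apply, one_div, smul_eq_mul]
  simp_rw [process_eq_formVec h]

/-- The matrix of the normalized long-run covariances is positive semidefinite. -/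
lemma posSemidef_longRunCov {κ : Type*} [Fintype κ] (h : IsStdNoise P ε) {k : κ → ℕ}
    (hk : ∀ p, 0 < k p) {b : κ → ℤ → ℝ} {c d : κ → ℝ}
    (hb : ∀ p, DecayBound (b p) (k p) (c p) (d p)) (σ : κ → ℝ) :
    (Matrix.of fun p q => longRunCov P ε (b p) (k p) (b q) (k q) / (σ p * σ q)).PosSemidef := by
  refine Matrix.PosSemidef.of_dotProduct_mulVec_nonneg ?_ fun x => ?_
  · ext p q
    simp [longRunCov_comm h (hk q) (hk p) (hb q) (hb p), mul_comm]
  · have h1 := tendsto_finsetSum Finset.univ fun p _ => tendsto_finsetSum Finset.univ fun q _ =>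
      (tendsto_inner_sumVec h (hk p) (hk q) (hb p) (hb q) tendsto_natCast_div_self
        tendsto_natCast_div_self).const_mul (x p / σ p * (x q / σ q))
    have e : star x ⬝ᵥ (Matrix.of fun p q =>
        longRunCov P ε (b p) (k p) (b q) (k q) / (σ p * σ q)).mulVec x =
        ∑ p, ∑ q, x p / σ p * (x q / σ q) *
          (min 1 1 * longRunCov P ε (b p) (k p) (b q) (k q)) := by
      simp only [dotProduct, Matrix.mulVec, Matrix.of_apply, Finset.mul_sum, min_self, one_mul,
        star_trivial]
      refine Finset.sum_congr rfl fun p _ => Finset.sum_congr rfl fun q _ => ?_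
      rw [div_eq_mul_inv, div_eq_mul_inv, div_eq_mul_inv, mul_inv]
      ring
    rw [e]
    -- Before the limit the quadratic form is a Gram form, the squared norm of a combination of
    -- partial sums divided by `N`.
    refine ge_of_tendsto' h1 fun N => ?_
    have e2 : ∑ p, ∑ q, x p / σ p * (x q / σ q) *
        (inner ℝ (sumVec P ε (b p) (k p) N) (sumVec P ε (b q) (k q) N) / N) =
        ‖∑ p, (x p / σ p) • sumVec P ε (b p) (k p) N‖ ^ 2 / N := by
      rw [← real_inner_self_eq_norm_sq]
      simp_rw [sum_inner, inner_sum, inner_smul_left, inner_smul_right, conj_trivial,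
        Finset.sum_div]
      refine Finset.sum_congr rfl fun p _ => Finset.sum_congr rfl fun q _ => ?_
      ring
    rw [e2]
    positivity

variable [IsProbabilityMeasure P]

lemma crossCov_eq_inner (h : IsStdNoise P ε) {a a' : ℕ+ → ℝ} (hk : 0 < k)
    (hb : DecayBound (extendZero a) k c d) (n : ℤ) :
    crossCov P ε a k a' k' n =
      inner ℝ (formVec P ε (extendZero a) k n) (formVec P ε (extendZero a') k' 0) := by
  rw [crossCov, process_eq_formVec h, process_eq_formVec h,
    covariance_coe_Lp _ _ (integral_formVec h hk (hb.summable_coeff_sq hk n))]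

lemma variance_partialSum (h : IsStdNoise P ε) {a : ℕ+ → ℝ} (hk : 0 < k)
    (hb : DecayBound (extendZero a) k c d) (A : ℕ → ℝ) (N : ℕ) :
    Var[partialSum A (process P ε a k) N 1; P] =
      ‖sumVec P ε (extendZero a) k N‖ ^ 2 / A N ^ 2 := by
  rw [variance_congr (partialSum_ae_eq h a A N 1), mul_one, Nat.floor_natCast,
    ← covariance_self (Lp.aestronglyMeasurable _).aemeasurable, covariance_coe_Lp,
    real_inner_self_eq_norm_sq, norm_smul, mul_pow, norm_inv, inv_pow, Real.norm_eq_abs, sq_abs,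
    div_eq_inv_mul]
  have h0 : ∫ ω, sumVec P ε (extendZero a) k N ω ∂P = 0 := by
    rw [sumVec, integral_coe_finsetSum]
    exact Finset.sum_eq_zero fun n _ => integral_formVec h hk (hb.summable_coeff_sq hk n)
  rw [integral_congr_ae (Lp.coeFn_smul _ _)]
  simp only [Pi.smul_apply, integral_smul, h0, smul_zero]

/-- Dividing the normalized variance, which tends to `1`, by the squared norm of the partial sum
over `N`, which tends to the long-run variance, leaves `N / A N ^ 2`. Positivity of `A N` selects
the root. -/
lemma tendsto_sqrt_div_norming (h : IsStdNoise P ε) {a : ℕ+ → ℝ} (hk : 0 < k)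
    (hb : DecayBound (extendZero a) k c d) {A : ℕ → ℝ} (hA : ∀ᶠ N in atTop, 0 < A N)
    (hV : Tendsto (fun N => Var[partialSum A (process P ε a k) N 1; P]) atTop (𝓝 1))
    (hpos : 0 < longRunCov P ε (extendZero a) k (extendZero a) k) :
    Tendsto (fun N : ℕ => √N / A N) atTop
      (𝓝 (√(longRunCov P ε (extendZero a) k (extendZero a) k))⁻¹) := by
  set g := longRunCov P ε (extendZero a) k (extendZero a) k
  have h1 : Tendsto (fun N : ℕ => ‖sumVec P ε (extendZero a) k N‖ ^ 2 / N) atTop (𝓝 g) := by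
    have := tendsto_inner_sumVec h hk hk hb hb tendsto_natCast_div_self tendsto_natCast_div_self
    simpa [real_inner_self_eq_norm_sq] using this
  have h2 := ((hV.div h1 hpos.ne').sqrt)
  rw [Real.sqrt_div zero_le_one, Real.sqrt_one, one_div] at h2
  refine h2.congr' ?_
  filter_upwards [hA, h1.eventually_const_lt hpos] with N hN hgN
  rw [Pi.div_apply, variance_partialSum h hk hb]
  have hn : ‖sumVec P ε (extendZero a) k N‖ ≠ 0 := fun h0 => by simp [h0] at hgN
  have e : ‖sumVec P ε (extendZero a) k N‖ ^ 2 / A N ^ 2 /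
      (‖sumVec P ε (extendZero a) k N‖ ^ 2 / N) = N / A N ^ 2 := by
    field_simp
  rw [e, Real.sqrt_div (Nat.cast_nonneg N), Real.sqrt_sq hN.le]

lemma isEquivalent_norming {A : ℕ → ℝ} {σ : ℝ} (hσ : 0 < σ)
    (h : Tendsto (fun N : ℕ => √N / A N) atTop (𝓝 σ⁻¹)) :
    Asymptotics.IsEquivalent atTop A fun N => σ * √(N : ℝ) := by
  refine Asymptotics.isEquivalent_of_tendsto_one ?_
  have h1 := (h.const_mul σ).inv₀ (by rw [mul_inv_cancel₀ hσ.ne']; exact one_ne_zero)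
  rw [mul_inv_cancel₀ hσ.ne', inv_one] at h1
  refine h1.congr fun N => ?_
  rw [Pi.div_apply, ← mul_div_assoc, inv_div]

/-- `F` carries the given normalization and `G` replaces `A p N` by `σ p * √N`. Their `L²` distance
vanishes because `√N / A p N - (σ p)⁻¹` tends to zero while the norms of the partial sums over `√N`
converge. The central limit theorem is applied to `G`, and `‖G N‖ ^ 2` converges to the limiting
variance. -/
theorem tendsto_charFun_sum_partialSum {κ : Type*} (h : IsStdNoise P ε) {k : κ → ℕ}
    (hk : ∀ p, 0 < k p) {a : κ → ℕ+ → ℝ} {c d : κ → ℝ}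
    (hb : ∀ p, DecayBound (extendZero (a p)) (k p) (c p) (d p)) {A : κ → ℕ → ℝ} {σ : κ → ℝ}
    (hA : ∀ p, Tendsto (fun N : ℕ => √N / A p N) atTop (𝓝 (σ p)⁻¹)) (S : Finset (ℝ≥0 × κ))
    (θ : ℝ≥0 × κ → ℝ) :
    Tendsto (fun N => charFun (P.map fun ω => ∑ i ∈ S, θ i *
        partialSum (A i.2) (process P ε (a i.2) (k i.2)) N i.1 ω) 1) atTop
      (𝓝 (Complex.exp (-((1 ^ 2 * (∑ i ∈ S, ∑ j ∈ S, θ i * θ j * (min (i.1 : ℝ) j.1 *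
        (longRunCov P ε (extendZero (a i.2)) (k i.2) (extendZero (a j.2)) (k j.2) /
          (σ i.2 * σ j.2)))) / 2 : ℝ) : ℂ)))) := by
  set W : ℝ≥0 × κ → ℕ → Lp ℝ 2 P := fun i N =>
    sumVec P ε (extendZero (a i.2)) (k i.2) ⌊(N : ℝ≥0) * i.1⌋₊ with hW
  set F : ℕ → Lp ℝ 2 P := fun N => ∑ i : S, θ i • (A i.1.2 N)⁻¹ • W i N with hF
  set G : ℕ → Lp ℝ 2 P := fun N => (√(N : ℝ))⁻¹ • ∑ i : S, (θ i * (σ i.1.2)⁻¹) • W i N with hG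
  have hWW : ∀ i j : ℝ≥0 × κ, Tendsto (fun N : ℕ => inner ℝ (W i N) (W j N) / N) atTop
      (𝓝 (min (i.1 : ℝ) j.1 *
        longRunCov P ε (extendZero (a i.2)) (k i.2) (extendZero (a j.2)) (k j.2))) := fun i j =>
    tendsto_inner_sumVec h (hk _) (hk _) (hb _) (hb _) (tendsto_floor_mul_div _)
      (tendsto_floor_mul_div _)
  have e1 : ∀ N, charFun (P.map fun ω => ∑ i ∈ S, θ i *
      partialSum (A i.2) (process P ε (a i.2) (k i.2)) N i.1 ω) 1 = charFun (P.map (F N)) 1 := by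
    intro N
    congr 1
    refine Measure.map_congr ?_
    have h1 : ∀ᵐ ω ∂P, ∀ i : S, partialSum (A i.1.2) (process P ε (a i.1.2) (k i.1.2)) N i.1.1 ω =
        ((A i.1.2 N)⁻¹ • W i N : Lp ℝ 2 P) ω :=
      ae_all_iff.2 fun i => partialSum_ae_eq h (a i.1.2) (A i.1.2) N i.1.1
    have h2 : ∀ᵐ ω ∂P, ∀ i : S, (θ i • (A i.1.2 N)⁻¹ • W i N : Lp ℝ 2 P) ω =
        θ i * ((A i.1.2 N)⁻¹ • W i N : Lp ℝ 2 P) ω :=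
      ae_all_iff.2 fun i => Lp.coeFn_smul (θ i) ((A i.1.2 N)⁻¹ • W i N : Lp ℝ 2 P)
    filter_upwards [h1, h2, Lp.coeFn_finsetSum Finset.univ fun i : S =>
      θ i • (A i.1.2 N)⁻¹ • W i N] with ω h1 h2 h3
    rw [h3, Finset.sum_apply, ← Finset.sum_coe_sort]
    exact Finset.sum_congr rfl fun i _ => by rw [h1, h2]
  have hCG := tendsto_charFun_sumVec (R := S) h (fun i => hk i.1.2)
    (fun i => fun n hn => extendZero_of_nonpos (a i.1.2) hn) (fun i => hb i.1.2)
    (fun i => θ i * (σ i.1.2)⁻¹) (M := fun i N => ⌊(N : ℝ≥0) * i.1.1⌋₊)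
    (C := ∑ i : S, (i.1.1 : ℝ)) (by positivity) fun i N => (floor_mul_le N i.1.1).trans (by
      gcongr
      exact Finset.single_le_sum (f := fun i : S => (i.1.1 : ℝ)) (fun i _ => by positivity)
        (Finset.mem_univ i))
  have hnG : Tendsto (fun N => ‖G N‖ ^ 2) atTop (𝓝 (∑ i ∈ S, ∑ j ∈ S, θ i * θ j *
      (min (i.1 : ℝ) j.1 *
        (longRunCov P ε (extendZero (a i.2)) (k i.2) (extendZero (a j.2)) (k j.2) /
          (σ i.2 * σ j.2))))) := by
    have h1 := tendsto_finsetSum S fun i _ => tendsto_finsetSum S fun j _ =>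
      (hWW i j).const_mul (θ i * (σ i.2)⁻¹ * (θ j * (σ j.2)⁻¹))
    convert! h1 using 2
    · rename_i N
      rw [← real_inner_self_eq_norm_sq, hG]
      simp_rw [inner_smul_left, inner_smul_right, sum_inner, inner_sum, inner_smul_left,
        inner_smul_right]
      simp only [conj_trivial]
      rw [← mul_assoc, ← mul_inv, Real.mul_self_sqrt (Nat.cast_nonneg N), Finset.mul_sum,
        ← Finset.sum_coe_sort S]
      refine Finset.sum_congr rfl fun i _ => ?_
      rw [Finset.mul_sum, ← Finset.sum_coe_sort S]
      refine Finset.sum_congr rfl fun j _ => ?_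
      ring
    · refine Finset.sum_congr rfl fun i _ => Finset.sum_congr rfl fun j _ => ?_
      rw [div_eq_mul_inv, mul_inv]
      ring
  have hFG : Tendsto (fun N => ‖F N - G N‖) atTop (𝓝 0) := by
    have h1 : Tendsto (fun N : ℕ => ∑ i : S, |θ i| * (|√N / A i.1.2 N - (σ i.1.2)⁻¹| *
        √(inner ℝ (W i N) (W i N) / N))) atTop (𝓝 0) := by
      have := tendsto_finsetSum Finset.univ fun (i : S) _ =>
        ((((hA i.1.2).sub_const (σ i.1.2)⁻¹).abs).mul (hWW i i).sqrt).const_mul |θ i|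
      simpa using this
    refine squeeze_zero' (Eventually.of_forall fun _ => norm_nonneg _) ?_ h1
    filter_upwards [eventually_gt_atTop 0] with N hN
    have hsN : √(N : ℝ) ≠ 0 := by positivity
    have e2 : F N - G N = ∑ i : S, θ i • (√N / A i.1.2 N - (σ i.1.2)⁻¹) • (√(N : ℝ))⁻¹ • W i N := by
      rw [hF, hG]
      dsimp only
      rw [Finset.smul_sum, ← Finset.sum_sub_distrib]
      refine Finset.sum_congr rfl fun i _ => ?_
      rw [smul_smul, smul_smul, smul_smul, smul_smul, ← sub_smul]
      congr 1
      field_simp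
    rw [e2]
    refine norm_sum_le_of_le _ fun i _ => ?_
    rw [norm_smul, norm_smul, norm_smul, Real.norm_eq_abs, Real.norm_eq_abs,
      real_inner_self_eq_norm_sq, Real.sqrt_div (sq_nonneg _), Real.sqrt_sq (norm_nonneg _),
      norm_inv, Real.norm_of_nonneg (Real.sqrt_nonneg _),
      div_eq_inv_mul _ √(N : ℝ)]
  have hCF : Tendsto (fun N => charFun (P.map (F N)) 1 - charFun (P.map (G N)) 1) atTop (𝓝 0) := by
    refine squeeze_zero_norm (fun N => ?_) hFG
    simpa using norm_charFun_sub_le (F N) (G N) 1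
  simp_rw [e1]
  have h3 : Tendsto (fun N => Complex.exp (-((‖G N‖ ^ 2 / 2 : ℝ) : ℂ))) atTop _ :=
    (Complex.continuous_exp.tendsto _).comp
      (((Complex.continuous_ofReal.tendsto _).comp (hnG.div_const 2)).neg)
  have h4 := (hCF.add hCG).add h3
  rw [zero_add, zero_add] at h4
  rw [one_pow, one_mul]
  refine h4.congr fun N => ?_
  ring

end PartialSums

end PolyForm

theorem mainTheorem2 {Ω : Type*} [MeasurableSpace Ω] (P : Measure Ω) [IsProbabilityMeasure P]
    (ε : ℤ → Ω → ℝ) (hε : PolyForm.IsStdNoise P ε)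
    (J : ℕ) (k : Fin J → ℕ) (hk : ∀ j, 0 < k j) (a : Fin J → ℕ+ → ℝ)
    (hSRD : ∀ j, PolyForm.IsSRD P ε (a j) (k j))
    (A : Fin J → ℕ → ℝ) (hA_pos : ∀ j, ∀ᶠ N in atTop, 0 < A j N)
    (hA : ∀ j, Tendsto
      (fun N => Var[PolyForm.partialSum (A j) (PolyForm.process P ε (a j) (k j)) N 1; P])
      atTop (𝓝 1))
    (γ : Fin J → Fin J → ℤ → ℝ)
    (hγ : ∀ p q n, γ p q n = PolyForm.crossCov P ε (a p) (k p) (a q) (k q) n)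
    (σ : Fin J → ℝ) (hσ : ∀ p, σ p = √(∑' n : ℤ, γ p p n)) :
    (∀ p q, Summable (fun n : ℤ => |γ p q n|)) ∧
    (∃ (Ω' : Type) (_ : MeasurableSpace Ω') (P' : Measure Ω') (_ : IsProbabilityMeasure P')
        (B : ℝ≥0 → Ω' → Fin J → ℝ),
      IsGaussianProcess B P' ∧
      (∀ p, IsBrownianReal (fun t ω => B t ω p) P') ∧
      (∀ (p q : Fin J) (s t : ℝ≥0), cov[fun ω => B s ω p, fun ω => B t ω q; P'] =
        (min s t : ℝ≥0) * ((∑' n : ℤ, γ p q n) / (σ p * σ q))) ∧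
      PolyForm.TendstoFDD
        (fun N t ω j =>
          PolyForm.partialSum (A j) (PolyForm.process P ε (a j) (k j)) N t ω) B P P') ∧
    (∀ j, Asymptotics.IsEquivalent atTop (A j) (fun N => σ j * √(N : ℝ))) := by
  choose d hd c hc0 hac using fun j => (hSRD j).1
  have hb : ∀ j, PolyForm.DecayBound (PolyForm.extendZero (a j)) (k j) (c j) (d j) := fun j =>
    ⟨hc0 j, hd j, PolyForm.abs_extendZero_le (hac j)⟩
  have hγ' : ∀ p q n, γ p q n = inner ℝ (PolyForm.formVec P ε (PolyForm.extendZero (a p)) (k p) n)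
      (PolyForm.formVec P ε (PolyForm.extendZero (a q)) (k q) 0) := fun p q n =>
    (hγ p q n).trans (PolyForm.crossCov_eq_inner hε (hk p) (hb p) n)
  set g : Fin J → Fin J → ℝ := fun p q => PolyForm.longRunCov P ε (PolyForm.extendZero (a p)) (k p)
    (PolyForm.extendZero (a q)) (k q) with hg
  have hγg : ∀ p q, ∑' n, γ p q n = g p q := fun p q => tsum_congr (hγ' p q)
  have hgpos : ∀ p, 0 < g p p := fun p => by
    rw [← hγg, tsum_congr (hγ p p)]
    exact (hSRD p).2
  have hσ' : ∀ p, σ p = √(g p p) := fun p => by rw [hσ, hγg]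
  have hσpos : ∀ p, 0 < σ p := fun p => by
    rw [hσ']
    exact Real.sqrt_pos.2 (hgpos p)
  have hAσ : ∀ p, Tendsto (fun N : ℕ => √N / A p N) atTop (𝓝 (σ p)⁻¹) := fun p => by
    rw [hσ']
    exact PolyForm.tendsto_sqrt_div_norming hε (hk p) (hb p) (hA_pos p) (hA p) (hgpos p)
  -- The correlation matrix of the limit; its diagonal is `1` because `σ p ^ 2 = g p p`, which makes
  -- each component a standard Brownian motion.
  set ρ : Matrix (Fin J) (Fin J) ℝ := Matrix.of fun p q => g p q / (σ p * σ q) with hρdef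
  have hρ : ρ.PosSemidef := PolyForm.posSemidef_longRunCov hε hk hb σ
  have hρ1 : ∀ p, ρ p p = 1 := fun p => by
    rw [hρdef, Matrix.of_apply, hσ', Real.mul_self_sqrt (hgpos p).le, div_self (hgpos p).ne']
  have hB := PolyForm.isCenteredGaussianFamily_brownianSeries hρ hρ1
  refine ⟨fun p q => ?_, ⟨ℤ → EuclideanSpace ℝ (Fin J), inferInstance, PolyForm.gaussianNoise ρ,
    inferInstance, PolyForm.brownianSeries, hB.isGaussian_process,
    PolyForm.isBrownianReal_brownianSeries hρ hρ1, fun p q s t => ?_, ?_⟩,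
    fun j => PolyForm.isEquivalent_norming (hσpos j) (hAσ j)⟩
  · simp_rw [hγ']
    exact PolyForm.summable_abs_inner_formVec hε (hk p) (hk q) (hb p) (hb q)
  · rw [hB.covariance_eq (s, p) (t, q), hγg, NNReal.coe_min]
    rfl
  · refine PolyForm.tendstoFDD_of_tendsto_charFun (fun N t p => ?_)
      (fun t p => hB.aemeasurable (t, p)) fun S θ => ?_
    · exact (Lp.aestronglyMeasurable _).aemeasurable.congr
        (PolyForm.partialSum_ae_eq hε (a p) (A p) N t).symm
    · rw [hB.charFun_eq S θ 1]
      exact PolyForm.tendsto_charFun_sum_partialSum hε hk hb hAσ S θ
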